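/- Let $N\ge 1$ be an integer, $p>0$, $\alpha\in\mathbb R\setminus\{0\}$, $K\in\{0,\dots,[(N-1)/2]\}$ and $\omega>\frac{\alpha^2}{(N-2K)^2}$. Let $\Gamma$ be the star graph with $N$ half-lines $(0,\infty)$ and $L^2(\Gamma)=\bigoplus_{j=1}^N L^2(0,\infty)$. Let $\Delta\Psi=(\psi_1'',\dots,\psi_N'')$ with domain $$\mathcal D(\Delta)=\Big\{\Psi\in\bigoplus_{j=1}^N H^2(0,\infty):\ \psi_1(0)=\dots=\psi_N(0),\ \sum_{j=1}^N\psi_j'(0)=\alpha\,\psi_1(0)\Big\}.$$ Put $\phi_\omega(x)=\omega^{\frac1{2p}}\operatorname{sech}^{\frac1p}(p\sqrt\omega\,x)$ and $a_K=\frac{1}{p\sqrt\omega}\operatorname{artanh}\!\Big(\frac{\alpha}{(N-2K)\sqrt\omega}\Big)$. Let the stationary state $\Phi_{\omega,K}$ be the function on $\Gamma$ whose components are $\phi_\omega(x+a_K)$ on $K$ of the edges and $\phi_\omega(x-a_K)$ on the other $N-K$ edges (the choice of the $K$ edges is arbitrary). Let $L_+$ and $L_-$ be the operators in $L^2(\Gamma)$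 with domain $\mathcal D(\Delta)$ given by $$L_+=-\Delta+\omega-(2p+1)(p+1)\Phi_{\omega,K}^{2p},\qquad L_-=-\Delta+\omega-(p+1)\Phi_{\omega,K}^{2p}.$$ Denote by $n(L_\pm)$ the number of negative eigenvalues of $L_\pm$, counted with multiplicity (the dimension of the eigenspace), and by $z(L_\pm)$ the multiplicity of $0$ as an eigenvalue of $L_\pm$. Here multiplicity $0$ means that the number is not an eigenvalue. Then: (i) $z(L_-)=1$ and $n(L_-)=0$; (ii) $z(L_+)=0$, and $n(L_+)=K+1$ if $\alpha<0$, while $n(L_+)=N-K$ if $\alpha>0$. In addition: - if $\alpha<0$ and $K\ge1$, there are $\lambda_1<\lambda_*<\lambda_2<0$ such that $\lambda_1$ and $\lambda_2$ are simple eigenvalues of $L_+$, $\lambda_*$ has multiplicity $K-1$, and $L_+$ has no other negative eigenvalue; - if $\alpha>0$, there are $\lambda_1<\lambda_{**}<0$ such that $\lambda_1$ is a simple eigenvalue of $L_+$, $\lambda_{**}$ has multiplicity $N-K-1$, and $L_+$ has no other negative eigenvalue. -/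

import Mathlib

open MeasureTheory Set

namespace StarGraph

noncomputable section

/-- Lebesgue measure on the half-line `(0, ∞)`. -/
abbrev halfLine : Measure ℝ := volume.restrict (Ioi 0)

/-- The complex Hilbert space `L²(0, ∞)`. -/
abbrev L2Edge : Type := Lp ℂ 2 halfLine

/-- The Hilbert space `L²(Γ) = ⨁ⱼ L²(0, ∞)` of the star graph with `N` edges. -/
abbrev L2Graph (N : ℕ) : Type := PiLp 2 (fun _ : Fin N => L2Edge)

/-- A test function on `(0, ∞)`: smooth, with compact support contained in `(0, ∞)`. -/
structure IsTestFunction (η : ℝ → ℝ) : Prop where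
  smooth : ContDiff ℝ (⊤ : ℕ∞) η
  compact : HasCompactSupport η
  support : tsupport η ⊆ Ioi 0

/-- `g ∈ L²(0, ∞)` is the weak derivative of `f ∈ L²(0, ∞)`. -/
def HasWeakDeriv (f g : L2Edge) : Prop :=
  ∀ η : ℝ → ℝ, IsTestFunction η →
    ∫ x in Ioi (0 : ℝ), deriv η x • f x = - ∫ x in Ioi (0 : ℝ), η x • g x

/-- `c` is the boundary value at the vertex of `f`: the value at `0` of a representative of `f`
that is continuous on `[0, ∞)`. -/
def HasTrace (f : L2Edge) (c : ℂ) : Prop :=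
  ∃ F : ℝ → ℂ, ContinuousOn F (Ici 0) ∧ F =ᵐ[halfLine] f ∧ F 0 = c

lemma integrable_test {η : ℝ → ℝ} (hη : IsTestFunction η) (f : L2Edge) :
    Integrable (fun x => η x • f x) halfLine := by
  have h1 : MemLp η 2 halfLine :=
    hη.smooth.continuous.memLp_of_hasCompactSupport hη.compact
  exact memLp_one_iff_integrable.1 ((Lp.memLp f).smul h1)

lemma integrable_deriv_test {η : ℝ → ℝ} (hη : IsTestFunction η) (f : L2Edge) :
    Integrable (fun x => deriv η x • f x) halfLine := by
  have h1 : MemLp (deriv η) 2 halfLine :=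
    (hη.smooth.continuous_deriv (by simp)).memLp_of_hasCompactSupport hη.compact.deriv
  exact memLp_one_iff_integrable.1 ((Lp.memLp f).smul h1)

lemma HasWeakDeriv.zero : HasWeakDeriv 0 0 := by
  intro η _
  have h0 : ∀ᵐ x ∂halfLine, (0 : L2Edge) x = 0 := Lp.coeFn_zero ℂ 2 halfLine
  rw [integral_congr_ae (g := fun _ => 0) (h0.mono fun x hx => by simp only [hx, smul_zero]),
    integral_congr_ae (f := fun x => η x • (0 : L2Edge) x) (g := fun _ => 0)
      (h0.mono fun x hx => by simp only [hx, smul_zero])]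
  simp

lemma HasWeakDeriv.add {f g f₂ g₂ : L2Edge} (h : HasWeakDeriv f g) (h₂ : HasWeakDeriv f₂ g₂) :
    HasWeakDeriv (f + f₂) (g + g₂) := by
  intro η hη
  rw [integral_congr_ae (g := fun x => deriv η x • f x + deriv η x • f₂ x)
      ((Lp.coeFn_add f f₂).mono fun x hx => by simp only [hx, Pi.add_apply, smul_add]),
    integral_congr_ae (f := fun x => η x • (g + g₂ : L2Edge) x)
      (g := fun x => η x • g x + η x • g₂ x)
      ((Lp.coeFn_add g g₂).mono fun x hx => by simp only [hx, Pi.add_apply, smul_add]),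
    integral_add (integrable_deriv_test hη f) (integrable_deriv_test hη f₂),
    integral_add (integrable_test hη g) (integrable_test hη g₂), h η hη, h₂ η hη]
  ring

lemma HasWeakDeriv.smul {f g : L2Edge} (c : ℂ) (h : HasWeakDeriv f g) :
    HasWeakDeriv (c • f) (c • g) := by
  intro η hη
  rw [integral_congr_ae (g := fun x => c • (deriv η x • f x))
      ((Lp.coeFn_smul c f).mono fun x hx => by simp only [hx, Pi.smul_apply, smul_comm c]),
    integral_congr_ae (f := fun x => η x • (c • g : L2Edge) x) (g := fun x => c • (η x • g x))
      ((Lp.coeFn_smul c g).mono fun x hx => by simp only [hx, Pi.smul_apply, smul_comm c]),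
    integral_smul, integral_smul, h η hη, smul_neg]

lemma HasWeakDeriv.eq_zero {g : L2Edge} (h : HasWeakDeriv 0 g) : g = 0 := by
  have h0 : ∀ᵐ x ∂halfLine, (0 : L2Edge) x = 0 := Lp.coeFn_zero ℂ 2 halfLine
  have hloc : LocallyIntegrable g halfLine :=
    (Lp.memLp g).locallyIntegrable (by norm_num)
  have key : ∀ᵐ x ∂halfLine, x ∈ Ioi (0 : ℝ) → g x = 0 := by
    refine isOpen_Ioi.ae_eq_zero_of_integral_contDiff_smul_eq_zero
      (hloc.locallyIntegrableOn _) fun η h1 h2 h3 => ?_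
    have := h η ⟨h1, h2, h3⟩
    rw [integral_congr_ae (g := fun _ => 0) (h0.mono fun x hx => by simp only [hx, smul_zero])] at this
    simpa using this.symm
  refine (Lp.eq_zero_iff_ae_eq_zero).2 ?_
  filter_upwards [key, ae_restrict_mem measurableSet_Ioi] with x hx hx' using hx hx'

lemma HasTrace.zero : HasTrace 0 0 :=
  ⟨0, continuousOn_const, (Lp.coeFn_zero ℂ 2 halfLine).symm, rfl⟩

lemma HasTrace.add {f f₂ : L2Edge} {c c₂ : ℂ} (h : HasTrace f c) (h₂ : HasTrace f₂ c₂) :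
    HasTrace (f + f₂) (c + c₂) := by
  obtain ⟨F, hF, hF', rfl⟩ := h
  obtain ⟨F₂, hF₂, hF₂', rfl⟩ := h₂
  exact ⟨F + F₂, hF.add hF₂, (hF'.add hF₂').trans (Lp.coeFn_add f f₂).symm, rfl⟩

lemma HasTrace.smul {f : L2Edge} {c : ℂ} (a : ℂ) (h : HasTrace f c) :
    HasTrace (a • f) (a * c) := by
  obtain ⟨F, hF, hF', rfl⟩ := h
  exact ⟨a • F, hF.const_smul a, (hF'.const_smul a).trans (Lp.coeFn_smul a f).symm, rfl⟩

/-- The graph of the Laplacian with a `δ` interaction of strength `α` at the vertex: pairs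
`(Ψ, Ψ'')` where every component of `Ψ` lies in `H²(0, ∞)` (with weak derivatives `ψⱼ'`, `ψⱼ''`
in `L²`), `ψ₁(0) = ⋯ = ψ_N(0)` and `∑ⱼ ψⱼ'(0) = α ψ₁(0)`. -/
def laplacianGraph (N : ℕ) (α : ℝ) : Submodule ℂ (L2Graph N × L2Graph N) where
  carrier := {x | ∃ (D : Fin N → L2Edge) (c : ℂ) (d : Fin N → ℂ),
    (∀ j, HasWeakDeriv (x.1 j) (D j)) ∧ (∀ j, HasWeakDeriv (D j) (x.2 j)) ∧
    (∀ j, HasTrace (x.1 j) c) ∧ (∀ j, HasTrace (D j) (d j)) ∧ ∑ j, d j = (α : ℂ) * c}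
  zero_mem' := ⟨0, 0, 0, fun _ => .zero, fun _ => .zero, fun _ => .zero, fun _ => .zero, by simp⟩
  add_mem' := by
    rintro x y ⟨D, c, d, h1, h2, h3, h4, h5⟩ ⟨D', c', d', h1', h2', h3', h4', h5'⟩
    refine ⟨D + D', c + c', d + d', fun j => (h1 j).add (h1' j), fun j => (h2 j).add (h2' j),
      fun j => (h3 j).add (h3' j), fun j => (h4 j).add (h4' j), ?_⟩
    simp [Finset.sum_add_distrib, h5, h5', mul_add]
  smul_mem' := by
    rintro a x ⟨D, c, d, h1, h2, h3, h4, h5⟩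
    refine ⟨a • D, a * c, a • d, fun j => (h1 j).smul a, fun j => (h2 j).smul a,
      fun j => (h3 j).smul a, fun j => (h4 j).smul a, ?_⟩
    simp [← Finset.mul_sum, h5]
    ring

lemma laplacianGraph_functional {N : ℕ} {α : ℝ} (x : L2Graph N × L2Graph N)
    (hx : x ∈ laplacianGraph N α) (h0 : x.1 = 0) : x.2 = 0 := by
  obtain ⟨D, c, d, h1, h2, -, -, -⟩ := hx
  ext1 j
  have hD : D j = 0 := HasWeakDeriv.eq_zero (by simpa [h0] using h1 j)
  exact HasWeakDeriv.eq_zero (by simpa [hD] using h2 j)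

/-- The Laplacian `Δ` on the star graph, an unbounded operator in `L²(Γ)` with domain `𝒟(Δ)`. -/
def laplacian (N : ℕ) (α : ℝ) : L2Graph N →ₗ.[ℂ] L2Graph N :=
  (laplacianGraph N α).toLinearPMap

lemma graph_laplacian (N : ℕ) (α : ℝ) : (laplacian N α).graph = laplacianGraph N α :=
  Submodule.toLinearPMap_graph_eq _ laplacianGraph_functional

/-- The soliton profile `φ_ω(x) = ω^{1/(2p)} sech^{1/p}(p √ω x)`. -/
def soliton (p ω x : ℝ) : ℝ :=
  ω ^ (1 / (2 * p)) * (Real.cosh (p * √ω * x))⁻¹ ^ (1 / p)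

/-- The shift `a_K = artanh (α / ((N - 2K) √ω)) / (p √ω)`. -/
def shift (p α ω : ℝ) (N K : ℕ) : ℝ :=
  Real.artanh (α / (((N : ℝ) - 2 * K) * √ω)) / (p * √ω)

/-- The stationary state `Φ_{ω,K}`: it equals `φ_ω(x + a_K)` on the `K = |S|` edges in `S`
and `φ_ω(x - a_K)` on the other `N - K` edges. -/
def stationaryState (p α ω : ℝ) {N : ℕ} (S : Finset (Fin N)) (j : Fin N) (x : ℝ) : ℝ :=
  if j ∈ S then soliton p ω (x + shift p α ω N S.card)
  else soliton p ω (x - shift p α ω N S.card)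

/-- The graph of `-Δ + ω - κ Φ^{2p}` on the domain of `Δ`, where `Φ` is the stationary state.
(The potential is bounded, so no element of the domain of `Δ` is lost by asking that the value
lies in `L²`.) -/
def hessianGraph (κ p α ω : ℝ) {N : ℕ} (S : Finset (Fin N)) :
    Submodule ℂ (L2Graph N × L2Graph N) where
  carrier := {x | ∃ U : (laplacian N α).domain, x.1 = U ∧ ∀ j, ∀ᵐ t ∂halfLine,
    x.2 j t = - (laplacian N α U) j t + (ω : ℂ) * x.1 j t
      - ((κ * stationaryState p α ω S j t ^ (2 * p) : ℝ) : ℂ) * x.1 j t}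
  zero_mem' := by
    refine ⟨0, rfl, fun j => ?_⟩
    filter_upwards [Lp.coeFn_zero ℂ 2 halfLine] with t ht
    have e : (laplacian N α 0) j = 0 := by simp
    change (0 : L2Edge) t = - ((laplacian N α 0) j) t + (ω : ℂ) * (0 : L2Edge) t
      - ((κ * stationaryState p α ω S j t ^ (2 * p) : ℝ) : ℂ) * (0 : L2Edge) t
    rw [e, ht]
    simp only [Pi.zero_apply, mul_zero, neg_zero, add_zero, sub_zero]
  add_mem' := by
    rintro x y ⟨U, hU, h⟩ ⟨V, hV, h'⟩
    refine ⟨U + V, by simp [hU, hV], fun j => ?_⟩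
    filter_upwards [h j, h' j, Lp.coeFn_add (x.2 j) (y.2 j), Lp.coeFn_add (x.1 j) (y.1 j),
      Lp.coeFn_add (laplacian N α U j) (laplacian N α V j)] with t h1 h2 h3 h4 h5
    simp only [LinearPMap.map_add, Prod.fst_add, Prod.snd_add, PiLp.add_apply, h3, h4, h5,
      Pi.add_apply, h1, h2]
    ring
  smul_mem' := by
    rintro a x ⟨U, hU, h⟩
    refine ⟨a • U, by simp [hU], fun j => ?_⟩
    filter_upwards [h j, Lp.coeFn_smul a (x.2 j), Lp.coeFn_smul a (x.1 j),
      Lp.coeFn_smul a (laplacian N α U j)] with t h1 h3 h4 h5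
    simp only [LinearPMap.map_smul, Prod.smul_fst, Prod.smul_snd, PiLp.smul_apply, h3, h4, h5,
      Pi.smul_apply, h1, smul_eq_mul]
    ring

lemma hessianGraph_functional {κ p α ω : ℝ} {N : ℕ} {S : Finset (Fin N)}
    (x : L2Graph N × L2Graph N) (hx : x ∈ hessianGraph κ p α ω S) (h0 : x.1 = 0) : x.2 = 0 := by
  obtain ⟨U, hU, h⟩ := hx
  have hU0 : U = 0 := by ext1; simp [← hU, h0]
  ext1 j
  refine (Lp.eq_zero_iff_ae_eq_zero).2 ?_
  filter_upwards [h j, Lp.coeFn_zero ℂ 2 halfLine] with t ht h2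
  rw [ht, hU0, h0]
  simp only [LinearPMap.map_zero, PiLp.zero_apply, h2, Pi.zero_apply, mul_zero, neg_zero, add_zero,
    sub_zero]

/-- The operator `-Δ + ω - κ Φ^{2p}` in `L²(Γ)`. -/
def hessian (κ p α ω : ℝ) {N : ℕ} (S : Finset (Fin N)) : L2Graph N →ₗ.[ℂ] L2Graph N :=
  (hessianGraph κ p α ω S).toLinearPMap

lemma graph_hessian (κ p α ω : ℝ) {N : ℕ} (S : Finset (Fin N)) :
    (hessian κ p α ω S).graph = hessianGraph κ p α ω S :=
  Submodule.toLinearPMap_graph_eq _ hessianGraph_functional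

/-- `L₊ = -Δ + ω - (2p+1)(p+1) Φ^{2p}`. -/
def Lplus (p α ω : ℝ) {N : ℕ} (S : Finset (Fin N)) : L2Graph N →ₗ.[ℂ] L2Graph N :=
  hessian ((2 * p + 1) * (p + 1)) p α ω S

/-- `L₋ = -Δ + ω - (p+1) Φ^{2p}`. -/
def Lminus (p α ω : ℝ) {N : ℕ} (S : Finset (Fin N)) : L2Graph N →ₗ.[ℂ] L2Graph N :=
  hessian (p + 1) p α ω S

section Spectral

variable {E : Type*} [AddCommGroup E] [Module ℂ E]

/-- The eigenspace `{u ∈ dom T : T u = μ u}` of an unbounded operator. -/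
def eigenspace (T : E →ₗ.[ℂ] E) (μ : ℂ) : Submodule ℂ E :=
  T.graph.comap (LinearMap.id.prod (μ • LinearMap.id))

lemma mem_eigenspace {T : E →ₗ.[ℂ] E} {μ : ℂ} {u : E} :
    u ∈ eigenspace T μ ↔ ∃ h : u ∈ T.domain, T ⟨u, h⟩ = μ • u := by
  simp [eigenspace, LinearPMap.mem_graph_iff]

/-- The multiplicity of `μ` as an eigenvalue: the dimension of the eigenspace
(`0` if `μ` is not an eigenvalue, `⊤` if the dimension is infinite). -/
def multiplicity (T : E →ₗ.[ℂ] E) (μ : ℂ) : ℕ∞ :=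
  Cardinal.toENat (Module.rank ℂ (eigenspace T μ))

/-- The Morse index: the number of negative eigenvalues, counted with multiplicity. -/
def morseIndex (T : E →ₗ.[ℂ] E) : ℕ∞ :=
  ∑' l : {l : ℝ // l < 0}, multiplicity T ((l : ℝ) : ℂ)

/-- The degeneracy index: the multiplicity of the eigenvalue zero. -/
def degeneracyIndex (T : E →ₗ.[ℂ] E) : ℕ∞ :=
  multiplicity T 0

end Spectral

end

end StarGraph

open Filter Topology

namespace StarGraph

noncomputable section

open ComplexConjugate

/-! On each edge the potential is a translated `sech²` well. The sign of `α` decides which edges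
contain the top of the soliton, at distance `b > 0` from the vertex (bumps, the set `B`), and which
carry only a decreasing piece (tails). For `α < 0` the bumps are the `K` edges of `S`, for `α > 0`
the other `N - K`. With `r = √ω`, and with `B`, `T` also denoting the numbers of bumps and tails,
the vertex condition of the stationary state reads `α = (B - T) r tanh(p r b)`.

Upper bound for `n(L₊)`. The derivative `φ'` of the soliton solves the `L₊` equation on the line and
vanishes only at the top. Picone's identity with `φ''/φ'` shows that, for functions with vertex
value `c` vanishing at the tops of the bumps, the quadratic form is at least `(B - T) d |c|²` for
some `d > 0` (`form_plus_ge`, `vertex_form_eq`). For `α > 0` we have `B > T`, so `B` linear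
conditions make the form nonnegative; for `α < 0` the condition `c = 0` is added, giving `B + 1`.
Eigenvectors for distinct eigenvalues are orthogonal, so the form is negative definite on the sum of
the negative eigenspaces, whose dimension is therefore at most the number of conditions
(`rank_iSup_eigenspace_le`).

Lower bound. At each energy `l ≤ 0` a hypergeometric series gives a decaying solution `u_l` on the
line, continuous in `l`; putting translates of `u_l` on the edges reduces the search for
eigenvectors to linear algebra at the vertex (`exists_eigenvectors`). Let `E₀` be the ground energy
on the line, with eigenfunction `φ^{p+1}`. At some `l_*` in `(E₀, 0)` one has `u_l(-b) = 0`, and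
coefficients on the bumps with zero sum give `B - 1` independent eigenvectors. The other eigenvalues
are zeros of `charFun`, whose signs are known at `E₀` and `0` (explicit solutions) and at `l_*`: one
zero lies below `E₀` if `α > 0`, and one on each side of `l_*` if `α < 0`. Without bumps,
`exists_tail_eigenvalue` replaces this. Lower and upper bounds coincide, so every inequality is an
equality and no other negative eigenvalue exists (`morseIndex_eq_of_le`).

Kernels. On each edge a square-integrable solution at energy `0` has the logarithmic derivative of
`φ'` (for `L₊`) or of `φ` (for `L₋`). For `L₊` the vertex condition becomes `(B - T) d c = 0`, which
forces `c = 0`; for `L₋` it holds automatically, leaving one free parameter. The form of `L₋` is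
nonnegative by Picone's identity with `φ'/φ`, which has no pole. -/

/-! ### Integration by parts and weak derivatives on the half-line. -/

/-- Since `g` is merely integrable, its primitive is only absolutely continuous, and integration by
parts is used in that class. -/
lemma integral_mul_primitive {η : ℝ → ℝ} {g : ℝ → ℝ} {b : ℝ} (hη : ContDiff ℝ 1 η)
    (h0 : η 0 = 0) (hb : η b = 0) (hg : IntervalIntegrable g volume 0 b) :
    ∫ x in 0..b, deriv η x * (∫ t in 0..x, g t) = - ∫ x in 0..b, η x * g x := by
  have hG : AbsolutelyContinuousOnInterval (fun x => ∫ t in 0..x, g t) 0 b :=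
    hg.absolutelyContinuousOnInterval_intervalIntegral (by simp)
  have hE : AbsolutelyContinuousOnInterval η 0 b :=
    hη.contDiffOn.absolutelyContinuousOnInterval
  have key := hE.integral_mul_deriv_eq_deriv_mul hG
  rw [h0, hb] at key
  have hd : ∫ x in 0..b, η x * deriv (fun x => ∫ t in 0..x, g t) x = ∫ x in 0..b, η x * g x := by
    refine intervalIntegral.integral_congr_ae ?_
    filter_upwards [hg.ae_hasDerivAt_integral] with x hx hx'
    rw [(hx (uIoc_subset_uIcc hx') 0 (by simp)).deriv]
  rw [← hd, key]
  simp

lemma integral_smul_primitive {η : ℝ → ℝ} {g : ℝ → ℂ} {b : ℝ} (hη : ContDiff ℝ 1 η)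
    (h0 : η 0 = 0) (hb : η b = 0) (hg : ∀ a b, IntervalIntegrable g volume a b) :
    ∫ x in 0..b, deriv η x • (∫ t in 0..x, g t) = - ∫ x in 0..b, η x • g x := by
  have hdc : Continuous (deriv η) := hη.continuous_deriv le_rfl
  have hGc : Continuous fun x => ∫ t in 0..x, g t := intervalIntegral.continuous_primitive hg 0
  have i1 : IntervalIntegrable (fun x => deriv η x • (∫ t in 0..x, g t)) volume 0 b :=
    (hdc.smul hGc).intervalIntegrable _ _
  have i2 : IntervalIntegrable (fun x => η x • g x) volume 0 b :=
    (hg 0 b).continuousOn_smul hη.continuous.continuousOn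
  have key : ∀ L : ℂ →L[ℝ] ℝ, L (∫ x in 0..b, deriv η x • (∫ t in 0..x, g t)) =
      L (- ∫ x in 0..b, η x • g x) := by
    intro L
    have := integral_mul_primitive (g := fun x => L (g x)) hη h0 hb
      ⟨L.integrable_comp (hg 0 b).1, L.integrable_comp (hg 0 b).2⟩
    rw [map_neg, ← L.intervalIntegral_comp_comm i1, ← L.intervalIntegral_comp_comm i2]
    simp only [map_smul, smul_eq_mul]
    rw [← this]
    congr 1
    ext x
    rw [L.intervalIntegral_comp_comm (hg 0 x)]
  exact Complex.ext (key Complex.reCLM) (key Complex.imCLM)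

lemma IsTestFunction.exists_support {η : ℝ → ℝ} (hη : IsTestFunction η) :
    ∃ a b, 0 < a ∧ a < b ∧ ∀ x, x ∉ Icc a b → η x = 0 := by
  obtain ⟨b, hb⟩ := hη.compact.isCompact.bddAbove
  obtain ⟨a, ha, ha'⟩ : ∃ a > 0, ∀ x ∈ tsupport η, a ≤ x := by
    rcases (tsupport η).eq_empty_or_nonempty with h | h
    · exact ⟨1, one_pos, by simp [h]⟩
    · exact ⟨sInf (tsupport η), hη.support (hη.compact.isCompact.sInf_mem h),
        fun x hx => csInf_le hη.compact.isCompact.bddBelow hx⟩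
  -- The maximum keeps the interval nondegenerate even when the support is empty or a point.
  refine ⟨a, max b (a + 1), ha, by simp, fun x hx => ?_⟩
  by_contra h
  have := subset_tsupport η (Function.mem_support.2 h)
  exact hx ⟨ha' x this, le_max_of_le_left (hb this)⟩

lemma exists_isTestFunction_integral_eq_one :
    ∃ ψ : ℝ → ℝ, IsTestFunction ψ ∧ ∫ x in Ioi 0, ψ x = 1 := by
  let B : ContDiffBump (1 : ℝ) := ⟨1 / 4, 1 / 2, by norm_num, by norm_num⟩
  have hs : tsupport (B.normed volume) ⊆ Ioi 0 := by
    rw [B.tsupport_normed_eq]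
    intro x hx
    rw [Metric.mem_closedBall, Real.dist_eq, abs_le] at hx
    have : B.rOut = 1 / 2 := rfl
    rw [this] at hx
    show (0 : ℝ) < x
    linarith [hx.1]
  refine ⟨B.normed volume, ⟨B.contDiff_normed, B.hasCompactSupport_normed, hs⟩, ?_⟩
  refine Eq.trans ?_ (B.integral_normed (μ := volume))
  refine setIntegral_eq_integral_of_forall_compl_eq_zero fun x hx => ?_
  by_contra h
  exact hx (hs (subset_tsupport _ (Function.mem_support.2 h)))

lemma IsTestFunction.setIntegral_eq {E : Type*} [NormedAddCommGroup E] [NormedSpace ℝ E]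
    {a b : ℝ} (ha : 0 < a) (hab : a < b) {F : ℝ → E} (hF : ∀ x, x ∉ Icc a b → F x = 0) :
    ∫ x in Ioi (0 : ℝ), F x = ∫ x in 0..b, F x := by
  rw [intervalIntegral.integral_of_le (ha.trans hab).le]
  refine (setIntegral_eq_of_subset_of_forall_sdiff_eq_zero measurableSet_Ioi
    Ioc_subset_Ioi_self fun x hx => hF x fun h => hx.2 ⟨hx.1, h.2⟩)

lemma IsTestFunction.deriv_eq_zero {η : ℝ → ℝ} {a b : ℝ}
    (h : ∀ x, x ∉ Icc a b → η x = 0) (x : ℝ) (hx : x ∉ Icc a b) : deriv η x = 0 := by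
  have : η =ᶠ[𝓝 x] fun _ => 0 := by
    filter_upwards [isClosed_Icc.isOpen_compl.mem_nhds hx] with y hy using h y hy
  rw [this.deriv_eq]
  simp

/-- A test function with vanishing integral is the derivative of a test function. -/
lemma IsTestFunction.exists_primitive {η : ℝ → ℝ} (hη : IsTestFunction η)
    (h : ∫ x in Ioi 0, η x = 0) : ∃ θ, IsTestFunction θ ∧ deriv θ = η := by
  obtain ⟨a, b, ha, hab, hs⟩ := hη.exists_support
  have hc := hη.smooth.continuous
  have hd : ∀ x, HasDerivAt (fun x => ∫ t in 0..x, η t) (η x) x := fun x =>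
    intervalIntegral.integral_hasDerivAt_right (hc.intervalIntegrable _ _)
      hc.stronglyMeasurable.stronglyMeasurableAtFilter hc.continuousAt
  have hderiv : deriv (fun x => ∫ t in 0..x, η t) = η := funext fun x => (hd x).deriv
  have hb : ∫ t in 0..b, η t = 0 := by
    rw [← IsTestFunction.setIntegral_eq ha hab hs, h]
  have hz : ∀ x, x ∉ Icc a b → ∫ t in 0..x, η t = 0 := by
    intro x hx
    rcases lt_or_ge x a with hxa | hxa
    · rw [intervalIntegral.integral_congr (g := fun _ => (0 : ℝ)) fun t ht => hs t fun h' => ?_]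
      · simp
      · rcases le_total 0 x with h0 | h0
        · rw [uIcc_of_le h0] at ht; linarith [ht.2, h'.1]
        · rw [uIcc_of_ge h0] at ht; linarith [ht.2, h'.1]
    · have hbx : b < x := by
        by_contra h'
        exact hx ⟨hxa, not_lt.1 h'⟩
      rw [← intervalIntegral.integral_add_adjacent_intervals (hc.intervalIntegrable 0 b)
        (hc.intervalIntegrable b x), hb, zero_add]
      rw [intervalIntegral.integral_congr_ae (g := fun _ => (0 : ℝ))]
      · simp
      · refine Eventually.of_forall fun t ht => hs t fun h' => ?_
        rw [uIoc_of_le hbx.le] at ht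
        linarith [ht.1, h'.2]
  have hts : tsupport (fun x => ∫ t in 0..x, η t) ⊆ Icc a b := by
    refine closure_minimal (fun x hx => ?_) isClosed_Icc
    by_contra h'
    exact hx (hz x h')
  refine ⟨_, ⟨?_, HasCompactSupport.of_support_subset_isCompact isCompact_Icc
    (subset_closure.trans hts), hts.trans fun x hx => ha.trans_le hx.1⟩, hderiv⟩
  have h1 : ContDiff ℝ (((⊤ : ℕ∞) : WithTop ℕ∞) + 1) (fun x => ∫ t in 0..x, η t) := by
    rw [contDiff_succ_iff_deriv]
    refine ⟨fun x => (hd x).differentiableAt, by simp, ?_⟩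
    rw [hderiv]
    exact hη.smooth
  exact h1.of_le (by simp)

/-- The du Bois-Reymond lemma on the half-line. -/
lemma exists_ae_eq_const {h : ℝ → ℂ} (hl : LocallyIntegrable h halfLine)
    (h0 : ∀ η, IsTestFunction η → ∫ x in Ioi (0 : ℝ), deriv η x • h x = 0) :
    ∃ C : ℂ, ∀ᵐ x ∂halfLine, h x = C := by
  obtain ⟨ψ, hψ, hψ1⟩ := exists_isTestFunction_integral_eq_one
  have hint : ∀ η, IsTestFunction η → Integrable (fun x => η x • h x) halfLine := fun η hη =>
    hl.integrable_smul_left_of_hasCompactSupport hη.smooth.continuous hη.compact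
  have hint' : ∀ η, IsTestFunction η → Integrable η halfLine := fun η hη =>
    hη.smooth.continuous.integrable_of_hasCompactSupport hη.compact
  set C : ℂ := ∫ x in Ioi (0 : ℝ), ψ x • h x with hC
  refine ⟨C, ?_⟩
  have key : ∀ᵐ x ∂halfLine, x ∈ Ioi (0 : ℝ) → h x - C = 0 := by
    refine isOpen_Ioi.ae_eq_zero_of_integral_contDiff_smul_eq_zero
      ((hl.sub (locallyIntegrable_const C)).locallyIntegrableOn _) fun η h1 h2 h3 => ?_
    have hη : IsTestFunction η := ⟨h1, h2, h3⟩
    set I : ℝ := ∫ x in Ioi (0 : ℝ), η x with hI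
    -- Subtracting `I ψ` makes the integral zero, so the result is the derivative of a test function
    -- and `h0` applies.
    have hζ : IsTestFunction (fun x => η x - I * ψ x) :=
      ⟨h1.sub (contDiff_const.mul hψ.smooth), h2.sub hψ.compact.mul_left,
        (tsupport_sub _ _).trans (union_subset h3
          ((closure_mono (fun x hx => by
            simp only [Function.mem_support] at hx ⊢
            exact right_ne_zero_of_mul hx)).trans hψ.support))⟩
    obtain ⟨θ, hθ, hθ'⟩ := hζ.exists_primitive (by
      rw [integral_sub (hint' η hη) ((hint' ψ hψ).const_mul I), integral_const_mul, hψ1, ← hI]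
      ring)
    have h4 := h0 θ hθ
    rw [hθ'] at h4
    have h5 : ∫ x in Ioi (0 : ℝ), (η x - I * ψ x) • h x =
        (∫ x in Ioi (0 : ℝ), η x • h x) - I • C := by
      rw [hC, ← integral_smul, ← integral_sub (hint η hη)
        (show Integrable (fun x => I • (ψ x • h x)) halfLine from (hint ψ hψ).smul I)]
      congr 1
      ext x
      simp [sub_smul, mul_smul]
    rw [h5] at h4
    have h6 : ∫ x in Ioi (0 : ℝ), η x • (h x - C) =
        (∫ x in Ioi (0 : ℝ), η x • h x) - I • C := by
      simp only [smul_sub]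
      rw [integral_sub (hint η hη) ((hint' η hη).smul_const C), integral_smul_const]
    exact h6.trans h4
  filter_upwards [key, ae_restrict_mem measurableSet_Ioi] with x hx hx'
  exact sub_eq_zero.1 (hx hx')

/-- The extension by zero of a square-integrable function is integrable on bounded intervals. -/
lemma intervalIntegrable_indicator (g : L2Edge) (a b : ℝ) :
    IntervalIntegrable ((Ioi (0 : ℝ)).indicator g) volume a b := by
  have h1 : MemLp ((Ioi (0 : ℝ)).indicator g) 2 volume :=
    (memLp_indicator_iff_restrict measurableSet_Ioi).2 (Lp.memLp g)
  exact ((h1.locallyIntegrable (by norm_num)).integrableOn_isCompact isCompact_uIcc).intervalIntegrable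

/-- The difference of `f` and a primitive of `g` has weak derivative zero, hence is constant by du
Bois-Reymond. -/
lemma HasWeakDeriv.exists_primitive {f g : L2Edge} (h : HasWeakDeriv f g) :
    ∃ C : ℂ, (fun x => C + ∫ t in 0..x, (Ioi (0 : ℝ)).indicator g t) =ᵐ[halfLine] f := by
  set G : ℝ → ℂ := fun x => ∫ t in 0..x, (Ioi (0 : ℝ)).indicator g t with hG
  have hGc : Continuous G := intervalIntegral.continuous_primitive (intervalIntegrable_indicator g) 0
  have hGl : LocallyIntegrable G halfLine :=
    hGc.locallyIntegrable
  have hf : LocallyIntegrable f halfLine := (Lp.memLp f).locallyIntegrable (by norm_num)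
  obtain ⟨C, hC⟩ := exists_ae_eq_const (hf.sub hGl) fun η hη => by
    have e1 : ∫ x in Ioi (0 : ℝ), deriv η x • G x = - ∫ x in Ioi (0 : ℝ), η x • g x := by
      obtain ⟨a, b, ha, hab, hs⟩ := hη.exists_support
      have e2 : ∫ x in Ioi (0 : ℝ), η x • g x =
          ∫ x in Ioi (0 : ℝ), η x • (Ioi (0 : ℝ)).indicator g x :=
        setIntegral_congr_fun measurableSet_Ioi fun x hx => by simp [indicator_of_mem hx]
      -- The upper limit is `b + 1` because `η` is only known to vanish outside `[a, b]`, and the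
      -- boundary term must vanish.
      rw [e2, IsTestFunction.setIntegral_eq ha (lt_add_of_lt_of_pos hab one_pos)
        fun x hx => by
          rw [IsTestFunction.deriv_eq_zero hs x fun h' => hx ⟨h'.1, by linarith [h'.2]⟩, zero_smul],
        IsTestFunction.setIntegral_eq ha (lt_add_of_lt_of_pos hab one_pos)
        fun x hx => by
          rw [hs x fun h' => hx ⟨h'.1, by linarith [h'.2]⟩, zero_smul]]
      exact integral_smul_primitive (hη.smooth.of_le (by simp))
        (hs 0 fun h' => by linarith [h'.1]) (hs _ fun h' => by linarith [h'.2])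
        (intervalIntegrable_indicator g)
    have e3 : Integrable (fun x => deriv η x • G x) halfLine :=
      hGl.integrable_smul_left_of_hasCompactSupport
        (hη.smooth.continuous_deriv (by simp)) hη.compact.deriv
    simp only [Pi.sub_apply, smul_sub]
    rw [integral_sub (integrable_deriv_test hη f) e3, e1, h η hη]
    ring
  refine ⟨C, ?_⟩
  filter_upwards [hC] with x hx
  rw [← hx]
  simp [hG]

/-! ### Continuous representatives and classical derivatives. -/

/-- `F` is the representative of `f` that is continuous on `[0, ∞)`. -/
structure IsRep (F : ℝ → ℂ) (f : L2Edge) : Prop where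
  cont : ContinuousOn F (Ici 0)
  ae : F =ᵐ[halfLine] f

lemma IsRep.eqOn {F G : ℝ → ℂ} {f : L2Edge} (hF : IsRep F f) (hG : IsRep G f) :
    EqOn F G (Ici 0) := by
  have h : F =ᵐ[volume.restrict (Ici (0 : ℝ))] G := by
    rw [Measure.restrict_congr_set Ioi_ae_eq_Ici.symm]
    exact hF.ae.trans hG.ae.symm
  exact Measure.eqOn_of_ae_eq h hF.cont hG.cont (by simp)

lemma IsRep.memLp {F : ℝ → ℂ} {f : L2Edge} (hF : IsRep F f) : MemLp F 2 halfLine :=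
  (memLp_congr_ae hF.ae).2 (Lp.memLp f)

lemma isRep_toLp {F : ℝ → ℂ} (hc : ContinuousOn F (Ici 0)) (hF : MemLp F 2 halfLine) :
    IsRep F (hF.toLp F) :=
  ⟨hc, hF.coeFn_toLp.symm⟩

lemma IsRep.hasTrace {F : ℝ → ℂ} {f : L2Edge} (hF : IsRep F f) : HasTrace f (F 0) :=
  ⟨F, hF.cont, hF.ae, rfl⟩

lemma IsRep.eq_of_hasTrace {F : ℝ → ℂ} {f : L2Edge} (hF : IsRep F f) {c : ℂ}
    (h : HasTrace f c) : F 0 = c := by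
  obtain ⟨G, hG, hG', rfl⟩ := h
  exact hF.eqOn ⟨hG, hG'⟩ self_mem_Ici

lemma HasWeakDeriv.exists_isRep {f g : L2Edge} (h : HasWeakDeriv f g) : ∃ F, IsRep F f := by
  obtain ⟨C, hC⟩ := h.exists_primitive
  exact ⟨_, (continuous_const.add
    (intervalIntegral.continuous_primitive (intervalIntegrable_indicator g) 0)).continuousOn, hC⟩

lemma HasWeakDeriv.exists_hasDerivAt {f g : L2Edge} (h : HasWeakDeriv f g) {G : ℝ → ℂ}
    (hG : IsRep G g) : ∃ F, IsRep F f ∧ ∀ x, 0 < x → HasDerivAt F (G x) x := by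
  obtain ⟨C, hC⟩ := h.exists_primitive
  refine ⟨fun x => C + ∫ t in 0..x, (Ioi (0 : ℝ)).indicator g t, ⟨(continuous_const.add (intervalIntegral.continuous_primitive
    (intervalIntegrable_indicator g) 0)).continuousOn, hC⟩, fun x hx => ?_⟩
  have he : (Ioi (0 : ℝ)).indicator G =ᵐ[volume] (Ioi (0 : ℝ)).indicator g := by
    have := (ae_restrict_iff' measurableSet_Ioi).1 hG.ae
    filter_upwards [this] with t ht
    by_cases h0 : t ∈ Ioi (0 : ℝ)
    · simp [indicator_of_mem h0, ht h0]
    · simp [indicator_of_notMem h0]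
  have hi : (fun x => C + ∫ t in 0..x, (Ioi (0 : ℝ)).indicator g t) =
      fun x => C + ∫ t in 0..x, (Ioi (0 : ℝ)).indicator G t := by
    ext x
    congr 1
    exact intervalIntegral.integral_congr_ae (he.mono fun t ht _ => ht.symm)
  rw [hi]
  have hc : ContinuousOn ((Ioi (0 : ℝ)).indicator G) (Ioi 0) :=
    (hG.cont.mono Ioi_subset_Ici_self).congr fun t ht => indicator_of_mem ht _
  have h1 := intervalIntegral.integral_hasDerivAt_right (a := 0) (b := x)
    ((intervalIntegrable_indicator g 0 x).congr_ae (ae_restrict_of_ae he.symm))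
    (hc.stronglyMeasurableAtFilter isOpen_Ioi x hx) (hc.continuousAt (Ioi_mem_nhds hx))
  rw [indicator_of_mem (show x ∈ Ioi (0 : ℝ) from hx)] at h1
  exact h1.const_add C

lemma hasWeakDeriv_of_hasDerivAt {f g : L2Edge} {F G : ℝ → ℂ} (hF : IsRep F f) (hG : IsRep G g)
    (h : ∀ x, 0 < x → HasDerivAt F (G x) x) : HasWeakDeriv f g := by
  intro η hη
  obtain ⟨a, b, ha, hab, hs⟩ := hη.exists_support
  have e1 : ∫ x in Ioi (0 : ℝ), deriv η x • f x = ∫ x in Ioi (0 : ℝ), deriv η x • F x :=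
    integral_congr_ae (hF.ae.mono fun x hx => by simp only [hx])
  have e2 : ∫ x in Ioi (0 : ℝ), η x • g x = ∫ x in Ioi (0 : ℝ), η x • G x :=
    integral_congr_ae (hG.ae.mono fun x hx => by simp only [hx])
  have hs' := IsTestFunction.deriv_eq_zero hs
  rw [e1, e2, IsTestFunction.setIntegral_eq ha (lt_add_of_lt_of_pos hab one_pos)
      fun x hx => by rw [hs' x fun h' => hx ⟨h'.1, by linarith [h'.2]⟩, zero_smul],
    IsTestFunction.setIntegral_eq ha (lt_add_of_lt_of_pos hab one_pos)
      fun x hx => by rw [hs x fun h' => hx ⟨h'.1, by linarith [h'.2]⟩, zero_smul]]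
  have hb : 0 ≤ b + 1 := by linarith
  have hsub : uIcc 0 (b + 1) ⊆ Ici 0 := by
    rw [uIcc_of_le hb]; exact Icc_subset_Ici_self
  have i1 : IntervalIntegrable (fun x => deriv η x • F x) volume 0 (b + 1) :=
    ((hη.smooth.continuous_deriv (by simp)).continuousOn.smul
      (hF.cont.mono hsub)).intervalIntegrable
  have i2 : IntervalIntegrable (fun x => η x • G x) volume 0 (b + 1) :=
    (hη.smooth.continuous.continuousOn.smul (hG.cont.mono hsub)).intervalIntegrable
  rw [eq_neg_iff_add_eq_zero, ← intervalIntegral.integral_add i1 i2]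
  rw [intervalIntegral.integral_eq_sub_of_hasDerivAt_of_le (f := fun x => η x • F x) hb
    (hη.smooth.continuous.continuousOn.smul (hF.cont.mono Icc_subset_Ici_self)) (fun x hx => ?_)
    (i1.add i2)]
  · rw [hs 0 fun h' => by linarith [h'.1], hs (b + 1) fun h' => by linarith [h'.2]]
    simp
  · have := ((hη.smooth.differentiable (by simp)) x).hasDerivAt.smul (h x hx.1)
    rwa [add_comm] at this

/-! ### The operator as a classical boundary value problem; Green's formula. -/

/-- `-F'' + q F = W` on a half-line, with all functions continuous up to the boundary and
square-integrable. -/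
structure SolvesEdge (q : ℝ → ℝ) (F F' W : ℝ → ℂ) : Prop where
  cont : ContinuousOn F (Ici 0)
  cont' : ContinuousOn F' (Ici 0)
  contW : ContinuousOn W (Ici 0)
  mem : MemLp F 2 halfLine
  mem' : MemLp F' 2 halfLine
  memW : MemLp W 2 halfLine
  deriv : ∀ x, 0 < x → HasDerivAt F (F' x) x
  deriv' : ∀ x, 0 < x → HasDerivAt F' (q x * F x - W x) x

/-- The relation `w = -v'' + V v` with the vertex conditions of strength `α`. -/
def InGraph {N : ℕ} (α : ℝ) (V : Fin N → ℝ → ℝ) (v w : L2Graph N) : Prop :=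
  ∃ (D E : Fin N → L2Edge) (c : ℂ) (d : Fin N → ℂ),
    (∀ j, HasWeakDeriv (v j) (D j)) ∧ (∀ j, HasWeakDeriv (D j) (E j)) ∧
    (∀ j, HasTrace (v j) c) ∧ (∀ j, HasTrace (D j) (d j)) ∧ ∑ j, d j = (α : ℂ) * c ∧
    ∀ j, ∀ᵐ t ∂halfLine, w j t = - E j t + (V j t : ℂ) * v j t

lemma mem_hessianGraph_iff {κ p α ω : ℝ} {N : ℕ} {S : Finset (Fin N)} {v w : L2Graph N} :
    (v, w) ∈ hessianGraph κ p α ω S ↔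
      InGraph α (fun j t => ω - κ * stationaryState p α ω S j t ^ (2 * p)) v w := by
  constructor
  · rintro ⟨U, hU, h⟩
    have hg : ((U : L2Graph N), laplacian N α U) ∈ laplacianGraph N α := by
      rw [← graph_laplacian]
      exact LinearPMap.mem_graph _ U
    obtain ⟨D, c, d, h1, h2, h3, h4, h5⟩ := hg
    simp only at hU h
    subst hU
    refine ⟨D, fun j => laplacian N α U j, c, d, h1, h2, h3, h4, h5, fun j => ?_⟩
    filter_upwards [h j] with t ht
    rw [ht]
    push_cast
    ring
  · rintro ⟨D, E, c, d, h1, h2, h3, h4, h5, h6⟩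
    have hg : (v, (WithLp.toLp 2 E : L2Graph N)) ∈ (laplacian N α).graph := by
      rw [graph_laplacian]
      exact ⟨D, c, d, h1, h2, h3, h4, h5⟩
    obtain ⟨U, hU, hU'⟩ := (LinearPMap.mem_graph_iff _).1 hg
    simp only at hU hU'
    refine ⟨U, hU.symm, fun j => ?_⟩
    rw [hU']
    filter_upwards [h6 j] with t ht
    refine ht.trans ?_
    push_cast
    ring

/-- Bootstrap: `v` has a continuous representative, so `v'' = V v - w` has one too when `w` does;
hence `v'` and then `v` are classically differentiable. -/
lemma InGraph.exists_solvesEdge {N : ℕ} {α : ℝ} {V : Fin N → ℝ → ℝ} {v w : L2Graph N}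
    (h : InGraph α V v w) (hV : ∀ j, Continuous (V j)) {W : Fin N → ℝ → ℂ}
    (hW : ∀ j, IsRep (W j) (w j)) :
    ∃ (F F' : Fin N → ℝ → ℂ) (c : ℂ), (∀ j, SolvesEdge (V j) (F j) (F' j) (W j)) ∧
      (∀ j, IsRep (F j) (v j)) ∧ (∀ j, F j 0 = c) ∧ ∑ j, F' j 0 = α * c := by
  obtain ⟨D, E, c, d, h1, h2, h3, h4, h5, h6⟩ := h
  have key : ∀ j, ∃ F F' : ℝ → ℂ, SolvesEdge (V j) F F' (W j) ∧ IsRep F (v j) ∧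
      IsRep F' (D j) := by
    intro j
    obtain ⟨F₀, hF₀⟩ := (h1 j).exists_isRep
    have hE : IsRep (fun t => V j t * F₀ t - W j t) (E j) := by
      refine ⟨((Complex.continuous_ofReal.comp (hV j)).continuousOn.mul hF₀.cont).sub
        (hW j).cont, ?_⟩
      filter_upwards [hF₀.ae, (hW j).ae, h6 j] with t ht ht' ht''
      rw [ht, ht', ht'']
      ring
    obtain ⟨F', hF', hd'⟩ := (h2 j).exists_hasDerivAt hE
    obtain ⟨F, hF, hd⟩ := (h1 j).exists_hasDerivAt hF'
    refine ⟨F, F', ⟨hF.cont, hF'.cont, (hW j).cont, hF.memLp, hF'.memLp, (hW j).memLp, hd,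
      fun x hx => ?_⟩, hF, hF'⟩
    -- The second derivative was computed with the preliminary representative `F₀`, which agrees
    -- with `F` on `[0, ∞)`.
    rw [hF.eqOn hF₀ (mem_Ici.2 hx.le)]
    exact hd' x hx
  choose F F' hs hF hF' using key
  refine ⟨F, F', c, hs, hF, fun j => (hF j).eq_of_hasTrace (h3 j), ?_⟩
  rw [← h5]
  exact Finset.sum_congr rfl fun j _ => (hF' j).eq_of_hasTrace (h4 j)

lemma inGraph_of_solvesEdge {N : ℕ} {α : ℝ} {V : Fin N → ℝ → ℝ} (hV : ∀ j, Continuous (V j))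
    (hVb : ∀ j, ∃ C, ∀ x, |V j x| ≤ C)
    {v w : L2Graph N} {F F' W : Fin N → ℝ → ℂ} {c : ℂ}
    (h : ∀ j, SolvesEdge (V j) (F j) (F' j) (W j)) (hF : ∀ j, IsRep (F j) (v j))
    (hW : ∀ j, IsRep (W j) (w j)) (h0 : ∀ j, F j 0 = c) (h1 : ∑ j, F' j 0 = α * c) :
    InGraph α V v w := by
  have hcE : ∀ j, ContinuousOn (fun t => V j t * F j t - W j t) (Ici 0) := fun j =>
    ((Complex.continuous_ofReal.comp (hV j)).continuousOn.mul (h j).cont).sub (h j).contW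
  have hmE : ∀ j, MemLp (fun t => V j t * F j t - W j t) 2 halfLine := by
    intro j
    obtain ⟨C, hC⟩ := hVb j
    refine MemLp.sub ?_ (h j).memW
    refine (h j).mem.of_le_mul (c := C) ?_ (Eventually.of_forall fun t => ?_)
    · exact (Complex.continuous_ofReal.comp (hV j)).aestronglyMeasurable.mul
        (h j).mem.aestronglyMeasurable
    · rw [norm_mul, Complex.norm_real, Real.norm_eq_abs]
      gcongr
      exact hC t
  have hD : ∀ j, IsRep (F' j) ((h j).mem'.toLp) := fun j => isRep_toLp (h j).cont' (h j).mem'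
  have hE : ∀ j, IsRep _ ((hmE j).toLp) := fun j => isRep_toLp (hcE j) (hmE j)
  refine ⟨fun j => (h j).mem'.toLp, fun j => (hmE j).toLp, c, fun j => F' j 0,
    fun j => hasWeakDeriv_of_hasDerivAt (hF j) (hD j) (h j).deriv,
    fun j => hasWeakDeriv_of_hasDerivAt (hD j) (hE j) (h j).deriv',
    fun j => h0 j ▸ (hF j).hasTrace, fun j => (hD j).hasTrace, h1, fun j => ?_⟩
  filter_upwards [(hE j).ae, (hF j).ae, (hW j).ae] with t h1 h2 h3
  rw [← h1, ← h2, ← h3]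
  ring

lemma integrable_conj_mul {F G : ℝ → ℂ} (hF : MemLp F 2 halfLine) (hG : MemLp G 2 halfLine) :
    Integrable (fun x => conj (F x) * G x) halfLine :=
  (hF.star).integrable_mul hG

/-- Green's formula on the half-line. -/
lemma SolvesEdge.integral_green {q : ℝ → ℝ} {F F' W G G' Y : ℝ → ℂ} (h : SolvesEdge q F F' W)
    (k : SolvesEdge q G G' Y) :
    ∫ x in Ioi (0 : ℝ), (conj (W x) * G x - conj (F x) * Y x) =
      conj (F' 0) * G 0 - conj (F 0) * G' 0 := by
  have hc : ∀ x, 0 < x → HasDerivAt (fun x => conj (F x) * G' x - conj (F' x) * G x)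
      (conj (W x) * G x - conj (F x) * Y x) x := by
    intro x hx
    have h1 := (h.deriv x hx).star
    have h2 := (h.deriv' x hx).star
    refine (((h1.mul (k.deriv' x hx)).sub (h2.mul (k.deriv x hx)))).congr_deriv ?_
    simp only [Complex.star_def, map_sub, map_mul, Complex.conj_ofReal]
    ring
  have hi : IntegrableOn (fun x => conj (W x) * G x - conj (F x) * Y x) (Ioi 0) :=
    (integrable_conj_mul h.memW k.mem).sub (integrable_conj_mul h.mem k.memW)
  have hi' : IntegrableOn (fun x => conj (F x) * G' x - conj (F' x) * G x) (Ioi 0) :=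
    (integrable_conj_mul h.mem k.mem').sub (integrable_conj_mul h.mem' k.mem)
  have hcont : ContinuousWithinAt (fun x => conj (F x) * G' x - conj (F' x) * G x) (Ici 0) 0 :=
    (((Complex.continuous_conj.comp_continuousOn h.cont).mul k.cont').sub
      ((Complex.continuous_conj.comp_continuousOn h.cont').mul k.cont)) 0 self_mem_Ici
  rw [integral_Ioi_of_hasDerivAt_of_tendsto hcont hc hi
    (tendsto_zero_of_hasDerivAt_of_integrableOn_Ioi hc hi hi')]
  ring

/-! ### Uniqueness for the initial value problem. -/

lemma hasDerivAt_normSq {F : ℝ → ℂ} {F' : ℂ} {x : ℝ} (h : HasDerivAt F F' x) :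
    HasDerivAt (fun x => Complex.normSq (F x)) (2 * (conj (F x) * F').re) x := by
  have h1 : HasDerivAt (fun x => (conj (F x) * F x).re)
      (conj F' * F x + conj (F x) * F').re x :=
    Complex.reCLM.hasFDerivAt.comp_hasDerivAt x (h.star.mul h)
  have h2 : (fun x => (conj (F x) * F x).re) = fun x => Complex.normSq (F x) := by
    ext x
    rw [← Complex.normSq_eq_conj_mul_self, Complex.ofReal_re]
  rw [h2] at h1
  refine h1.congr_deriv ?_
  simp
  ring

/-- Uniqueness for the initial value problem of `F'' = q F`. -/
lemma eq_zero_of_initial {q : ℝ → ℝ} {C : ℝ} (hq : ∀ x, |q x| ≤ C) {F F' : ℝ → ℂ}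
    (hc : ContinuousOn F (Ici 0)) (hc' : ContinuousOn F' (Ici 0))
    (hd : ∀ x, 0 < x → HasDerivAt F (F' x) x) (hd' : ∀ x, 0 < x → HasDerivAt F' (q x * F x) x)
    (h0 : F 0 = 0) (h0' : F' 0 = 0) : ∀ x, 0 ≤ x → F x = 0 ∧ F' x = 0 := by
  -- The derivative of `|F|² + |F'|²` is at most `(1 + C)` times itself, so this weighted energy is
  -- nonincreasing from the value `0`.
  set e : ℝ → ℝ := fun x =>
    (Complex.normSq (F x) + Complex.normSq (F' x)) * Real.exp (-(1 + C) * x) with he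
  have hC : 0 ≤ C := (abs_nonneg _).trans (hq 0)
  have hde : ∀ x, 0 < x → HasDerivAt e
      ((2 * (conj (F x) * F' x).re + 2 * (conj (F' x) * (q x * F x)).re -
        (1 + C) * (Complex.normSq (F x) + Complex.normSq (F' x))) * Real.exp (-(1 + C) * x)) x := by
    intro x hx
    have h1 : HasDerivAt (fun x : ℝ => Real.exp (-(1 + C) * x))
        (Real.exp (-(1 + C) * x) * (-(1 + C) * 1)) x :=
      ((hasDerivAt_id x).const_mul _).exp
    refine (((hasDerivAt_normSq (hd x hx)).add (hasDerivAt_normSq (hd' x hx))).mul h1).congr_deriv ?_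
    simp only [Pi.add_apply]
    ring
  have hanti : AntitoneOn e (Ici 0) := by
    refine antitoneOn_of_deriv_nonpos (convex_Ici 0) ?_ ?_ ?_
    · exact ((Complex.continuous_normSq.comp_continuousOn hc).add
        (Complex.continuous_normSq.comp_continuousOn hc')).mul (by fun_prop)
    · rw [interior_Ici]
      exact fun x hx => (hde x hx).differentiableAt.differentiableWithinAt
    · rw [interior_Ici]
      intro x hx
      rw [(hde x hx).deriv]
      refine mul_nonpos_of_nonpos_of_nonneg ?_ (Real.exp_pos _).le
      have hq' := abs_le.1 (hq x)
      simp only [Complex.mul_re, Complex.conj_re, Complex.conj_im, Complex.normSq_apply,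
        Complex.ofReal_re, Complex.ofReal_im, Complex.mul_im]
      nlinarith [sq_nonneg ((F x).re - (F' x).re), sq_nonneg ((F x).im - (F' x).im),
        mul_nonneg (by linarith [hq'.2] : 0 ≤ C - q x) (sq_nonneg ((F x).re + (F' x).re)),
        mul_nonneg (by linarith [hq'.2] : 0 ≤ C - q x) (sq_nonneg ((F x).im + (F' x).im)),
        mul_nonneg (by linarith [hq'.1] : 0 ≤ C + q x) (sq_nonneg ((F x).re - (F' x).re)),
        mul_nonneg (by linarith [hq'.1] : 0 ≤ C + q x) (sq_nonneg ((F x).im - (F' x).im))]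
  intro x hx
  have h1 : e x ≤ e 0 := hanti self_mem_Ici hx hx
  have h2 : e 0 = 0 := by simp [he, h0, h0']
  have h3 : Complex.normSq (F x) + Complex.normSq (F' x) ≤ 0 := by
    rw [h2, he] at h1
    exact nonpos_of_mul_nonpos_left h1 (Real.exp_pos _)
  have h4 := Complex.normSq_nonneg (F x)
  have h5 := Complex.normSq_nonneg (F' x)
  exact ⟨Complex.normSq_eq_zero.1 (by linarith), Complex.normSq_eq_zero.1 (by linarith)⟩

/-! ### Picone's identity and its limiting forms. -/

/-- The boundary term in Picone's identity. -/
def piconeTerm (g : ℝ → ℝ) (F F' : ℝ → ℂ) (x : ℝ) : ℝ :=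
  (conj (F x) * F' x).re - g x * Complex.normSq (F x)

/-- By the Riccati equation `g' = q - g²`, the boundary term has derivative `|F' - g F|² - Re (conj
F · W)`; the square is dropped. -/
lemma picone_Icc {q g : ℝ → ℝ} {F F' W : ℝ → ℂ} {x y : ℝ} (hxy : x ≤ y)
    (hg : ∀ t ∈ Icc x y, HasDerivAt g (q t - g t ^ 2) t)
    (hF : ∀ t ∈ Icc x y, HasDerivAt F (F' t) t)
    (hF' : ∀ t ∈ Icc x y, HasDerivAt F' (q t * F t - W t) t)
    (hW : ContinuousOn W (Icc x y)) :
    piconeTerm g F F' x - piconeTerm g F F' y ≤ ∫ t in x..y, (conj (F t) * W t).re := by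
  have hcF : ContinuousOn F (Icc x y) := fun t ht => (hF t ht).continuousAt.continuousWithinAt
  have hd : ∀ t ∈ Icc x y, HasDerivAt (piconeTerm g F F')
      ((conj (F' t) * F' t + conj (F t) * (q t * F t - W t)).re -
        ((q t - g t ^ 2) * Complex.normSq (F t) + g t * (2 * (conj (F t) * F' t).re))) t := by
    intro t ht
    have h1 := Complex.reCLM.hasFDerivAt.comp_hasDerivAt t ((hF t ht).star.mul (hF' t ht))
    exact h1.sub ((hg t ht).mul (hasDerivAt_normSq (hF t ht)))
  have hcW : ContinuousOn (fun t => (conj (F t) * W t).re) (Icc x y) :=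
    Complex.continuous_re.comp_continuousOn
      ((Complex.continuous_conj.comp_continuousOn hcF).mul hW)
  have := intervalIntegral.integral_le_sub_of_hasDeriv_right_of_le hxy
    (fun t ht => (hd t ht).continuousAt.continuousWithinAt)
    (fun t ht => (hd t (Ioo_subset_Icc_self ht)).hasDerivWithinAt)
    (φ := fun t => -(conj (F t) * W t).re) (hcW.neg.integrableOn_Icc) (fun t ht => ?_)
  · rw [intervalIntegral.integral_neg] at this
    linarith
  · simp only [Complex.mul_re, Complex.conj_re, Complex.conj_im, Complex.normSq_apply,
        Complex.ofReal_re, Complex.ofReal_im, Complex.mul_im, Complex.add_re, Complex.sub_re,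
        Complex.sub_im]
    nlinarith [sq_nonneg ((F' t).re - g t * (F t).re), sq_nonneg ((F' t).im - g t * (F t).im)]

/-- The comparison solution may vanish at the endpoint, where `g` has a pole; so the boundary term
enters as a one-sided limit. -/
lemma picone_left {q g : ℝ → ℝ} {F F' W : ℝ → ℂ} {x y A : ℝ} (hxy : x < y)
    (hg : ∀ t ∈ Ioc x y, HasDerivAt g (q t - g t ^ 2) t)
    (hF : ∀ t ∈ Ioc x y, HasDerivAt F (F' t) t)
    (hF' : ∀ t ∈ Ioc x y, HasDerivAt F' (q t * F t - W t) t)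
    (hcF : ContinuousOn F (Icc x y)) (hW : ContinuousOn W (Icc x y))
    (hA : Tendsto (piconeTerm g F F') (𝓝[>] x) (𝓝 A)) :
    A - piconeTerm g F F' y ≤ ∫ t in x..y, (conj (F t) * W t).re := by
  have hcW : ContinuousOn (fun t => (conj (F t) * W t).re) (Icc x y) :=
    Complex.continuous_re.comp_continuousOn
      ((Complex.continuous_conj.comp_continuousOn hcF).mul hW)
  have h1 : ContinuousOn (fun z => ∫ t in z..y, (conj (F t) * W t).re) (uIcc x y) :=
    intervalIntegral.continuousOn_primitive_interval_left
      (by rw [uIcc_of_le hxy.le]; exact hcW.integrableOn_Icc)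
  rw [uIcc_of_le hxy.le] at h1
  have h2 : Tendsto (fun z => ∫ t in z..y, (conj (F t) * W t).re) (𝓝[>] x)
      (𝓝 (∫ t in x..y, (conj (F t) * W t).re)) := by
    have := h1 x (left_mem_Icc.2 hxy.le)
    exact this.mono_left (by
      rw [← nhdsWithin_Ioo_eq_nhdsGT hxy]; exact nhdsWithin_mono _ Ioo_subset_Icc_self)
  refine le_of_tendsto_of_tendsto (hA.sub_const _) h2 ?_
  filter_upwards [Ioo_mem_nhdsGT hxy] with z hz
  have hs : Icc z y ⊆ Ioc x y := fun t ht => ⟨hz.1.trans_le ht.1, ht.2⟩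
  exact picone_Icc hz.2.le (fun t ht => hg t (hs ht)) (fun t ht => hF t (hs ht))
    (fun t ht => hF' t (hs ht)) (hW.mono (hs.trans Ioc_subset_Icc_self))

lemma picone_Ioo {q g : ℝ → ℝ} {F F' W : ℝ → ℂ} {x y A B : ℝ} (hxy : x < y)
    (hg : ∀ t ∈ Ioo x y, HasDerivAt g (q t - g t ^ 2) t)
    (hF : ∀ t ∈ Ioo x y, HasDerivAt F (F' t) t)
    (hF' : ∀ t ∈ Ioo x y, HasDerivAt F' (q t * F t - W t) t)
    (hcF : ContinuousOn F (Icc x y)) (hW : ContinuousOn W (Icc x y))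
    (hA : Tendsto (piconeTerm g F F') (𝓝[>] x) (𝓝 A))
    (hB : Tendsto (piconeTerm g F F') (𝓝[<] y) (𝓝 B)) :
    A - B ≤ ∫ t in x..y, (conj (F t) * W t).re := by
  have hcW : ContinuousOn (fun t => (conj (F t) * W t).re) (Icc x y) :=
    Complex.continuous_re.comp_continuousOn
      ((Complex.continuous_conj.comp_continuousOn hcF).mul hW)
  have h1 : ContinuousOn (fun z => ∫ t in x..z, (conj (F t) * W t).re) (uIcc x y) :=
    intervalIntegral.continuousOn_primitive_interval
      (by rw [uIcc_of_le hxy.le]; exact hcW.integrableOn_Icc)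
  rw [uIcc_of_le hxy.le] at h1
  have h2 : Tendsto (fun z => ∫ t in x..z, (conj (F t) * W t).re) (𝓝[<] y)
      (𝓝 (∫ t in x..y, (conj (F t) * W t).re)) := by
    have := h1 y (right_mem_Icc.2 hxy.le)
    exact this.mono_left (by
      rw [← nhdsWithin_Ioo_eq_nhdsLT hxy]; exact nhdsWithin_mono _ Ioo_subset_Icc_self)
  refine le_of_tendsto_of_tendsto (hB.const_sub _) h2 ?_
  filter_upwards [Ioo_mem_nhdsLT hxy] with z hz
  have hs : Ioc x z ⊆ Ioo x y := fun t ht => ⟨ht.1, ht.2.trans_lt hz.2⟩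
  have hs' : Icc x z ⊆ Icc x y := Icc_subset_Icc_right hz.2.le
  exact picone_left hz.1 (fun t ht => hg t (hs ht)) (fun t ht => hF t (hs ht))
    (fun t ht => hF' t (hs ht)) (hcF.mono hs') (hW.mono hs') hA

/-- Both functions are integrable with integrable derivative, because `F`, `F'` and `F'' = q F - W`
are all square-integrable. This removes the boundary terms at infinity. -/
lemma SolvesEdge.tendsto_zero {q : ℝ → ℝ} {C : ℝ} (hq : ∀ x, |q x| ≤ C) (hqc : Continuous q)
    {F F' W : ℝ → ℂ} (h : SolvesEdge q F F' W) :
    Tendsto (fun x => conj (F x) * F' x) atTop (𝓝 0) ∧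
      Tendsto (fun x => Complex.normSq (F x)) atTop (𝓝 0) := by
  have hqF : MemLp (fun x => (q x : ℂ) * F x - W x) 2 halfLine := by
    refine MemLp.sub (h.mem.of_le_mul (c := C) ?_ (Eventually.of_forall fun t => ?_)) h.memW
    · exact (Complex.continuous_ofReal.comp hqc).aestronglyMeasurable.mul
        h.mem.aestronglyMeasurable
    · rw [norm_mul, Complex.norm_real, Real.norm_eq_abs]
      gcongr
      exact hq t
  constructor
  · refine tendsto_zero_of_hasDerivAt_of_integrableOn_Ioi
      (fun x hx => (h.deriv x hx).star.mul (h.deriv' x hx)) ?_ (integrable_conj_mul h.mem h.mem')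
    exact (integrable_conj_mul h.mem' h.mem').add (integrable_conj_mul h.mem hqF)
  · have h1 : Tendsto (fun x => conj (F x) * F x) atTop (𝓝 0) :=
      tendsto_zero_of_hasDerivAt_of_integrableOn_Ioi
        (fun x hx => (h.deriv x hx).star.mul (h.deriv x hx))
        ((integrable_conj_mul h.mem' h.mem).add (integrable_conj_mul h.mem h.mem'))
        (integrable_conj_mul h.mem h.mem)
    have h2 := (Complex.continuous_re.tendsto 0).comp h1
    refine h2.congr fun x => ?_
    simp only [Function.comp_apply]
    rw [← Complex.normSq_eq_conj_mul_self, Complex.ofReal_re]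

lemma SolvesEdge.picone_Ioi {q g : ℝ → ℝ} {C : ℝ} (hq : ∀ x, |q x| ≤ C) (hqc : Continuous q)
    {F F' W : ℝ → ℂ} (h : SolvesEdge q F F' W) {x A : ℝ} (hx : 0 ≤ x)
    (hg : ∀ t, x < t → HasDerivAt g (q t - g t ^ 2) t)
    (hgb : IsBoundedUnder (· ≤ ·) atTop fun t => |g t|)
    (hA : Tendsto (piconeTerm g F F') (𝓝[>] x) (𝓝 A)) :
    A ≤ ∫ t in Ioi x, (conj (F t) * W t).re := by
  have hi : IntegrableOn (fun t => (conj (F t) * W t).re) (Ioi x) :=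
    (Complex.reCLM.integrable_comp (integrable_conj_mul h.mem h.memW)).mono_measure
      (Measure.restrict_mono (Ioi_subset_Ioi hx) le_rfl)
  obtain ⟨h1, h2⟩ := h.tendsto_zero hq hqc
  have h3 : Tendsto (piconeTerm g F F') atTop (𝓝 0) := by
    have h4 : Tendsto (fun t => g t * Complex.normSq (F t)) atTop (𝓝 0) :=
      bdd_le_mul_tendsto_zero' hgb.eventually_le.choose hgb.eventually_le.choose_spec h2
    have h5 := (((Complex.continuous_re.tendsto 0).comp h1)).sub h4
    rw [Complex.zero_re, sub_zero] at h5
    exact h5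
  have h5 := intervalIntegral_tendsto_integral_Ioi x hi tendsto_id
  have h6 := le_of_tendsto_of_tendsto (h3.const_sub A) h5 (by
    filter_upwards [Ioi_mem_atTop x] with y hy
    have hs : Icc x y ⊆ Ici 0 := fun t ht => hx.trans ht.1
    exact picone_left hy (fun t ht => hg t ht.1) (fun t ht => h.deriv t (hx.trans_lt ht.1))
      (fun t ht => h.deriv' t (hx.trans_lt ht.1)) (h.cont.mono hs) (h.contW.mono hs) hA)
  simpa using h6

/-- If `F` vanishes at `b` and `g` has at most a simple pole there, the boundary term of Picone's
identity vanishes at `b`. -/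
lemma tendsto_piconeTerm_zero {g : ℝ → ℝ} {F F' : ℝ → ℂ} {b L : ℝ}
    (hF : HasDerivAt F (F' b) b) (hF' : ContinuousAt F' b) (hb : F b = 0)
    (hg : Tendsto (fun x => g x * (x - b)) (𝓝[≠] b) (𝓝 L)) :
    Tendsto (piconeTerm g F F') (𝓝[≠] b) (𝓝 0) := by
  have h1 : Tendsto (fun x => (conj (F x) * F' x).re) (𝓝[≠] b) (𝓝 0) := by
    have : ContinuousAt (fun x => (conj (F x) * F' x).re) b :=
      Complex.continuous_re.continuousAt.comp
        ((Complex.continuous_conj.continuousAt.comp hF.continuousAt).mul hF')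
    have h := this.tendsto
    simp only [hb, map_zero, zero_mul, Complex.zero_re] at h
    exact h.mono_left nhdsWithin_le_nhds
  have h2 : Tendsto (fun x => Complex.normSq (slope F b x)) (𝓝[≠] b) (𝓝 (Complex.normSq (F' b))) :=
    (Complex.continuous_normSq.tendsto _).comp (hasDerivAt_iff_tendsto_slope.1 hF)
  have h3 : Tendsto (fun x : ℝ => x - b) (𝓝[≠] b) (𝓝 0) := by
    have : ContinuousAt (fun x : ℝ => x - b) b := by fun_prop
    have h := this.tendsto
    rw [sub_self] at h
    exact h.mono_left nhdsWithin_le_nhds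
  -- Near `b` the term `g |F|²` is the product of `g (x - b)`, of `x - b` and of the squared slope
  -- of `F`; only the middle factor tends to zero.
  have h4 := (hg.mul h3).mul h2
  have h5 : Tendsto (fun x => g x * Complex.normSq (F x)) (𝓝[≠] b) (𝓝 0) := by
    rw [mul_zero, zero_mul] at h4
    refine h4.congr' ?_
    filter_upwards [self_mem_nhdsWithin] with x hx
    have hx' : x - b ≠ 0 := sub_ne_zero.2 hx
    rw [slope_def_module, hb, sub_zero, Complex.real_smul, Complex.normSq_mul,
      Complex.normSq_ofReal]
    field_simp
  have h6 := h1.sub h5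
  rw [sub_zero] at h6
  exact h6

/-! ### The `sech²` well and its explicit Riccati solutions. -/

lemma hasDerivAt_tanh (x : ℝ) : HasDerivAt Real.tanh (1 - Real.tanh x ^ 2) x := by
  have h : Real.tanh = fun x => Real.sinh x / Real.cosh x := by
    ext x; exact Real.tanh_eq_sinh_div_cosh x
  have hc := (Real.cosh_pos x).ne'
  rw [h]
  refine ((Real.hasDerivAt_sinh x).div (Real.hasDerivAt_cosh x) hc).congr_deriv ?_
  field_simp

lemma hasDerivAt_tanh_mul (s x : ℝ) :
    HasDerivAt (fun x => Real.tanh (s * x)) (s * (1 - Real.tanh (s * x) ^ 2)) x := by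
  have h1 : HasDerivAt (fun x => s * x) s x := by
    simpa using (hasDerivAt_id x).const_mul s
  refine ((hasDerivAt_tanh (s * x)).comp x h1).congr_deriv ?_
  ring

lemma tanh_sq_lt_one (x : ℝ) : Real.tanh x ^ 2 < 1 := by
  have := Real.abs_tanh_lt_one x
  rwa [← sq_lt_one_iff_abs_lt_one] at this

lemma tanh_pos {x : ℝ} (hx : 0 < x) : 0 < Real.tanh x := by
  rw [Real.tanh_eq_sinh_div_cosh]
  exact div_pos (Real.sinh_pos_iff.2 hx) (Real.cosh_pos x)

lemma tanh_ne_zero {x : ℝ} (hx : x ≠ 0) : Real.tanh x ≠ 0 := by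
  rw [Real.tanh_eq_sinh_div_cosh]
  exact div_ne_zero (by simpa using hx) (Real.cosh_pos x).ne'

lemma tanh_mono {x y : ℝ} (h : x ≤ y) : Real.tanh x ≤ Real.tanh y :=
  monotone_of_hasDerivAt_nonneg hasDerivAt_tanh
    (fun x => by have := tanh_sq_lt_one x; simp only [Pi.zero_apply]; linarith) h

lemma continuous_tanh : Continuous Real.tanh :=
  continuous_iff_continuousAt.2 fun x => (hasDerivAt_tanh x).continuousAt

/-- The potential `r² - κ r² sech² (p r y)`. -/
def well (κ p r y : ℝ) : ℝ := r ^ 2 - κ * r ^ 2 * (1 - Real.tanh (p * r * y) ^ 2)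

lemma continuous_well (κ p r : ℝ) : Continuous (well κ p r) := by
  have := continuous_tanh
  unfold well
  fun_prop

lemma abs_well_le (κ p r y : ℝ) : |well κ p r y| ≤ r ^ 2 + |κ| * r ^ 2 := by
  have h1 := tanh_sq_lt_one (p * r * y)
  have h2 := sq_nonneg (Real.tanh (p * r * y))
  unfold well
  refine (abs_sub _ _).trans ?_
  rw [abs_mul, abs_mul, abs_of_nonneg (sq_nonneg r),
    abs_of_nonneg (by linarith : 0 ≤ 1 - Real.tanh (p * r * y) ^ 2)]
  have : 0 ≤ |κ| * r ^ 2 := by positivity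
  nlinarith

/-- The logarithmic derivative of the soliton. -/
def logDerivSoliton (p r y : ℝ) : ℝ := -r * Real.tanh (p * r * y)

/-- The Riccati form of the `L₋` equation satisfied by the soliton. -/
lemma hasDerivAt_logDerivSoliton (p r y : ℝ) :
    HasDerivAt (logDerivSoliton p r) (well (p + 1) p r y - logDerivSoliton p r y ^ 2) y := by
  refine ((hasDerivAt_tanh_mul (p * r) y).const_mul (-r)).congr_deriv ?_
  simp only [well, logDerivSoliton]
  ring

/-- The logarithmic derivative of the derivative of the soliton. -/
def logDerivSoliton' (p r y : ℝ) : ℝ :=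
  r * (p / Real.tanh (p * r * y) - (p + 1) * Real.tanh (p * r * y))

/-- Differentiating the soliton equation shows that `φ'` solves the `L₊` equation at energy zero;
this is its Riccati form, valid away from the only zero of `φ'`. -/
lemma hasDerivAt_logDerivSoliton' {p r y : ℝ} (hp : 0 < p) (hr : 0 < r) (hy : y ≠ 0) :
    HasDerivAt (logDerivSoliton' p r)
      (well ((2 * p + 1) * (p + 1)) p r y - logDerivSoliton' p r y ^ 2) y := by
  have h0 : Real.tanh (p * r * y) ≠ 0 := tanh_ne_zero (by positivity)
  have h1 := hasDerivAt_tanh_mul (p * r) y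
  refine ((((hasDerivAt_const y p).div h1 h0).sub (h1.const_mul (p + 1))).const_mul r).congr_deriv ?_
  simp only [well, logDerivSoliton']
  clear h1
  generalize Real.tanh (p * r * y) = θ at *
  field_simp
  ring

lemma logDerivSoliton'_neg (p r y : ℝ) : logDerivSoliton' p r (-y) = - logDerivSoliton' p r y := by
  simp [logDerivSoliton', div_neg]
  ring

/-- The zero of `φ'` at the top is simple, so its logarithmic derivative has a simple pole with
residue `1`. -/
lemma tendsto_logDerivSoliton'_mul {p r : ℝ} (hp : 0 < p) (hr : 0 < r) :
    Tendsto (fun y => logDerivSoliton' p r y * y) (𝓝[≠] 0) (𝓝 1) := by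
  have h1 := hasDerivAt_iff_tendsto_slope.1 (hasDerivAt_tanh_mul (p * r) 0)
  simp only [mul_zero, Real.tanh_zero, ne_eq, OfNat.ofNat_ne_zero, not_false_eq_true, zero_pow,
    sub_zero, mul_one] at h1
  have hs : p * r ≠ 0 := by positivity
  have h2 := (h1.inv₀ hs).const_mul (r * p)
  have h3 : Tendsto (fun y : ℝ => r * ((p + 1) * Real.tanh (p * r * y)) * y) (𝓝[≠] 0) (𝓝 0) := by
    have hc := continuous_tanh
    have : Continuous (fun y : ℝ => r * ((p + 1) * Real.tanh (p * r * y)) * y) := by fun_prop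
    have h := this.tendsto 0
    simp only [mul_zero] at h
    exact h.mono_left nhdsWithin_le_nhds
  have h4 := h2.sub h3
  have e : r * p * (p * r)⁻¹ - 0 = 1 := by field_simp; simp
  rw [e] at h4
  refine h4.congr' ?_
  filter_upwards [self_mem_nhdsWithin] with y hy
  have hy' : y ≠ 0 := hy
  have h0 : Real.tanh (p * r * y) ≠ 0 := tanh_ne_zero (by positivity)
  simp only [slope_def_field, mul_zero, Real.tanh_zero, sub_zero, logDerivSoliton']
  field_simp

lemma isBoundedUnder_logDerivSoliton' {p r : ℝ} (hp : 0 < p) (hr : 0 < r) (a : ℝ) :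
    IsBoundedUnder (· ≤ ·) atTop fun y => |logDerivSoliton' p r (y + a)| := by
  refine isBoundedUnder_of_eventually_le (a := r * (p / Real.tanh (p * r * 1) + (p + 1))) ?_
  filter_upwards [eventually_ge_atTop (1 - a)] with y hy
  have h1 : 0 < Real.tanh (p * r * 1) := tanh_pos (by positivity)
  have h2 : Real.tanh (p * r * 1) ≤ Real.tanh (p * r * (y + a)) :=
    tanh_mono (by gcongr; linarith)
  have h3 := Real.tanh_lt_one (p * r * (y + a))
  have h4 : 0 < Real.tanh (p * r * (y + a)) := h1.trans_le h2
  rw [logDerivSoliton', abs_mul, abs_of_pos hr]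
  gcongr
  refine (abs_sub _ _).trans ?_
  rw [abs_of_pos (by positivity), abs_of_pos (by positivity)]
  gcongr
  nlinarith

/-! ### Power series with explicit coefficient bounds and the hypergeometric equation. -/

/-- The sum of the power series with coefficients `a`. -/
def powerSum (a : ℕ → ℝ) (z : ℝ) : ℝ := ∑' n, a n * z ^ n

/-- The coefficients of the derivative of a power series. -/
def derivCoeff (a : ℕ → ℝ) (n : ℕ) : ℝ := (n + 1) * a (n + 1)

/-- The coefficients grow at most like those of `M (1 - z)^{-(k+1)}`. -/
def CoeffBound (M : ℝ) (k : ℕ) (a : ℕ → ℝ) : Prop := ∀ n, |a n| ≤ M * (n + k).choose k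

lemma CoeffBound.derivCoeff {M : ℝ} {k : ℕ} {a : ℕ → ℝ} (h : CoeffBound M k a) :
    CoeffBound (M * (k + 1)) (k + 1) (derivCoeff a) := by
  intro n
  have h1 := h (n + 1)
  have h2 : ((n : ℝ) + 1) * ((n + 1 + k).choose k : ℝ) =
      (k + 1) * ((n + (k + 1)).choose (k + 1) : ℝ) := by
    have h3 := Nat.choose_succ_right_eq (n + 1 + k) k
    rw [show n + 1 + k - k = n + 1 by omega] at h3
    rw [show n + (k + 1) = n + 1 + k by ring]
    have h4 : ((n + 1 + k).choose (k + 1) : ℝ) * (k + 1) = (n + 1 + k).choose k * (n + 1) := by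
      exact_mod_cast h3
    linarith
  rw [StarGraph.derivCoeff, abs_mul, abs_of_nonneg (by positivity : (0 : ℝ) ≤ n + 1)]
  calc ((n : ℝ) + 1) * |a (n + 1)| ≤ (n + 1) * (M * (n + 1 + k).choose k) := by gcongr
    _ = M * ((n + 1) * ((n + 1 + k).choose k : ℝ)) := by ring
    _ = _ := by rw [h2]; ring

lemma summable_choose_bound (M : ℝ) (k : ℕ) {z : ℝ} (hz : |z| < 1) :
    Summable fun n : ℕ => M * (n + k).choose k * |z| ^ n := by
  have := (summable_choose_mul_geometric_of_norm_lt_one (R := ℝ) k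
    (r := |z|) (by simpa using hz)).mul_left M
  simpa [mul_assoc] using this

lemma CoeffBound.norm_le {M : ℝ} {k : ℕ} {a : ℕ → ℝ} (h : CoeffBound M k a) {z w : ℝ}
    (hz : |z| ≤ w) (n : ℕ) : ‖a n * z ^ n‖ ≤ M * (n + k).choose k * w ^ n := by
  rw [norm_mul, norm_pow, Real.norm_eq_abs, Real.norm_eq_abs]
  have h1 := h n
  have h2 : 0 ≤ M * (n + k).choose k := (abs_nonneg _).trans h1
  gcongr

lemma CoeffBound.hasSum {M : ℝ} {k : ℕ} {a : ℕ → ℝ} (h : CoeffBound M k a) {z : ℝ}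
    (hz : |z| < 1) : HasSum (fun n => a n * z ^ n) (powerSum a z) :=
  (Summable.of_norm_bounded (summable_choose_bound M k hz)
    fun n => h.norm_le le_rfl n).hasSum

lemma CoeffBound.abs_powerSum_le {M : ℝ} {k : ℕ} {a : ℕ → ℝ} (h : CoeffBound M k a) {z w : ℝ}
    (hw : |w| < 1) (hz : |z| ≤ |w|) :
    |powerSum a z| ≤ ∑' n : ℕ, M * (n + k).choose k * |w| ^ n := by
  rw [← Real.norm_eq_abs, powerSum]
  exact tsum_of_norm_bounded (summable_choose_bound M k hw).hasSum fun n => h.norm_le hz n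

lemma CoeffBound.hasDerivAt {M : ℝ} {k : ℕ} {a : ℕ → ℝ} (h : CoeffBound M k a) {z : ℝ}
    (hz : |z| < 1) : HasDerivAt (powerSum a) (powerSum (StarGraph.derivCoeff a) z) z := by
  obtain ⟨w, hzw, hw1⟩ := exists_between hz
  have hw0 : 0 ≤ w := (abs_nonneg z).trans hzw.le
  have hw : |w| < 1 := by rwa [abs_of_nonneg hw0]
  have hD := h.derivCoeff
  set u : ℕ → ℝ := fun n => M * (k + 1) * (n + (k + 1)).choose (k + 1) * |w| ^ n
  have hu : Summable u := summable_choose_bound _ _ hw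
  have h1 : HasDerivAt (fun z => ∑' n, a (n + 1) * z ^ (n + 1))
      (∑' n, StarGraph.derivCoeff a n * z ^ n) z := by
    refine hasDerivAt_tsum_of_isPreconnected (𝕜 := ℝ) (g := fun n z => a (n + 1) * z ^ (n + 1))
      -- The derivatives are dominated uniformly on `(-w, w)`, with `|z| < w < 1`; the constant term
      -- of the series was split off so that indices match.
      (g' := fun n z => StarGraph.derivCoeff a n * z ^ n) (t := Ioo (-w) w) (y₀ := 0) hu isOpen_Ioo
      isPreconnected_Ioo (fun n y hy => ?_) (fun n y hy => ?_) ?_ ?_ ?_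
    · refine ((hasDerivAt_pow (n + 1) y).const_mul (a (n + 1))).congr_deriv ?_
      simp [StarGraph.derivCoeff]
      ring
    · exact hD.norm_le (by rw [abs_of_nonneg hw0]; exact (abs_lt.2 hy).le) n
    · have := (abs_nonneg z).trans_lt hzw
      exact ⟨by linarith, this⟩
    · simp [summable_zero]
    · exact abs_lt.1 hzw
  have h2 : powerSum a =ᶠ[𝓝 z] fun z => a 0 + ∑' n, a (n + 1) * z ^ (n + 1) := by
    filter_upwards [(isOpen_lt continuous_abs continuous_const).mem_nhds hz] with y hy
    rw [powerSum, (h.hasSum hy).summable.tsum_eq_zero_add]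
    simp
  exact (h1.const_add (a 0)).congr_of_eventuallyEq h2

lemma CoeffBound.hasSum_mul_deriv {M : ℝ} {k : ℕ} {a : ℕ → ℝ} (h : CoeffBound M k a) {z : ℝ}
    (hz : |z| < 1) :
    HasSum (fun n : ℕ => n * a n * z ^ n) (z * powerSum (StarGraph.derivCoeff a) z) := by
  have h1 := (h.derivCoeff.hasSum hz).mul_left z
  rw [← hasSum_nat_add_iff' 1]
  simp only [Finset.sum_range_one, Nat.cast_zero, zero_mul, sub_zero]
  refine h1.congr_fun fun n => ?_
  simp only [StarGraph.derivCoeff]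
  push_cast
  ring

/-- The coefficients of the hypergeometric series `F(-ν, ν + 1; 1 + κ; z)`, where
`A = ν (ν + 1)`. -/
def hyperCoeff (A κ : ℝ) : ℕ → ℝ
  | 0 => 1
  | n + 1 => hyperCoeff A κ n * ((n * (n + 1) - A) / ((n + 1) * (n + 1 + κ)))

/-- The ratio of consecutive coefficients is at most `1 + A` always and at most `1` once `n ≥ A`.
The bound is uniform in `κ`, which later gives continuity in the energy. -/
lemma exists_coeffBound_hyperCoeff {A : ℝ} (hA : 0 ≤ A) :
    ∃ M, ∀ κ, 0 ≤ κ → CoeffBound M 0 (hyperCoeff A κ) := by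
  obtain ⟨m, hm⟩ := exists_nat_ge A
  refine ⟨(1 + A) ^ m, fun κ hκ n => ?_⟩
  have key : |hyperCoeff A κ n| ≤ (1 + A) ^ (min n m) := by
    induction n with
    | zero => simp [hyperCoeff]
    | succ n ih =>
      have hd : (0 : ℝ) < (n + 1) * (n + 1 + κ) := by positivity
      rw [hyperCoeff, abs_mul, abs_div, abs_of_pos hd]
      rcases lt_or_ge n m with h | h
      · rw [min_eq_left h, pow_succ]
        rw [min_eq_left h.le] at ih
        gcongr
        rw [div_le_iff₀ hd]
        refine (abs_sub _ _).trans ?_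
        rw [abs_of_nonneg hA, abs_of_nonneg (by positivity)]
        nlinarith [mul_nonneg hA hκ, mul_nonneg (mul_nonneg hA hκ) (Nat.cast_nonneg (α := ℝ) n),
          mul_nonneg hA (Nat.cast_nonneg (α := ℝ) n), mul_nonneg hκ (Nat.cast_nonneg (α := ℝ) n),
          mul_nonneg hA (sq_nonneg (n : ℝ)), Nat.cast_nonneg (α := ℝ) n]
      · rw [min_eq_right (by omega)]
        rw [min_eq_right h] at ih
        refine (mul_le_of_le_one_right (abs_nonneg _) ?_).trans ih
        rw [div_le_one hd]
        have h2 : (m : ℝ) ≤ n := by exact_mod_cast h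
        rw [abs_le]
        constructor <;> nlinarith [mul_nonneg hκ (Nat.cast_nonneg (α := ℝ) n),
          Nat.cast_nonneg (α := ℝ) n]
  simp only [add_zero, Nat.choose_zero_right, Nat.cast_one, mul_one]
  exact key.trans (pow_le_pow_right₀ (by linarith) (min_le_right _ _))

lemma continuousOn_hyperCoeff (A : ℝ) (n : ℕ) :
    ContinuousOn (fun κ => hyperCoeff A κ n) (Ici 0) := by
  induction n with
  | zero => simpa [hyperCoeff] using continuousOn_const
  | succ n ih =>
    simp only [hyperCoeff]
    refine ih.mul (continuousOn_const.div (by fun_prop) fun κ hκ => ?_)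
    have : (0 : ℝ) ≤ κ := hκ
    positivity

lemma hyper_ode {A κ z : ℝ} (hA : 0 ≤ A) (hκ : 0 ≤ κ) (hz : |z| < 1) :
    z * (1 - z) * powerSum (derivCoeff (derivCoeff (hyperCoeff A κ))) z
      + (1 + κ - 2 * z) * powerSum (derivCoeff (hyperCoeff A κ)) z
      + A * powerSum (hyperCoeff A κ) z = 0 := by
  obtain ⟨M, hM⟩ := exists_coeffBound_hyperCoeff hA
  have h0 := hM κ hκ
  set c := hyperCoeff A κ with hc
  have s0 := h0.hasSum hz
  have s1 := h0.derivCoeff.hasSum hz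
  have s2 := h0.hasSum_mul_deriv hz
  have s3 := h0.derivCoeff.hasSum_mul_deriv hz
  have s4 : HasSum (fun n : ℕ => (n : ℝ) * (n - 1) * c n * z ^ n)
      (z * (z * powerSum (derivCoeff (derivCoeff c)) z)) := by
    rw [← hasSum_nat_add_iff' 1]
    simp only [Finset.sum_range_one, Nat.cast_zero, zero_mul, sub_zero]
    refine (s3.mul_left z).congr_fun fun n => ?_
    simp only [derivCoeff]
    push_cast
    ring
  have s5 := (((s3.sub s4).add (s1.mul_left (1 + κ))).sub (s2.mul_left 2)).add (s0.mul_left A)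
  have s6 : (fun b : ℕ => b * derivCoeff c b * z ^ b - b * (b - 1) * c b * z ^ b +
      (1 + κ) * (derivCoeff c b * z ^ b) - 2 * (b * c b * z ^ b) + A * (c b * z ^ b)) =
      fun _ => 0 := by
    ext n
    have hd : ((n : ℝ) + 1 + κ) ≠ 0 := by positivity
    have hd' : ((n : ℝ) + 1) ≠ 0 := by positivity
    -- The recursion is exactly the vanishing of the coefficient of `z ^ n` in the equation.
    have e : c (n + 1) * ((n + 1) * (n + 1 + κ)) = c n * (n * (n + 1) - A) := by
      rw [hc, hyperCoeff]
      field_simp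
    simp only [derivCoeff]
    linear_combination z ^ n * e
  rw [s6] at s5
  have := s5.unique hasSum_zero
  linear_combination this

/-! ### Solutions with prescribed exponential decay at `+∞`. -/

/-- The variable `z = (1 - tanh (s y)) / 2 ∈ (0, 1)`. -/
def zvar (s y : ℝ) : ℝ := (1 - Real.tanh (s * y)) / 2

lemma zvar_pos (s y : ℝ) : 0 < zvar s y := by
  have := Real.tanh_lt_one (s * y)
  unfold zvar; linarith

lemma zvar_lt_one (s y : ℝ) : zvar s y < 1 := by
  have := Real.neg_one_lt_tanh (s * y)
  unfold zvar; linarith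

lemma abs_zvar_lt_one (s y : ℝ) : |zvar s y| < 1 := by
  rw [abs_of_pos (zvar_pos s y)]; exact zvar_lt_one s y

lemma hasDerivAt_zvar (s y : ℝ) :
    HasDerivAt (zvar s) (-(2 * s * zvar s y * (1 - zvar s y))) y := by
  refine (((hasDerivAt_tanh_mul s y).const_sub 1).div_const 2).congr_deriv ?_
  unfold zvar
  ring

lemma zvar_anti {s x y : ℝ} (hs : 0 ≤ s) (h : x ≤ y) : zvar s y ≤ zvar s x := by
  have := tanh_mono (mul_le_mul_of_nonneg_left h hs)
  unfold zvar; linarith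

lemma zvar_eq (s y : ℝ) : zvar s y = (1 + Real.exp (2 * (s * y)))⁻¹ := by
  have h1 : Real.exp (2 * (s * y)) = Real.exp (s * y) * Real.exp (s * y) := by
    rw [← Real.exp_add]; ring_nf
  have h2 : Real.exp (-(s * y)) = (Real.exp (s * y))⁻¹ := Real.exp_neg _
  have h3 := Real.exp_pos (s * y)
  rw [zvar, Real.tanh_eq, h1, h2]
  field_simp
  ring

lemma tendsto_zvar {s : ℝ} (hs : 0 < s) : Tendsto (zvar s) atTop (𝓝 0) := by
  have h : zvar s = fun y => (1 + Real.exp (2 * (s * y)))⁻¹ := funext (zvar_eq s)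
  rw [h]
  refine Tendsto.inv_tendsto_atTop (tendsto_atTop_add_const_left _ _ ?_)
  exact Real.tendsto_exp_atTop.comp
    ((tendsto_id.const_mul_atTop hs).const_mul_atTop two_pos)

/-- The solution of `u'' = (k² - A s² sech² (s y)) u` with `u(y) ~ e^{-k y}` at `+∞`. -/
def jost (A s k y : ℝ) : ℝ := Real.exp (-(k * y)) * powerSum (hyperCoeff A (k / s)) (zvar s y)

/-- The derivative of `jost`. -/
def jost' (A s k y : ℝ) : ℝ := Real.exp (-(k * y)) *
  (-k * powerSum (hyperCoeff A (k / s)) (zvar s y) -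
    2 * s * zvar s y * (1 - zvar s y) * powerSum (derivCoeff (hyperCoeff A (k / s))) (zvar s y))

lemma hasDerivAt_exp_neg_mul (k y : ℝ) :
    HasDerivAt (fun y : ℝ => Real.exp (-(k * y))) (-k * Real.exp (-(k * y))) y := by
  refine (((hasDerivAt_id y).const_mul k).neg.exp).congr_deriv ?_
  simp only [Pi.neg_apply, id]
  ring

lemma hasDerivAt_jost {A s k : ℝ} (hA : 0 ≤ A) (hs : 0 < s) (hk : 0 ≤ k) (y : ℝ) :
    HasDerivAt (jost A s k) (jost' A s k y) y := by
  obtain ⟨M, hM⟩ := exists_coeffBound_hyperCoeff hA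
  have h0 := hM (k / s) (by positivity)
  have h1 := (h0.hasDerivAt (abs_zvar_lt_one s y)).comp y (hasDerivAt_zvar s y)
  refine ((hasDerivAt_exp_neg_mul k y).mul h1).congr_deriv ?_
  simp only [jost', Function.comp_apply]
  ring

lemma hasDerivAt_jost' {A s k : ℝ} (hA : 0 ≤ A) (hs : 0 < s) (hk : 0 ≤ k) (y : ℝ) :
    HasDerivAt (jost' A s k)
      ((k ^ 2 - A * s ^ 2 * (1 - Real.tanh (s * y) ^ 2)) * jost A s k y) y := by
  obtain ⟨M, hM⟩ := exists_coeffBound_hyperCoeff hA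
  have h0 := hM (k / s) (by positivity)
  have hz := hasDerivAt_zvar s y
  have h1 := (h0.hasDerivAt (abs_zvar_lt_one s y)).comp y hz
  have h2 := (h0.derivCoeff.hasDerivAt (abs_zvar_lt_one s y)).comp y hz
  have hode := hyper_ode hA (κ := k / s) (by positivity) (abs_zvar_lt_one s y)
  have h3 := (hasDerivAt_exp_neg_mul k y).mul ((h1.const_mul (-k)).sub
    (((hz.const_mul (2 * s)).mul (hz.const_sub 1)).mul h2))
  refine h3.congr_deriv ?_
  -- In the variable `z` one has `1 - tanh² = 4 z (1 - z)`, so the equation reduces to the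
  -- hypergeometric one.
  have ht : Real.tanh (s * y) = 1 - 2 * zvar s y := by unfold zvar; ring
  simp only [jost, ht, Function.comp_apply, Pi.mul_apply, Pi.sub_apply]
  generalize powerSum (derivCoeff (derivCoeff (hyperCoeff A (k / s)))) (zvar s y) = f2 at *
  generalize powerSum (derivCoeff (hyperCoeff A (k / s))) (zvar s y) = f1 at *
  generalize powerSum (hyperCoeff A (k / s)) (zvar s y) = f0 at *
  generalize zvar s y = z at *
  have hk' : k = s * (k / s) := by field_simp
  generalize k / s = κ at *
  subst hk'
  linear_combination (4 * s ^ 2 * z * (1 - z) * Real.exp (-(s * κ * y))) * hode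

lemma exists_jost_bound {A s k : ℝ} (hA : 0 ≤ A) (hs : 0 < s) (hk : 0 ≤ k) (y₀ : ℝ) :
    ∃ C, ∀ y, y₀ ≤ y → |jost A s k y| ≤ C * Real.exp (-(k * y)) ∧
      |jost' A s k y| ≤ C * Real.exp (-(k * y)) := by
  obtain ⟨M, hM⟩ := exists_coeffBound_hyperCoeff hA
  have h0 := hM (k / s) (by positivity)
  have hle : ∀ y, y₀ ≤ y → |zvar s y| ≤ |zvar s y₀| := fun y hy => by
    rw [abs_of_pos (zvar_pos _ _), abs_of_pos (zvar_pos _ _)]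
    exact zvar_anti hs.le hy
  obtain ⟨C₀, hC₀⟩ : ∃ C₀, ∀ y, y₀ ≤ y → |powerSum (hyperCoeff A (k / s)) (zvar s y)| ≤ C₀ :=
    ⟨_, fun y hy => h0.abs_powerSum_le (abs_zvar_lt_one s y₀) (hle y hy)⟩
  obtain ⟨C₁, hC₁⟩ : ∃ C₁, ∀ y, y₀ ≤ y →
      |powerSum (derivCoeff (hyperCoeff A (k / s))) (zvar s y)| ≤ C₁ :=
    ⟨_, fun y hy => h0.derivCoeff.abs_powerSum_le (abs_zvar_lt_one s y₀) (hle y hy)⟩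
  have hC₀0 : 0 ≤ C₀ := (abs_nonneg _).trans (hC₀ y₀ le_rfl)
  have hC₁0 : 0 ≤ C₁ := (abs_nonneg _).trans (hC₁ y₀ le_rfl)
  refine ⟨C₀ + k * C₀ + 2 * s * C₁, fun y hy => ⟨?_, ?_⟩⟩
  · rw [jost, abs_mul, Real.abs_exp, mul_comm]
    gcongr
    have h1 := hC₀ y hy
    nlinarith [mul_nonneg hk hC₀0, mul_nonneg hs.le hC₁0]
  · rw [jost', abs_mul, Real.abs_exp, mul_comm]
    gcongr
    have h1 := hC₀ y hy
    have h2 := hC₁ y hy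
    have hz0 := zvar_pos s y
    have hz1 := zvar_lt_one s y
    refine (abs_sub _ _).trans ?_
    rw [abs_mul, abs_mul (2 * s * zvar s y * (1 - zvar s y)), abs_neg, abs_of_nonneg hk,
      abs_of_nonneg (mul_nonneg (by positivity) (by linarith) :
        0 ≤ 2 * s * zvar s y * (1 - zvar s y))]
    have h3 : 2 * s * zvar s y * (1 - zvar s y) ≤ 2 * s := by
      nlinarith [mul_pos hs hz0, mul_nonneg (mul_pos hs hz0).le hz0.le]
    have h4 : 2 * s * zvar s y * (1 - zvar s y) *
        |powerSum (derivCoeff (hyperCoeff A (k / s))) (zvar s y)| ≤ 2 * s * C₁ := by gcongr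
    have h5 := mul_le_mul_of_nonneg_left h1 hk
    linarith

/-- The series equals `1` at `z = 0`, the point that corresponds to `y = +∞`. This normalisation
fixes the sign of the solution at every energy. -/
lemma jost_eventually_pos {A s k : ℝ} (hA : 0 ≤ A) (hs : 0 < s) (hk : 0 ≤ k) :
    ∀ᶠ y in atTop, 0 < jost A s k y := by
  obtain ⟨M, hM⟩ := exists_coeffBound_hyperCoeff hA
  have h0 := hM (k / s) (by positivity)
  have h1 : Tendsto (powerSum (hyperCoeff A (k / s))) (𝓝 0)
      (𝓝 (powerSum (hyperCoeff A (k / s)) 0)) :=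
    (h0.hasDerivAt (z := 0) (by simp)).continuousAt.tendsto
  have h2 : powerSum (hyperCoeff A (k / s)) 0 = 1 := by
    rw [powerSum, tsum_eq_single 0 (fun n hn => by simp [hn])]
    simp [hyperCoeff]
  rw [h2] at h1
  filter_upwards [(h1.comp (tendsto_zvar hs)).eventually (lt_mem_nhds one_pos)] with y hy
  exact mul_pos (Real.exp_pos _) hy

lemma tendsto_jost {A s k : ℝ} (hA : 0 ≤ A) (hs : 0 < s) (hk : 0 < k) :
    Tendsto (jost A s k) atTop (𝓝 0) ∧ Tendsto (jost' A s k) atTop (𝓝 0) := by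
  obtain ⟨C, hC⟩ := exists_jost_bound hA hs hk.le 0
  have h1 : Tendsto (fun y => C * Real.exp (-(k * y))) atTop (𝓝 0) := by
    have h2 : Tendsto (fun y : ℝ => Real.exp (-(k * y))) atTop (𝓝 0) :=
      Real.tendsto_exp_neg_atTop_nhds_zero.comp (tendsto_id.const_mul_atTop hk)
    simpa using h2.const_mul C
  exact ⟨squeeze_zero_norm' (by filter_upwards [eventually_ge_atTop 0] with y hy using (hC y hy).1) h1,
    squeeze_zero_norm' (by filter_upwards [eventually_ge_atTop 0] with y hy using (hC y hy).2) h1⟩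

lemma continuousOn_powerSum_param {a : ℝ → ℕ → ℝ} {M : ℝ} {m : ℕ} {t : Set ℝ} {z : ℝ}
    (hz : |z| < 1) (ha : ∀ n, ContinuousOn (fun κ => a κ n) t)
    (hb : ∀ κ ∈ t, CoeffBound M m (a κ)) : ContinuousOn (fun κ => powerSum (a κ) z) t :=
  continuousOn_tsum (fun n => (ha n).mul continuousOn_const) (summable_choose_bound M m hz)
    fun n κ hκ => (hb κ hκ).norm_le le_rfl n

/-- Uniform convergence of the series in the parameter, by the `κ`-independent coefficient bound. -/
lemma continuousOn_jost {A s : ℝ} (hA : 0 ≤ A) (hs : 0 < s) (y : ℝ) :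
    ContinuousOn (fun k => jost A s k y) (Ici 0) ∧
      ContinuousOn (fun k => jost' A s k y) (Ici 0) := by
  obtain ⟨M, hM⟩ := exists_coeffBound_hyperCoeff hA
  have hd : MapsTo (fun k => k / s) (Ici 0) (Ici 0) := fun k hk => div_nonneg hk hs.le
  have h0 : ContinuousOn (fun k => powerSum (hyperCoeff A (k / s)) (zvar s y)) (Ici 0) :=
    (continuousOn_powerSum_param (abs_zvar_lt_one s y) (continuousOn_hyperCoeff A)
      hM).comp (by fun_prop) hd
  have h1 : ContinuousOn (fun k => powerSum (derivCoeff (hyperCoeff A (k / s))) (zvar s y))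
      (Ici 0) :=
    (continuousOn_powerSum_param (a := fun κ => derivCoeff (hyperCoeff A κ))
      (abs_zvar_lt_one s y) (fun n => continuousOn_const.mul (continuousOn_hyperCoeff A (n + 1)))
      fun κ hκ => (hM κ hκ).derivCoeff).comp (by fun_prop) hd
  have he : ContinuousOn (fun k => Real.exp (-(k * y))) (Ici 0) := by fun_prop
  exact ⟨he.mul h0, he.mul ((continuousOn_id.neg.mul h0).sub (continuousOn_const.mul h1))⟩

/-! ### Decaying solutions of the `L₊` equation on the line. -/

lemma integral_normSq_pos {F : ℝ → ℂ} (hc : ContinuousOn F (Ici 0)) (hm : MemLp F 2 halfLine)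
    {x : ℝ} (hx : 0 ≤ x) (hF : F x ≠ 0) : 0 < ∫ t in Ioi (0 : ℝ), Complex.normSq (F t) := by
  have hi : Integrable (fun t => Complex.normSq (F t)) halfLine := by
    refine (Complex.reCLM.integrable_comp (integrable_conj_mul hm hm)).congr
      (Eventually.of_forall fun t => ?_)
    simp only [Complex.reCLM_apply]
    rw [← Complex.normSq_eq_conj_mul_self, Complex.ofReal_re]
  refine lt_of_le_of_ne (integral_nonneg fun t => Complex.normSq_nonneg _) fun h => hF ?_
  have h1 := (integral_eq_zero_iff_of_nonneg (fun t => Complex.normSq_nonneg _) hi).1 h.symm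
  have h2 : F =ᵐ[volume.restrict (Ici (0 : ℝ))] fun _ => 0 := by
    rw [Measure.restrict_congr_set Ioi_ae_eq_Ici.symm]
    exact h1.mono fun t ht => Complex.normSq_eq_zero.1 ht
  exact Measure.eqOn_of_ae_eq h2 hc continuousOn_const (by simp) hx

/-- The coupling constant of `L₊`. -/
abbrev kappa (p : ℝ) : ℝ := (2 * p + 1) * (p + 1)

/-- The decaying solution of `-u'' + (r² - (2p+1)(p+1) r² sech²(p r y)) u = l u`. -/
def decaying (p r l y : ℝ) : ℝ := jost (kappa p / p ^ 2) (p * r) (√(r ^ 2 - l)) y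

/-- The derivative of `decaying`. -/
def decaying' (p r l y : ℝ) : ℝ := jost' (kappa p / p ^ 2) (p * r) (√(r ^ 2 - l)) y

lemma hasDerivAt_decaying {p r : ℝ} (hp : 0 < p) (hr : 0 < r) (l y : ℝ) :
    HasDerivAt (decaying p r l) (decaying' p r l y) y :=
  hasDerivAt_jost (by unfold kappa; positivity) (by positivity) (Real.sqrt_nonneg _) y

lemma hasDerivAt_decaying' {p r l : ℝ} (hp : 0 < p) (hr : 0 < r) (hl : l ≤ 0) (y : ℝ) :
    HasDerivAt (decaying' p r l) ((well (kappa p) p r y - l) * decaying p r l y) y := by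
  refine (hasDerivAt_jost' (by unfold kappa; positivity) (by positivity)
    (Real.sqrt_nonneg _) y).congr_deriv ?_
  rw [Real.sq_sqrt (by nlinarith), well, decaying]
  field_simp
  ring

lemma exists_decaying_bound {p r l : ℝ} (hp : 0 < p) (hr : 0 < r) (y₀ : ℝ) :
    ∃ C, ∀ y, y₀ ≤ y → |decaying p r l y| ≤ C * Real.exp (-(√(r ^ 2 - l) * y)) ∧
      |decaying' p r l y| ≤ C * Real.exp (-(√(r ^ 2 - l) * y)) :=
  exists_jost_bound (by unfold kappa; positivity) (by positivity) (Real.sqrt_nonneg _) y₀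

lemma decaying_eventually_pos {p r : ℝ} (hp : 0 < p) (hr : 0 < r) (l : ℝ) :
    ∀ᶠ y in atTop, 0 < decaying p r l y :=
  jost_eventually_pos (by unfold kappa; positivity) (by positivity) (Real.sqrt_nonneg _)

lemma sqrt_pos_of_nonpos {r l : ℝ} (hr : 0 < r) (hl : l ≤ 0) : 0 < √(r ^ 2 - l) :=
  Real.sqrt_pos.2 (by nlinarith)

lemma tendsto_decaying {p r l : ℝ} (hp : 0 < p) (hr : 0 < r) (hl : l ≤ 0) :
    Tendsto (decaying p r l) atTop (𝓝 0) ∧ Tendsto (decaying' p r l) atTop (𝓝 0) :=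
  tendsto_jost (by unfold kappa; positivity) (by positivity) (sqrt_pos_of_nonpos hr hl)

lemma continuous_decaying_param {p r : ℝ} (hp : 0 < p) (hr : 0 < r) (y : ℝ) :
    Continuous (fun l => decaying p r l y) ∧ Continuous (fun l => decaying' p r l y) := by
  obtain ⟨h1, h2⟩ := continuousOn_jost (A := kappa p / p ^ 2) (s := p * r)
    (by unfold kappa; positivity) (by positivity) y
  have hs : Continuous fun l : ℝ => √(r ^ 2 - l) := by fun_prop
  exact ⟨h1.comp_continuous hs fun l => Real.sqrt_nonneg _,
    h2.comp_continuous hs fun l => Real.sqrt_nonneg _⟩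

lemma continuous_decaying {p r : ℝ} (hp : 0 < p) (hr : 0 < r) (l : ℝ) :
    Continuous (decaying p r l) :=
  continuous_iff_continuousAt.2 fun y => (hasDerivAt_decaying hp hr l y).continuousAt

lemma continuous_decaying' {p r l : ℝ} (hp : 0 < p) (hr : 0 < r) (hl : l ≤ 0) :
    Continuous (decaying' p r l) :=
  continuous_iff_continuousAt.2 fun y => (hasDerivAt_decaying' hp hr hl y).continuousAt

lemma memLp_of_exp_bound {f : ℝ → ℝ} (hf : Continuous f) {C k : ℝ} (hk : 0 < k)
    (h : ∀ x, 0 ≤ x → |f x| ≤ C * Real.exp (-(k * x))) :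
    MemLp (fun x => (f x : ℂ)) 2 halfLine := by
  have h1 : MemLp (fun x : ℝ => Real.exp (-(k * x))) 2 halfLine := by
    rw [memLp_two_iff_integrable_sq (by fun_prop)]
    have := integrableOn_exp_mul_Ioi (a := -(2 * k)) (by linarith) 0
    refine this.congr_fun (fun x _ => ?_) measurableSet_Ioi
    simp only
    rw [← Real.exp_nat_mul]
    push_cast
    ring_nf
  refine h1.of_le_mul (c := C) (Complex.continuous_ofReal.comp hf).aestronglyMeasurable ?_
  filter_upwards [ae_restrict_mem measurableSet_Ioi] with x hx
  rw [Complex.norm_real, Real.norm_eq_abs, Real.norm_eq_abs, Real.abs_exp]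
  exact h x (le_of_lt hx)

/-- The decaying solution, shifted, as a solution on the half-line. -/
lemma solvesEdge_decaying {p r l : ℝ} (hp : 0 < p) (hr : 0 < r) (hl : l ≤ 0) (a l₀ : ℝ) :
    SolvesEdge (fun x => well (kappa p) p r (x + a) - l₀) (fun x => (decaying p r l (x + a) : ℂ))
      (fun x => (decaying' p r l (x + a) : ℂ))
      (fun x => ((l - l₀ : ℝ) : ℂ) * (decaying p r l (x + a) : ℂ)) := by
  have hc : Continuous fun x => decaying p r l (x + a) :=
    (continuous_decaying hp hr l).comp (by fun_prop)
  have hc' : Continuous fun x => decaying' p r l (x + a) :=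
    (continuous_decaying' hp hr hl).comp (by fun_prop)
  have hk := sqrt_pos_of_nonpos hr hl
  obtain ⟨C, hC⟩ := exists_decaying_bound (l := l) hp hr a
  have hC0 : 0 ≤ C := by
    have := (abs_nonneg _).trans (hC a le_rfl).1
    exact nonneg_of_mul_nonneg_left this (Real.exp_pos _)
  have he : ∀ x, C * Real.exp (-(√(r ^ 2 - l) * (x + a))) =
      C * Real.exp (-(√(r ^ 2 - l) * a)) * Real.exp (-(√(r ^ 2 - l) * x)) := by
    intro x
    rw [mul_assoc, ← Real.exp_add]
    ring_nf
  have hm : MemLp (fun x => (decaying p r l (x + a) : ℂ)) 2 halfLine :=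
    memLp_of_exp_bound hc hk fun x hx => by
      rw [← he]; exact (hC (x + a) (by linarith)).1
  have hm' : MemLp (fun x => (decaying' p r l (x + a) : ℂ)) 2 halfLine :=
    memLp_of_exp_bound hc' hk fun x hx => by
      rw [← he]; exact (hC (x + a) (by linarith)).2
  refine ⟨(Complex.continuous_ofReal.comp hc).continuousOn,
    (Complex.continuous_ofReal.comp hc').continuousOn,
    (continuous_const.mul (Complex.continuous_ofReal.comp hc)).continuousOn, hm, hm',
    hm.const_mul _, fun x _ => ?_, fun x _ => ?_⟩
  · exact ((hasDerivAt_decaying hp hr l (x + a)).comp_add_const x a).ofReal_comp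
  · refine ((hasDerivAt_decaying' hp hr hl (x + a)).comp_add_const x a).ofReal_comp.congr_deriv ?_
    push_cast
    ring

/-- Zero initial data at `a` would make the solution vanish on `[a, ∞)`, although it is positive
near infinity. -/
lemma decaying_zero_data {p r l : ℝ} (hp : 0 < p) (hr : 0 < r) (hl : l ≤ 0) (a : ℝ) :
    decaying p r l a ≠ 0 ∨ decaying' p r l a ≠ 0 := by
  by_contra h
  push Not at h
  have hs := solvesEdge_decaying hp hr hl a l
  have hz := eq_zero_of_initial (q := fun x => well (kappa p) p r (x + a) - l)
    (C := (r ^ 2 + |kappa p| * r ^ 2) + |l|)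
    (fun x => (abs_sub _ _).trans (by gcongr; exact abs_well_le _ _ _ _))
    hs.cont hs.cont' hs.deriv (fun x hx => by simpa using hs.deriv' x hx)
    (by simp [h.1]) (by simp [h.2])
  obtain ⟨y, hy, hy'⟩ := ((decaying_eventually_pos hp hr l).and (eventually_ge_atTop a)).exists
  have := (hz (y - a) (by linarith)).1
  simp only [sub_add_cancel, Complex.ofReal_eq_zero] at this
  linarith

/-- A decaying solution for `l < l₀` has no zero to the right of which a positive solution for
`l₀` exists. -/
lemma decaying_ne_zero_of_riccati {p r l l₀ : ℝ} (hp : 0 < p) (hr : 0 < r) (hl : l ≤ 0)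
    (hll : l < l₀) {a : ℝ} {g : ℝ → ℝ}
    (hg : ∀ y, a ≤ y → HasDerivAt g (well (kappa p) p r y - l₀ - g y ^ 2) y)
    (hgb : IsBoundedUnder (· ≤ ·) atTop fun y => |g (y + a)|) : decaying p r l a ≠ 0 := by
  intro h0
  have hs := solvesEdge_decaying hp hr hl a l₀
  -- A zero at `a` would kill the boundary term, and Picone's inequality would read `0 ≤ (l - l₀) ∫
  -- u²`, which is negative.
  have hA : Tendsto (piconeTerm (fun x => g (x + a)) (fun x => (decaying p r l (x + a) : ℂ))
      (fun x => (decaying' p r l (x + a) : ℂ))) (𝓝[>] 0) (𝓝 0) := by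
    have hcg : ContinuousAt (fun x => g (x + a)) 0 := by
      refine ContinuousAt.comp (g := g) (f := fun x => x + a) ?_ (by fun_prop)
      simpa using (hg a le_rfl).continuousAt
    have hc1 : Continuous fun x => (decaying p r l (x + a) : ℂ) :=
      Complex.continuous_ofReal.comp ((continuous_decaying hp hr l).comp (by fun_prop))
    have hc2 : Continuous fun x => (decaying' p r l (x + a) : ℂ) :=
      Complex.continuous_ofReal.comp ((continuous_decaying' hp hr hl).comp (by fun_prop))
    have hc : ContinuousAt (piconeTerm (fun x => g (x + a))
        (fun x => (decaying p r l (x + a) : ℂ)) (fun x => (decaying' p r l (x + a) : ℂ))) 0 :=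
      (Complex.continuous_re.comp
        ((Complex.continuous_conj.comp hc1).mul hc2)).continuousAt.sub
        (hcg.mul (Complex.continuous_normSq.comp hc1).continuousAt)
    have := hc.tendsto
    simp only [piconeTerm, zero_add, h0, Complex.ofReal_zero, map_zero, zero_mul, mul_zero,
      Complex.zero_re, sub_zero] at this
    exact this.mono_left nhdsWithin_le_nhds
  have hP := hs.picone_Ioi (C := (r ^ 2 + |kappa p| * r ^ 2) + |l₀|)
    (fun x => (abs_sub _ _).trans (by gcongr; exact abs_well_le _ _ _ _))
    (((continuous_well _ _ _).comp (by fun_prop)).sub continuous_const) le_rfl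
    (g := fun x => g (x + a))
    (fun t ht => (hg (t + a) (by linarith)).comp_add_const t a) hgb hA
  obtain ⟨y, hy, hy'⟩ := ((decaying_eventually_pos hp hr l).and (eventually_ge_atTop a)).exists
  have hpos := integral_normSq_pos hs.cont hs.mem (x := y - a) (by linarith) (by
    simp only [sub_add_cancel, ne_eq, Complex.ofReal_eq_zero]; linarith)
  have he : ∫ t in Ioi (0 : ℝ), (conj (decaying p r l (t + a) : ℂ) *
      (((l - l₀ : ℝ) : ℂ) * (decaying p r l (t + a) : ℂ))).re =
      (l - l₀) * ∫ t in Ioi (0 : ℝ), Complex.normSq (decaying p r l (t + a) : ℂ) := by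
    rw [← integral_const_mul]
    congr 1
    ext t
    simp only [Complex.conj_ofReal, ← Complex.ofReal_mul, Complex.ofReal_re, Complex.normSq_ofReal]
    ring
  rw [he] at hP
  nlinarith

/-- Two decaying solutions of `u'' = q u` on the line are proportional. -/
lemma exists_eq_const_mul {q u u' v v' : ℝ → ℝ} {C : ℝ} (hq : ∀ y, |q y| ≤ C)
    (hu : ∀ y, HasDerivAt u (u' y) y) (hu' : ∀ y, HasDerivAt u' (q y * u y) y)
    (hv : ∀ y, HasDerivAt v (v' y) y) (hv' : ∀ y, HasDerivAt v' (q y * v y) y)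
    (tu : Tendsto u atTop (𝓝 0)) (tu' : Tendsto u' atTop (𝓝 0))
    (tv : Tendsto v atTop (𝓝 0)) (tv' : Tendsto v' atTop (𝓝 0))
    (h0 : v 0 ^ 2 + v' 0 ^ 2 ≠ 0) : ∃ c, ∀ y, u y = c * v y ∧ u' y = c * v' y := by
  have hW : ∀ y, HasDerivAt (fun y => u y * v' y - u' y * v y) 0 y := fun y => by
    refine (((hu y).mul (hv' y)).sub ((hu' y).mul (hv y))).congr_deriv ?_
    ring
  -- The Wronskian is constant and tends to zero, hence vanishes; `c` is then the coefficient of the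
  -- orthogonal projection of the data of `u` at `0` onto those of `v`.
  have hconst : ∀ y, u y * v' y - u' y * v y = u 0 * v' 0 - u' 0 * v 0 := fun y =>
    is_const_of_deriv_eq_zero (fun y => (hW y).differentiableAt) (fun y => (hW y).deriv) y 0
  have hlim : Tendsto (fun y => u y * v' y - u' y * v y) atTop (𝓝 0) := by
    simpa using (tu.mul tv').sub (tu'.mul tv)
  have hW0 : u 0 * v' 0 - u' 0 * v 0 = 0 := by
    simp only [hconst] at hlim
    exact tendsto_nhds_unique tendsto_const_nhds hlim
  set c := (u 0 * v 0 + u' 0 * v' 0) / (v 0 ^ 2 + v' 0 ^ 2) with hc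
  have e1 : u 0 - c * v 0 = 0 := by
    rw [hc]; field_simp
    linear_combination v' 0 * hW0
  have e2 : u' 0 - c * v' 0 = 0 := by
    rw [hc]; field_simp
    linear_combination -v 0 * hW0
  have d1 : ∀ y, HasDerivAt (fun y => u y - c * v y) (u' y - c * v' y) y := fun y =>
    (hu y).sub ((hv y).const_mul c)
  have d2 : ∀ y, HasDerivAt (fun y => u' y - c * v' y) (q y * (u y - c * v y)) y := fun y =>
    ((hu' y).sub ((hv' y).const_mul c)).congr_deriv (by ring)
  have c1 : Continuous fun y => u y - c * v y :=
    continuous_iff_continuousAt.2 fun y => (d1 y).continuousAt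
  have c2 : Continuous fun y => u' y - c * v' y :=
    continuous_iff_continuousAt.2 fun y => (d2 y).continuousAt
  refine ⟨c, fun y => ?_⟩
  rcases le_total 0 y with hy | hy
  · have := eq_zero_of_initial hq (F := fun y => ((u y - c * v y : ℝ) : ℂ))
      (F' := fun y => ((u' y - c * v' y : ℝ) : ℂ))
      (Complex.continuous_ofReal.comp c1).continuousOn
      (Complex.continuous_ofReal.comp c2).continuousOn (fun x _ => (d1 x).ofReal_comp)
      (fun x _ => (d2 x).ofReal_comp.congr_deriv (by push_cast; ring))
      (by simp only [e1, Complex.ofReal_zero]) (by simp only [e2, Complex.ofReal_zero]) y hy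
    simp only [Complex.ofReal_eq_zero] at this
    exact ⟨by linarith [this.1], by linarith [this.2]⟩
  -- Negative arguments are treated by reflection, since uniqueness was proved on `[0, ∞)`.
  · have d3 : ∀ x, HasDerivAt (fun y => u (-y) - c * v (-y)) (-(u' (-x) - c * v' (-x))) x :=
      fun x => ((d1 (-x)).comp x (hasDerivAt_neg x)).congr_deriv (by ring)
    have d4 : ∀ x, HasDerivAt (fun y => -(u' (-y) - c * v' (-y)))
        (q (-x) * (u (-x) - c * v (-x))) x :=
      fun x => ((d2 (-x)).comp x (hasDerivAt_neg x)).neg.congr_deriv (by ring)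
    have := eq_zero_of_initial (q := fun x => q (-x)) (fun x => hq (-x))
      (F := fun y => ((u (-y) - c * v (-y) : ℝ) : ℂ))
      (F' := fun y => ((-(u' (-y) - c * v' (-y)) : ℝ) : ℂ))
      (Complex.continuous_ofReal.comp (c1.comp continuous_neg)).continuousOn
      (Complex.continuous_ofReal.comp (c2.comp continuous_neg).neg).continuousOn
      (fun x _ => (d3 x).ofReal_comp)
      (fun x _ => (d4 x).ofReal_comp.congr_deriv (by push_cast; ring))
      (by simp only [neg_zero, e1, Complex.ofReal_zero])
      (by simp only [neg_zero, e2, Complex.ofReal_zero]) (-y) (by linarith)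
    simp only [Complex.ofReal_eq_zero, neg_neg] at this
    exact ⟨by linarith [this.1], by linarith [this.2]⟩

/-! ### Explicit decaying solutions at the ground energy and at zero energy. -/

/-- The function `sech^β (s y)`. -/
def sechPow (β s y : ℝ) : ℝ := Real.cosh (s * y) ^ (-β)

lemma sechPow_pos (β s y : ℝ) : 0 < sechPow β s y :=
  Real.rpow_pos_of_pos (Real.cosh_pos _) _

lemma sechPow_neg_arg (β s y : ℝ) : sechPow β s (-y) = sechPow β s y := by
  simp [sechPow]

lemma hasDerivAt_sechPow (β s y : ℝ) :
    HasDerivAt (sechPow β s) (-(β * s) * Real.tanh (s * y) * sechPow β s y) y := by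
  have hc := Real.cosh_pos (s * y)
  have h1 : HasDerivAt (fun y => Real.cosh (s * y)) (Real.sinh (s * y) * (s * 1)) y :=
    (Real.hasDerivAt_cosh (s * y)).comp y ((hasDerivAt_id y).const_mul s)
  refine (h1.rpow_const (p := -β) (Or.inl hc.ne')).congr_deriv ?_
  rw [Real.tanh_eq_sinh_div_cosh, sechPow, Real.rpow_sub_one hc.ne']
  field_simp

lemma tendsto_sechPow {β s : ℝ} (hβ : 0 < β) (hs : 0 < s) :
    Tendsto (sechPow β s) atTop (𝓝 0) := by
  refine (tendsto_rpow_neg_atTop hβ).comp (tendsto_atTop_mono (fun y => ?_)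
    (tendsto_id.const_mul_atTop hs))
  simp only [id]
  have h1 : s * y ≤ Real.sinh |s * y| + 0 := by
    have := Real.self_le_sinh_iff.2 (abs_nonneg (s * y))
    linarith [le_abs_self (s * y)]
  have h2 := (Real.sinh_lt_cosh |s * y|).le
  rw [Real.cosh_abs] at h2
  linarith

lemma tendsto_mul_zero_of_abs_le {f g : ℝ → ℝ} {C : ℝ} (hf : ∀ y, |f y| ≤ C)
    (hg : Tendsto g atTop (𝓝 0)) : Tendsto (fun y => f y * g y) atTop (𝓝 0) :=
  bdd_le_mul_tendsto_zero' C (Eventually.of_forall hf) hg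

/-- The lowest eigenvalue of `L₊` on the line. -/
def groundEnergy (p r : ℝ) : ℝ := r ^ 2 * (1 - (p + 1) ^ 2)

lemma groundEnergy_neg {p r : ℝ} (hp : 0 < p) (hr : 0 < r) : groundEnergy p r < 0 :=
  mul_neg_of_pos_of_neg (by positivity) (by nlinarith)

/-- The function `φ^{p+1}` is a decaying eigenfunction at this energy, and decaying solutions are
proportional. -/
lemma decaying_groundEnergy {p r : ℝ} (hp : 0 < p) (hr : 0 < r) : ∃ c > 0, ∀ y,
    decaying p r (groundEnergy p r) y = c * sechPow (1 + 1 / p) (p * r) y ∧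
    decaying' p r (groundEnergy p r) y =
      -((p + 1) * r) * Real.tanh (p * r * y) * (c * sechPow (1 + 1 / p) (p * r) y) := by
  have hl := (groundEnergy_neg hp hr).le
  obtain ⟨tu, tu'⟩ := tendsto_decaying hp hr hl
  have e : (1 + 1 / p) * (p * r) = (p + 1) * r := by field_simp
  have hd := fun y => hasDerivAt_sechPow (1 + 1 / p) (p * r) y
  rw [e] at hd
  have hβ : 0 < 1 + 1 / p := by positivity
  have hlim := tendsto_sechPow hβ (mul_pos hp hr)
  obtain ⟨c, hc⟩ := exists_eq_const_mul (q := fun y => well (kappa p) p r y - groundEnergy p r)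
    (C := (r ^ 2 + |kappa p| * r ^ 2) + |groundEnergy p r|)
    (fun x => (abs_sub _ _).trans (by gcongr; exact abs_well_le _ _ _ _))
    (fun y => hasDerivAt_decaying hp hr _ y) (fun y => hasDerivAt_decaying' hp hr hl y)
    hd (fun y => (((hasDerivAt_tanh_mul (p * r) y).const_mul (-((p + 1) * r))).mul (hd y)).congr_deriv
      (by simp only [well, groundEnergy]; ring)) tu tu' hlim
    (tendsto_mul_zero_of_abs_le (C := |-((p + 1) * r)| * 1) (fun y => by
      rw [abs_mul]; gcongr; exact (Real.abs_tanh_lt_one _).le) hlim)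
    (by simp [sechPow])
  refine ⟨c, ?_, fun y => ⟨(hc y).1, by rw [(hc y).2]; ring⟩⟩
  obtain ⟨y, hy⟩ := (decaying_eventually_pos hp hr (groundEnergy p r)).exists
  rw [(hc y).1] at hy
  exact pos_of_mul_pos_left hy (sechPow_pos _ _ _).le

/-- At energy zero the decaying solution is a positive multiple of `-φ'`; the sign comes from
positivity near `+∞`. -/
lemma decaying_zero {p r : ℝ} (hp : 0 < p) (hr : 0 < r) : ∃ c > 0, ∀ y,
    decaying p r 0 y = c * sechPow (1 / p) (p * r) y * Real.tanh (p * r * y) ∧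
    decaying' p r 0 y = c * sechPow (1 / p) (p * r) y *
      (p * r - (p + 1) * r * Real.tanh (p * r * y) ^ 2) := by
  obtain ⟨tu, tu'⟩ := tendsto_decaying hp hr le_rfl
  have e : (1 / p) * (p * r) = r := by field_simp
  have hd := fun y => hasDerivAt_sechPow (1 / p) (p * r) y
  rw [e] at hd
  have hβ : 0 < 1 / p := by positivity
  have hlim := tendsto_sechPow hβ (mul_pos hp hr)
  have ht := fun y => hasDerivAt_tanh_mul (p * r) y
  have hp2 := fun y => (((ht y).pow 2).const_mul ((p + 1) * r)).const_sub (p * r)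
  obtain ⟨c, hc⟩ := exists_eq_const_mul (q := fun y => well (kappa p) p r y - 0)
    (v := fun y => Real.tanh (p * r * y) * sechPow (1 / p) (p * r) y)
    (v' := fun y => (p * r - (p + 1) * r * Real.tanh (p * r * y) ^ 2) *
      sechPow (1 / p) (p * r) y)
    (C := (r ^ 2 + |kappa p| * r ^ 2))
    (fun x => by rw [sub_zero]; exact abs_well_le _ _ _ _)
    (fun y => hasDerivAt_decaying hp hr _ y) (fun y => hasDerivAt_decaying' hp hr le_rfl y)
    (fun y => ((ht y).mul (hd y)).congr_deriv (by ring))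
    (fun y => ((hp2 y).mul (hd y)).congr_deriv (by simp [well, kappa]; ring)) tu tu'
    (tendsto_mul_zero_of_abs_le (C := 1) (fun y => (Real.abs_tanh_lt_one _).le) hlim)
    (tendsto_mul_zero_of_abs_le (C := |p * r| + |(p + 1) * r| * 1) (fun y => by
      refine (abs_sub _ _).trans ?_
      rw [abs_mul ((p + 1) * r)]
      gcongr
      rw [abs_of_nonneg (sq_nonneg _)]
      exact (tanh_sq_lt_one _).le) hlim)
    (by simp [sechPow, hp.ne', hr.ne'])
  refine ⟨c, ?_, fun y => ⟨by rw [(hc y).1]; ring, by rw [(hc y).2]; ring⟩⟩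
  obtain ⟨y, hy, hy'⟩ := ((decaying_eventually_pos hp hr 0).and (eventually_gt_atTop 0)).exists
  rw [(hc y).1] at hy
  exact pos_of_mul_pos_left hy (mul_pos (tanh_pos (by positivity)) (sechPow_pos _ _ _)).le

/-! ### Zeros and signs of the decaying solutions. -/

/-- Sturm comparison with `φ'`, which has no zero to the right of the top. -/
lemma decaying_ne_zero_of_pos {p r l y : ℝ} (hp : 0 < p) (hr : 0 < r) (hl : l ≤ 0) (hy : 0 < y) :
    decaying p r l y ≠ 0 := by
  rcases hl.lt_or_eq with h | rfl
  · exact decaying_ne_zero_of_riccati hp hr hl h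
      (fun z hz => by
        rw [sub_zero]
        exact hasDerivAt_logDerivSoliton' hp hr (hy.trans_le hz).ne')
      (isBoundedUnder_logDerivSoliton' hp hr y)
  · obtain ⟨c, hc, h⟩ := decaying_zero hp hr
    rw [(h y).1]
    exact (mul_pos (mul_pos hc (sechPow_pos _ _ _)) (tanh_pos (by positivity))).ne'

/-- Sturm comparison with the ground state, which has no zero at all. -/
lemma decaying_ne_zero_of_lt {p r l : ℝ} (hp : 0 < p) (hr : 0 < r) (hl : l < groundEnergy p r)
    (y : ℝ) : decaying p r l y ≠ 0 := by
  refine decaying_ne_zero_of_riccati (l₀ := groundEnergy p r)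
    (g := fun y => -((p + 1) * r) * Real.tanh (p * r * y)) hp hr
    (hl.le.trans (groundEnergy_neg hp hr).le) hl (fun z _ => ?_) ?_
  · refine ((hasDerivAt_tanh_mul (p * r) z).const_mul (-((p + 1) * r))).congr_deriv ?_
    simp only [well, groundEnergy]
    ring
  · refine isBoundedUnder_of ⟨|-((p + 1) * r)| * 1, fun z => ?_⟩
    rw [abs_mul]
    gcongr
    exact (Real.abs_tanh_lt_one _).le

lemma pos_of_forall_ne_zero {f : ℝ → ℝ} (hf : Continuous f) (hpos : ∀ᶠ y in atTop, 0 < f y)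
    {a : ℝ} (h : ∀ y, a ≤ y → f y ≠ 0) : 0 < f a := by
  by_contra hneg
  obtain ⟨y, hy, hy'⟩ := (hpos.and (eventually_ge_atTop a)).exists
  obtain ⟨z, hz, hz'⟩ := intermediate_value_Icc hy' hf.continuousOn ⟨not_lt.1 hneg, hy.le⟩
  exact h z hz.1 hz'

lemma decaying_pos {p r l y : ℝ} (hp : 0 < p) (hr : 0 < r) (hl : l ≤ 0) (hy : 0 < y) :
    0 < decaying p r l y :=
  pos_of_forall_ne_zero (continuous_decaying hp hr l) (decaying_eventually_pos hp hr l)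
    fun _ hz => decaying_ne_zero_of_pos hp hr hl (hy.trans_le hz)

lemma decaying_pos_of_lt {p r l : ℝ} (hp : 0 < p) (hr : 0 < r) (hl : l < groundEnergy p r)
    (y : ℝ) : 0 < decaying p r l y :=
  pos_of_forall_ne_zero (continuous_decaying hp hr l) (decaying_eventually_pos hp hr l)
    fun z _ => decaying_ne_zero_of_lt hp hr hl z

/-- For very negative energies the decaying solution is decreasing. -/
lemma exists_decaying'_nonpos {p r : ℝ} (hp : 0 < p) (hr : 0 < r) :
    ∃ l < groundEnergy p r, ∀ y, decaying' p r l y ≤ 0 := by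
  -- The first entry makes the solution positive, the second makes `well - l ≥ 0`. The solution is
  -- then convex, and its increasing derivative tends to `0`.
  set l : ℝ := min (groundEnergy p r - 1) (-(r ^ 2 + |kappa p| * r ^ 2)) with hldef
  have hl1 : l < groundEnergy p r := (min_le_left _ _).trans_lt (by linarith)
  have hl2 : l ≤ -(r ^ 2 + |kappa p| * r ^ 2) := min_le_right _ _
  have hl := (hl1.trans (groundEnergy_neg hp hr)).le
  refine ⟨l, hl1, fun y => ?_⟩
  have hmono : Monotone (decaying' p r l) :=
    monotone_of_hasDerivAt_nonneg (fun y => hasDerivAt_decaying' hp hr hl y) fun y => by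
      have := (abs_le.1 (abs_well_le (kappa p) p r y)).1
      exact mul_nonneg (by linarith) (decaying_pos_of_lt hp hr hl1 y).le
  exact hmono.ge_of_tendsto (tendsto_decaying hp hr hl).2 y

/-- At a zero `-b < 0` of the decaying solution at negative energy, its derivative is positive. -/
lemma decaying'_pos_of_eq_zero {p r l b : ℝ} (hp : 0 < p) (hr : 0 < r) (hl : l < 0) (hb : 0 < b)
    (h0 : decaying p r l (-b) = 0) : 0 < decaying' p r l (-b) := by
  have hne : decaying' p r l (-b) ≠ 0 :=
    (decaying_zero_data hp hr hl.le (-b)).resolve_left (not_not.2 h0)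
  by_contra hneg
  have hneg' : decaying' p r l (-b) < 0 := lt_of_le_of_ne (not_lt.1 hneg) hne
  have hc := continuous_decaying hp hr l
  have hc' := continuous_decaying' hp hr hl.le
  have hU0 : 0 ≤ decaying p r l 0 := by
    have : Tendsto (decaying p r l) (𝓝[>] 0) (𝓝 (decaying p r l 0)) :=
      (hc.tendsto 0).mono_left nhdsWithin_le_nhds
    refine ge_of_tendsto this ?_
    filter_upwards [self_mem_nhdsWithin] with y hy using (decaying_pos hp hr hl.le hy).le
  -- A negative derivative forces negative values just after `-b`, hence a second zero `y₁ ≤ 0`.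
  -- Picone's inequality against `φ'`, which has no zero on `(-∞, 0)`, then gives `0 ≤ l ∫ u²`, a
  -- contradiction.
  obtain ⟨y₀, hy₀, hy₀b⟩ : ∃ y, decaying p r l y < 0 ∧ y ∈ Ioo (-b) 0 := by
    have h1 := (hasDerivAt_iff_tendsto_slope.1 (hasDerivAt_decaying hp hr l (-b)))
    have h2 : ∀ᶠ y in 𝓝[>] (-b), slope (decaying p r l) (-b) y < 0 :=
      (h1.mono_left (nhdsWithin_mono _ fun y hy => ne_of_gt hy)).eventually (gt_mem_nhds hneg')
    obtain ⟨y, hy, hy'⟩ := (h2.and (Ioo_mem_nhdsGT (neg_lt_zero.2 hb))).exists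
    refine ⟨y, ?_, hy'⟩
    rw [slope_def_field, h0, sub_zero] at hy
    exact neg_of_div_neg_left hy (by linarith [hy'.1])
  obtain ⟨y₁, hy₁, hy₁0⟩ := intermediate_value_Icc hy₀b.2.le hc.continuousOn ⟨hy₀.le, hU0⟩
  have hlt : y₀ < y₁ := lt_of_le_of_ne hy₁.1 (by rintro rfl; linarith)
  have hab : -b < y₁ := hy₀b.1.trans hlt
  set F : ℝ → ℂ := fun y => (decaying p r l y : ℂ) with hF
  set F' : ℝ → ℂ := fun y => (decaying' p r l y : ℂ) with hF'
  have hdF : ∀ y, HasDerivAt F (F' y) y := fun y => (hasDerivAt_decaying hp hr l y).ofReal_comp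
  have hdF' : ∀ y, HasDerivAt F' (well (kappa p) p r y * F y - l * F y) y := fun y =>
    (hasDerivAt_decaying' hp hr hl.le y).ofReal_comp.congr_deriv (by
      simp only [hF]; push_cast; ring)
  have hcF : Continuous F := Complex.continuous_ofReal.comp hc
  have hcF' : Continuous F' := Complex.continuous_ofReal.comp hc'
  have hzero : ∀ a, a ≤ 0 → F a = 0 → Tendsto (piconeTerm (logDerivSoliton' p r) F F')
      (𝓝[≠] a) (𝓝 0) := by
    intro a ha hFa
    rcases ha.lt_or_eq with h | rfl
    · refine tendsto_piconeTerm_zero (L := 0) (hdF a) hcF'.continuousAt hFa ?_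
      have h1 : ContinuousAt (fun x => logDerivSoliton' p r x * (x - a)) a :=
        (hasDerivAt_logDerivSoliton' hp hr h.ne).continuousAt.mul (by fun_prop)
      have h2 := h1.tendsto
      rw [sub_self, mul_zero] at h2
      exact h2.mono_left nhdsWithin_le_nhds
    · refine tendsto_piconeTerm_zero (L := 1) (hdF 0) hcF'.continuousAt hFa ?_
      simpa using tendsto_logDerivSoliton'_mul hp hr
  have hP := picone_Ioo (q := well (kappa p) p r) (g := logDerivSoliton' p r) (F := F) (F' := F')
    (W := fun y => l * F y) hab
    (fun t ht => hasDerivAt_logDerivSoliton' hp hr (ht.2.trans_le hy₁.2).ne)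
    (fun t _ => hdF t) (fun t _ => hdF' t) hcF.continuousOn
    (continuous_const.mul hcF).continuousOn
    ((hzero (-b) (by linarith) (by simp [hF, h0])).mono_left
      (nhdsWithin_mono _ fun y hy => ne_of_gt hy))
    ((hzero y₁ hy₁.2 (by simp [hF, hy₁0])).mono_left (nhdsWithin_mono _ fun y hy => ne_of_lt hy))
  have he : ∀ t, (conj (F t) * (l * F t)).re = l * decaying p r l t ^ 2 := by
    intro t
    simp only [hF, Complex.conj_ofReal, ← Complex.ofReal_mul, Complex.ofReal_re]
    ring
  simp only [he, intervalIntegral.integral_const_mul, sub_zero] at hP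
  have hpos : 0 < ∫ t in (-b)..y₁, decaying p r l t ^ 2 :=
    intervalIntegral.integral_pos hab (hc.pow 2).continuousOn (fun t _ => sq_nonneg _)
      ⟨y₀, ⟨hy₀b.1.le, hlt.le⟩, by nlinarith⟩
  nlinarith

/-! ### Signs and zeros of the characteristic function. -/

/-- The characteristic function whose zeros are the eigenvalues with nonzero vertex value, for `B`
edges carrying a bump at distance `b` and `T` edges carrying a tail. -/
def charFun (p r b α B T l : ℝ) : ℝ :=
  B * (decaying' p r l (-b) * decaying p r l b) + T * (decaying' p r l b * decaying p r l (-b))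
    - α * (decaying p r l (-b) * decaying p r l b)

lemma continuous_charFun {p r : ℝ} (hp : 0 < p) (hr : 0 < r) (b α B T : ℝ) :
    Continuous (charFun p r b α B T) := by
  have h1 := (continuous_decaying_param hp hr b).1
  have h2 := (continuous_decaying_param hp hr b).2
  have h3 := (continuous_decaying_param hp hr (-b)).1
  have h4 := (continuous_decaying_param hp hr (-b)).2
  unfold charFun
  fun_prop

lemma exists_zero_between {f : ℝ → ℝ} (hf : Continuous f) {x y : ℝ} (hxy : x < y)
    (h : f x * f y < 0) : ∃ z, x < z ∧ z < y ∧ f z = 0 := by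
  rcases mul_neg_iff.1 h with ⟨h1, h2⟩ | ⟨h1, h2⟩
  · obtain ⟨z, hz, hz0⟩ := intermediate_value_Ioo' hxy.le hf.continuousOn ⟨h2, h1⟩
    exact ⟨z, hz.1, hz.2, hz0⟩
  · obtain ⟨z, hz, hz0⟩ := intermediate_value_Ioo hxy.le hf.continuousOn ⟨h1, h2⟩
    exact ⟨z, hz.1, hz.2, hz0⟩

section

variable {p r b : ℝ}

/-- The value at `b` of the logarithmic derivative of the soliton's derivative. -/
lemma decaying_data_zero (hp : 0 < p) (hr : 0 < r) (hb : 0 < b) :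
    0 < decaying p r 0 b ∧ decaying p r 0 (-b) < 0 ∧
    decaying' p r 0 b = logDerivSoliton' p r b * decaying p r 0 b ∧
    decaying' p r 0 (-b) = -logDerivSoliton' p r b * decaying p r 0 (-b) := by
  obtain ⟨c, hc, h⟩ := decaying_zero hp hr
  have hτ : 0 < Real.tanh (p * r * b) := tanh_pos (by positivity)
  have hw := mul_pos hc (sechPow_pos (1 / p) (p * r) b)
  have e : Real.tanh (p * r * -b) = -Real.tanh (p * r * b) := by simp
  rw [(h b).1, (h b).2, (h (-b)).1, (h (-b)).2, sechPow_neg_arg, e, logDerivSoliton']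
  refine ⟨mul_pos hw hτ, by nlinarith [mul_pos hw hτ], ?_, ?_⟩ <;>
  · generalize Real.tanh (p * r * b) = τ at *
    field_simp

lemma decaying_data_groundEnergy (hp : 0 < p) (hr : 0 < r) :
    0 < decaying p r (groundEnergy p r) b ∧ 0 < decaying p r (groundEnergy p r) (-b) ∧
    decaying' p r (groundEnergy p r) b =
      -((p + 1) * r * Real.tanh (p * r * b)) * decaying p r (groundEnergy p r) b ∧
    decaying' p r (groundEnergy p r) (-b) =
      (p + 1) * r * Real.tanh (p * r * b) * decaying p r (groundEnergy p r) (-b) := by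
  obtain ⟨c, hc, h⟩ := decaying_groundEnergy hp hr
  have hw := mul_pos hc (sechPow_pos (1 + 1 / p) (p * r) b)
  have e : Real.tanh (p * r * -b) = -Real.tanh (p * r * b) := by simp
  rw [(h b).1, (h b).2, (h (-b)).1, (h (-b)).2, sechPow_neg_arg, e]
  refine ⟨hw, hw, by ring, by ring⟩

/-- The logarithmic derivatives of the ground state are `p + 1` times those of the soliton, so their
vertex sum is `(p + 1) α`. -/
lemma charFun_groundEnergy (hp : 0 < p) (hr : 0 < r) {α B T : ℝ}
    (hα : α = (B - T) * r * Real.tanh (p * r * b)) :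
    charFun p r b α B T (groundEnergy p r) = p * α *
      (decaying p r (groundEnergy p r) (-b) * decaying p r (groundEnergy p r) b) := by
  obtain ⟨-, -, h3, h4⟩ := decaying_data_groundEnergy (b := b) hp hr
  rw [charFun, h3, h4, hα]
  ring

lemma sub_logDerivSoliton' (hp : 0 < p) (hr : 0 < r) (hb : 0 < b) :
    r * Real.tanh (p * r * b) + logDerivSoliton' p r b =
      r * p * ((1 - Real.tanh (p * r * b) ^ 2) / Real.tanh (p * r * b)) ∧
    0 < (1 - Real.tanh (p * r * b) ^ 2) / Real.tanh (p * r * b) := by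
  have hτ : 0 < Real.tanh (p * r * b) := tanh_pos (by positivity)
  have hτ1 := tanh_sq_lt_one (p * r * b)
  refine ⟨?_, div_pos (by linarith) hτ⟩
  rw [logDerivSoliton']
  generalize Real.tanh (p * r * b) = τ at *
  field_simp
  ring

/-- The quantity whose sign decides the Morse index. -/
lemma vertex_form_eq (hp : 0 < p) (hr : 0 < r) (hb : 0 < b) {α B T : ℝ}
    (hα : α = (B - T) * r * Real.tanh (p * r * b)) :
    ∃ d > 0, α + (B - T) * logDerivSoliton' p r b = (B - T) * d := by
  obtain ⟨h1, h2⟩ := sub_logDerivSoliton' hp hr hb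
  exact ⟨r * p * ((1 - Real.tanh (p * r * b) ^ 2) / Real.tanh (p * r * b)), by positivity,
    by rw [hα, ← h1]; ring⟩

lemma charFun_zero (hp : 0 < p) (hr : 0 < r) (hb : 0 < b) {α B T : ℝ} :
    charFun p r b α B T 0 = -(α + (B - T) * logDerivSoliton' p r b) *
      (decaying p r 0 (-b) * decaying p r 0 b) := by
  obtain ⟨-, -, h3, h4⟩ := decaying_data_zero hp hr hb
  rw [charFun, h3, h4]
  ring

/-- At `-b` the decaying solution is positive at the ground energy and negative at energy zero. -/
lemma exists_dirichlet (hp : 0 < p) (hr : 0 < r) (hb : 0 < b) :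
    ∃ l, groundEnergy p r < l ∧ l < 0 ∧ decaying p r l (-b) = 0 ∧ 0 < decaying' p r l (-b) := by
  obtain ⟨-, h1, -, -⟩ := decaying_data_zero hp hr hb
  obtain ⟨-, h2, -, -⟩ := decaying_data_groundEnergy (b := b) hp hr
  obtain ⟨l, hl, hl0, h⟩ := exists_zero_between (continuous_decaying_param hp hr (-b)).1
    (groundEnergy_neg hp hr) (mul_neg_of_pos_of_neg h2 h1)
  exact ⟨l, hl, hl0, h, decaying'_pos_of_eq_zero hp hr hl0 hb h⟩

/-- Sign change between a very negative energy, where the decaying solution is nonincreasing, and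
the ground energy. -/
lemma exists_charFun_eq_zero_of_pos (hp : 0 < p) (hr : 0 < r) {α B T : ℝ}
    (hα : α = (B - T) * r * Real.tanh (p * r * b)) (hα0 : 0 < α) (hB : 0 ≤ B) (hT : 0 ≤ T) :
    ∃ l < groundEnergy p r, charFun p r b α B T l = 0 := by
  obtain ⟨l, hl, h⟩ := exists_decaying'_nonpos hp hr
  obtain ⟨h1, h2, -, -⟩ := decaying_data_groundEnergy (b := b) hp hr
  have h3 : 0 < charFun p r b α B T (groundEnergy p r) := by
    rw [charFun_groundEnergy hp hr hα]; positivity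
  have hp1 := decaying_pos_of_lt hp hr hl b
  have hp2 := decaying_pos_of_lt hp hr hl (-b)
  have h4 : charFun p r b α B T l < 0 := by
    have e1 := mul_nonneg hB (mul_nonneg (neg_nonneg.2 (h (-b))) hp1.le)
    have e2 := mul_nonneg hT (mul_nonneg (neg_nonneg.2 (h b)) hp2.le)
    have e3 := mul_pos hα0 (mul_pos hp2 hp1)
    unfold charFun
    linarith
  obtain ⟨m, -, hm, h5⟩ := exists_zero_between (continuous_charFun hp hr b α B T) hl
    (mul_neg_of_neg_of_pos h4 h3)
  exact ⟨m, hm, h5⟩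

/-- The characteristic function is negative at the ground energy, positive at `ls` (only the bump
term survives there), and negative at zero. -/
lemma exists_charFun_eq_zero_of_neg (hp : 0 < p) (hr : 0 < r) (hb : 0 < b) {α B T : ℝ}
    (hα : α = (B - T) * r * Real.tanh (p * r * b)) (hα0 : α < 0) (hB : 0 < B) {ls : ℝ}
    (hls : groundEnergy p r < ls) (hls0 : ls < 0) (h : decaying p r ls (-b) = 0)
    (h' : 0 < decaying' p r ls (-b)) :
    ∃ l₁ l₂, l₁ < ls ∧ ls < l₂ ∧ l₂ < 0 ∧ charFun p r b α B T l₁ = 0 ∧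
      charFun p r b α B T l₂ = 0 := by
  have hτ : 0 < Real.tanh (p * r * b) := tanh_pos (by positivity)
  have hBT : B - T < 0 := by
    by_contra hcon
    have : 0 ≤ (B - T) * r * Real.tanh (p * r * b) :=
      mul_nonneg (mul_nonneg (not_lt.1 hcon) hr.le) hτ.le
    linarith
  have hc := continuous_charFun hp hr b α B T
  have h1 : charFun p r b α B T (groundEnergy p r) < 0 := by
    obtain ⟨e1, e2, -, -⟩ := decaying_data_groundEnergy (b := b) hp hr
    rw [charFun_groundEnergy hp hr hα]
    exact mul_neg_of_neg_of_pos (mul_neg_of_pos_of_neg hp hα0) (mul_pos e2 e1)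
  have h2 : 0 < charFun p r b α B T ls := by
    rw [charFun, h]
    have := mul_pos hB (mul_pos h' (decaying_pos hp hr hls0.le hb))
    linarith
  have h3 : charFun p r b α B T 0 < 0 := by
    obtain ⟨e1, e2, -, -⟩ := decaying_data_zero hp hr hb
    obtain ⟨d, hd, hd'⟩ := vertex_form_eq hp hr hb hα
    rw [charFun_zero hp hr hb, hd']
    have e3 := mul_neg_of_neg_of_pos e2 e1
    have e4 := mul_neg_of_neg_of_pos hBT hd
    nlinarith
  obtain ⟨l₁, -, hl₁, e1⟩ := exists_zero_between hc hls (mul_neg_of_neg_of_pos h1 h2)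
  obtain ⟨l₂, hl₂, hl₂0, e2⟩ := exists_zero_between hc hls0 (mul_neg_of_pos_of_neg h2 h3)
  exact ⟨l₁, l₂, hl₁, hl₂, hl₂0, e1, e2⟩

/-- The characteristic equation when there is no bump edge. -/
lemma exists_tail_eigenvalue (hp : 0 < p) (hr : 0 < r) (hb : 0 < b) {α T : ℝ}
    (hα : α = (0 - T) * r * Real.tanh (p * r * b)) (hα0 : α < 0) :
    ∃ l < 0, T * decaying' p r l b = α * decaying p r l b := by
  have hτ : 0 < Real.tanh (p * r * b) := tanh_pos (by positivity)
  have hT : 0 < T := by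
    by_contra hcon
    have : 0 ≤ (0 - T) * r * Real.tanh (p * r * b) :=
      mul_nonneg (mul_nonneg (by linarith) hr.le) hτ.le
    linarith
  have hc : Continuous fun l => T * decaying' p r l b - α * decaying p r l b :=
    ((continuous_decaying_param hp hr b).2.const_mul T).sub
      ((continuous_decaying_param hp hr b).1.const_mul α)
  obtain ⟨e1, -, e3, -⟩ := decaying_data_groundEnergy (b := b) hp hr
  obtain ⟨f1, -, f3, -⟩ := decaying_data_zero hp hr hb
  obtain ⟨d, hd, hd'⟩ := vertex_form_eq hp hr hb hα
  have h1 : T * decaying' p r (groundEnergy p r) b - α * decaying p r (groundEnergy p r) b < 0 := by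
    rw [e3]
    have : T * (-((p + 1) * r * Real.tanh (p * r * b)) * decaying p r (groundEnergy p r) b) -
      α * decaying p r (groundEnergy p r) b = p * α * decaying p r (groundEnergy p r) b := by
      rw [hα]; ring
    rw [this]
    exact mul_neg_of_neg_of_pos (mul_neg_of_pos_of_neg hp hα0) e1
  have h2 : 0 < T * decaying' p r 0 b - α * decaying p r 0 b := by
    rw [f3]
    have : T * (logDerivSoliton' p r b * decaying p r 0 b) - α * decaying p r 0 b =
        T * d * decaying p r 0 b := by
      linear_combination (-decaying p r 0 b) * hd'
    rw [this]
    positivity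
  obtain ⟨l, -, hl0, h⟩ := exists_zero_between hc (groundEnergy_neg hp hr)
    (mul_neg_of_neg_of_pos h1 h2)
  exact ⟨l, hl0, by linarith⟩

end

/-! ### Multiplicities and dimension counts. -/

section Counting

variable {E : Type*} [AddCommGroup E] [Module ℂ E]

lemma multiplicity_eq_zero_iff {T : E →ₗ.[ℂ] E} {μ : ℂ} :
    multiplicity T μ = 0 ↔ eigenspace T μ = ⊥ := by
  rw [multiplicity, Cardinal.toENat_eq_zero, Submodule.rank_eq_zero]

lemma natCast_le_multiplicity {T : E →ₗ.[ℂ] E} {μ : ℂ} {X : Type*} [AddCommGroup X] [Module ℂ X]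
    [Module.Finite ℂ X] (f : X →ₗ[ℂ] E) (hf : Function.Injective f)
    (h : ∀ x, f x ∈ eigenspace T μ) : (Module.finrank ℂ X : ℕ∞) ≤ multiplicity T μ := by
  have h1 : Function.Injective (f.codRestrict (eigenspace T μ) h) := fun x y hxy =>
    hf (congrArg Subtype.val hxy)
  have h2 := LinearMap.lift_rank_le_of_injective _ h1
  rw [multiplicity, Cardinal.natCast_le_toENat]
  rw [← Module.finrank_eq_rank, Cardinal.lift_natCast] at h2
  simpa using h2

/-- The sum of the multiplicities of the negative eigenvalues is bounded by the dimension of the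
sum of the eigenspaces. -/
lemma exists_multiplicity_nat {T : E →ₗ.[ℂ] E} {n : ℕ}
    (hind : iSupIndep fun l : {l : ℝ // l < 0} => eigenspace T ((l : ℝ) : ℂ))
    (hr : Module.rank ℂ (⨆ l : {l : ℝ // l < 0}, eigenspace T ((l : ℝ) : ℂ) : Submodule ℂ E) ≤ n) :
    ∃ m : {l : ℝ // l < 0} → ℕ, (∀ l : {l : ℝ // l < 0}, multiplicity T ((l : ℝ) : ℂ) = m l) ∧
      ∀ s : Finset {l : ℝ // l < 0}, ∑ l ∈ s, m l ≤ n := by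
  set W : Submodule ℂ E := ⨆ l : {l : ℝ // l < 0}, eigenspace T ((l : ℝ) : ℂ) with hW
  have hfin : Module.Finite ℂ W := Module.rank_lt_aleph0_iff.1 (hr.trans_lt (Cardinal.natCast_lt_aleph0))
  have hle : ∀ l : {l : ℝ // l < 0}, eigenspace T ((l : ℝ) : ℂ) ≤ W := fun l =>
    le_iSup (fun l : {l : ℝ // l < 0} => eigenspace T ((l : ℝ) : ℂ)) l
  have hfin' : ∀ l : {l : ℝ // l < 0}, Module.Finite ℂ (eigenspace T ((l : ℝ) : ℂ)) := fun l =>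
    Module.Finite.of_injective _ (Submodule.inclusion_injective (hle l))
  refine ⟨fun l => Module.finrank ℂ (eigenspace T ((l : ℝ) : ℂ)), fun l => ?_, fun s => ?_⟩
  · rw [multiplicity, ← Module.finrank_eq_rank, Cardinal.toENat_nat]
  · let f : (∀ l : s, eigenspace T ((l : ℝ) : ℂ)) →ₗ[ℂ] W :=
      ∑ l : s, (Submodule.inclusion (hle l)) ∘ₗ (LinearMap.proj l)
    have hf : Function.Injective f := by
      rw [injective_iff_map_eq_zero]
      intro x hx
      have h1 : ∑ l : s, ((x l : eigenspace T ((l : ℝ) : ℂ)) : E) = 0 := by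
        have := congrArg Subtype.val hx
        simpa [f] using this
      have h2 := (iSupIndep_iff_finsetSum_eq_zero_imp_eq_zero _).1
        (hind.comp (Subtype.val_injective (p := fun l => l ∈ s))) Finset.univ
        (fun l => (x l : E)) (fun l _ => (x l).2) h1
      ext l
      exact h2 l (Finset.mem_univ l)
    have h3 := LinearMap.finrank_le_finrank_of_injective hf
    rw [Module.finrank_pi_fintype] at h3
    have h4 : Module.finrank ℂ W ≤ n := by
      rw [← Module.finrank_eq_rank] at hr
      exact_mod_cast hr
    rw [← Finset.sum_coe_sort s]
    exact h3.trans h4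

end Counting

/-- A subspace of `L²(Γ)` whose elements are determined by the values of their continuous
representatives at finitely many points is finite-dimensional. -/
lemma rank_le_card_of_values {N : ℕ} {ι : Type} [Fintype ι] (W : Submodule ℂ (L2Graph N))
    (e : ι → Fin N) (x : ι → ℝ) (hW : ∀ v ∈ W, ∀ i, ∃ F, IsRep F (v i))
    (h : ∀ v ∈ W, (∀ i, ∃ F, IsRep F (v (e i)) ∧ F (x i) = 0) → v = 0) :
    Module.rank ℂ W ≤ Fintype.card ι := by
  -- Evaluation of the continuous representative is encoded as a linear relation, which avoids a
  -- linear choice of representatives. `G` projects onto `W` and injects into `ι → ℂ`.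
  let G : Submodule ℂ (L2Graph N × (ι → ℂ)) :=
    { carrier := {y | y.1 ∈ W ∧ ∀ i, ∃ F, IsRep F (y.1 (e i)) ∧ F (x i) = y.2 i}
      zero_mem' := ⟨W.zero_mem, fun i =>
        ⟨0, ⟨continuousOn_const, (Lp.coeFn_zero ℂ 2 halfLine).symm⟩, rfl⟩⟩
      add_mem' := by
        rintro y z ⟨hy, hy'⟩ ⟨hz, hz'⟩
        refine ⟨W.add_mem hy hz, fun i => ?_⟩
        obtain ⟨F, hF, hF'⟩ := hy' i
        obtain ⟨G, hG, hG'⟩ := hz' i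
        exact ⟨F + G, ⟨hF.cont.add hG.cont, (hF.ae.add hG.ae).trans (Lp.coeFn_add _ _).symm⟩,
          by simp [hF', hG']⟩
      smul_mem' := by
        rintro a y ⟨hy, hy'⟩
        refine ⟨W.smul_mem a hy, fun i => ?_⟩
        obtain ⟨F, hF, hF'⟩ := hy' i
        exact ⟨a • F, ⟨hF.cont.const_smul a, (hF.ae.const_smul a).trans (Lp.coeFn_smul _ _).symm⟩,
          by simp [hF']⟩ }
  have h1 : Function.Injective (LinearMap.snd ℂ (L2Graph N) (ι → ℂ) ∘ₗ G.subtype) := by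
    rw [injective_iff_map_eq_zero]
    rintro ⟨⟨v, t⟩, hv, ht⟩ h0
    have ht0 : t = 0 := h0
    subst ht0
    have : v = 0 := h v hv ht
    subst this
    rfl
  let g : G →ₗ[ℂ] W := (LinearMap.fst ℂ (L2Graph N) (ι → ℂ) ∘ₗ G.subtype).codRestrict W
    fun y => y.2.1
  have h2 : Function.Surjective g := by
    rintro ⟨v, hv⟩
    choose F hF using fun i => hW v hv (e i)
    exact ⟨⟨(v, fun i => F i (x i)), hv, fun i => ⟨F i, hF i, rfl⟩⟩, rfl⟩
  calc Module.rank ℂ W ≤ Module.rank ℂ G := LinearMap.rank_le_of_surjective g h2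
    _ ≤ Module.rank ℂ (ι → ℂ) := LinearMap.rank_le_of_injective _ h1
    _ = Fintype.card ι := by simp

/-! ### Symmetry and the negative spectral subspace. -/

section Operator

variable {N : ℕ} {α : ℝ} {V : Fin N → ℝ → ℝ}

lemma InGraph.exists_isRep {v w : L2Graph N} (h : InGraph α V v w) (j : Fin N) :
    ∃ F, IsRep F (v j) := by
  obtain ⟨D, E, c, d, h1, -⟩ := h
  exact (h1 j).exists_isRep

lemma inner_eq_sum_integral {v w : L2Graph N} {F W : Fin N → ℝ → ℂ} (hF : ∀ j, IsRep (F j) (v j))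
    (hW : ∀ j, IsRep (W j) (w j)) :
    inner ℂ v w = ∑ j, ∫ x in Ioi (0 : ℝ), conj (F j x) * W j x := by
  rw [PiLp.inner_apply]
  refine Finset.sum_congr rfl fun j _ => ?_
  rw [L2.inner_def]
  refine integral_congr_ae ?_
  filter_upwards [(hF j).ae, (hW j).ae] with x h1 h2
  rw [← h1, ← h2, RCLike.inner_apply, mul_comm]

lemma re_inner_eq_sum_integral {v w : L2Graph N} {F W : Fin N → ℝ → ℂ}
    (hF : ∀ j, IsRep (F j) (v j)) (hW : ∀ j, IsRep (W j) (w j)) :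
    (inner ℂ v w : ℂ).re = ∑ j, ∫ x in Ioi (0 : ℝ), (conj (F j x) * W j x).re := by
  rw [inner_eq_sum_integral hF hW, Complex.re_sum]
  refine Finset.sum_congr rfl fun j _ => ?_
  exact (integral_re (integrable_conj_mul (hF j).memLp (hW j).memLp)).symm

/-- The operator is symmetric. -/
lemma InGraph.inner_eq (hV : ∀ j, Continuous (V j)) {v w v' w' : L2Graph N}
    (h : InGraph α V v w) (h' : InGraph α V v' w') {W W' : Fin N → ℝ → ℂ}
    (hW : ∀ j, IsRep (W j) (w j)) (hW' : ∀ j, IsRep (W' j) (w' j)) :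
    (inner ℂ w v' : ℂ) = inner ℂ v w' := by
  obtain ⟨F, F', c, hs, hF, h0, h1⟩ := h.exists_solvesEdge hV hW
  obtain ⟨G, G', c', ks, hG, k0, k1⟩ := h'.exists_solvesEdge hV hW'
  rw [inner_eq_sum_integral hW hG, inner_eq_sum_integral hF hW', ← sub_eq_zero,
    ← Finset.sum_sub_distrib]
  have e : ∀ j, (∫ x in Ioi (0 : ℝ), conj (W j x) * G j x) -
      (∫ x in Ioi (0 : ℝ), conj (F j x) * W' j x) = conj (F' j 0) * c' - conj c * G' j 0 := by
    intro j
    rw [← integral_sub (integrable_conj_mul (hW j).memLp (hG j).memLp)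
      (integrable_conj_mul (hF j).memLp (hW' j).memLp), (hs j).integral_green (ks j), h0, k0]
  simp only [e]
  rw [Finset.sum_sub_distrib, ← Finset.sum_mul, ← Finset.mul_sum, ← map_sum, h1, k1]
  simp only [map_mul, Complex.conj_ofReal]
  ring

variable {T : L2Graph N →ₗ.[ℂ] L2Graph N}

lemma mem_eigenspace_iff_inGraph (hT : ∀ v w, (v, w) ∈ T.graph ↔ InGraph α V v w) {l : ℂ}
    {u : L2Graph N} : u ∈ eigenspace T l ↔ InGraph α V u (l • u) := by
  rw [← hT]
  rfl

lemma IsRep.const_smul {F : ℝ → ℂ} {f : L2Edge} (hF : IsRep F f) (a : ℂ) :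
    IsRep (fun x => a * F x) (a • f) :=
  ⟨continuousOn_const.mul hF.cont, (hF.ae.const_smul a).trans (Lp.coeFn_smul _ _).symm⟩

lemma inner_eigenspace_eq_zero (hV : ∀ j, Continuous (V j))
    (hT : ∀ v w, (v, w) ∈ T.graph ↔ InGraph α V v w) {l m : ℝ} (hlm : l ≠ m) {u v : L2Graph N}
    (hu : u ∈ eigenspace T (l : ℂ)) (hv : v ∈ eigenspace T (m : ℂ)) : (inner ℂ u v : ℂ) = 0 := by
  rw [mem_eigenspace_iff_inGraph hT] at hu hv
  choose F hF using hu.exists_isRep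
  choose G hG using hv.exists_isRep
  have h := hu.inner_eq hV hv (fun j => (hF j).const_smul l) (fun j => (hG j).const_smul m)
  rw [inner_smul_left, inner_smul_right, Complex.conj_ofReal, ← sub_eq_zero, ← sub_mul] at h
  refine (mul_eq_zero.1 h).resolve_left ?_
  exact sub_ne_zero.2 (by exact_mod_cast hlm)

lemma iSupIndep_eigenspace (hV : ∀ j, Continuous (V j))
    (hT : ∀ v w, (v, w) ∈ T.graph ↔ InGraph α V v w) :
    iSupIndep fun l : {l : ℝ // l < 0} => eigenspace T ((l : ℝ) : ℂ) := by
  refine OrthogonalFamily.independent (𝕜 := ℂ) fun l m hlm u v => ?_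
  exact inner_eigenspace_eq_zero hV hT (fun h => hlm (Subtype.ext h)) u.2 v.2

/-- On the negative spectral subspace the operator is negative definite. -/
lemma exists_inGraph_of_mem_iSup (hV : ∀ j, Continuous (V j))
    (hT : ∀ v w, (v, w) ∈ T.graph ↔ InGraph α V v w) {v : L2Graph N}
    (hv : v ∈ (⨆ l : {l : ℝ // l < 0}, eigenspace T ((l : ℝ) : ℂ) : Submodule ℂ (L2Graph N))) :
    ∃ w, InGraph α V v w ∧ (∀ j, ∃ W, IsRep W (w j)) ∧
      (v ≠ 0 → (inner ℂ v w : ℂ).re < 0) := by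
  obtain ⟨f, hf, rfl⟩ := (Submodule.mem_iSup_iff_exists_finsupp _ _).1 hv
  have hg : ∀ l : {l : ℝ // l < 0}, (f l, ((l : ℝ) : ℂ) • f l) ∈ T.graph := fun l => hf l
  -- The image `w` lies in the domain as well, and therefore has continuous representatives.
  have hg' : ∀ l : {l : ℝ // l < 0}, (((l : ℝ) : ℂ) • f l, ((l : ℝ) : ℂ) • ((l : ℝ) : ℂ) • f l) ∈ T.graph := fun l =>
    T.graph.smul_mem ((l : ℝ) : ℂ) (hg l)
  have key : ∀ g h : {l : ℝ // l < 0} → L2Graph N, (∀ l, (g l, h l) ∈ T.graph) →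
      InGraph α V (∑ l ∈ f.support, g l) (∑ l ∈ f.support, h l) := by
    intro g h hgh
    rw [← hT]
    have := T.graph.sum_mem (t := f.support) (f := fun l => (g l, h l)) fun l _ => hgh l
    convert this using 1
    ext1 <;> simp [Prod.fst_sum, Prod.snd_sum]
  have h1 := key (fun l => f l) (fun l => ((l : ℝ) : ℂ) • f l) hg
  have h2 := key (fun l => ((l : ℝ) : ℂ) • f l) _ hg'
  have hsum : (f.sum fun _ x => x) = ∑ l ∈ f.support, f l := rfl
  refine ⟨∑ l ∈ f.support, ((l : ℝ) : ℂ) • f l, h1, h2.exists_isRep, fun hne => ?_⟩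
  have h3 : (inner ℂ (∑ l ∈ f.support, f l) (∑ l ∈ f.support, ((l : ℝ) : ℂ) • f l) : ℂ) =
      ((∑ l ∈ f.support, (l : ℝ) * ‖f l‖ ^ 2 : ℝ) : ℂ) := by
    rw [sum_inner, Complex.ofReal_sum]
    refine Finset.sum_congr rfl fun l hl => ?_
    rw [inner_sum, Finset.sum_eq_single l]
    · rw [inner_smul_right, inner_self_eq_norm_sq_to_K]
      push_cast
      rfl
    · intro m _ hm
      rw [inner_smul_right, inner_eigenspace_eq_zero hV hT (fun h => hm (Subtype.ext h.symm))
        (hf l) (hf m), mul_zero]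
    · exact fun h => absurd hl h
  rw [hsum, h3, Complex.ofReal_re]
  refine Finset.sum_neg (fun l hl => ?_) ?_
  · have h4 : f l ≠ 0 := Finsupp.mem_support_iff.1 hl
    exact mul_neg_of_neg_of_pos l.2 (by positivity)
  · by_contra h
    rw [Finset.not_nonempty_iff_eq_empty] at h
    exact hne (by rw [hsum, h, Finset.sum_empty])

/-- An upper bound for the dimension of the negative spectral subspace: the form is nonnegative
on functions vanishing at the given points. -/
lemma rank_iSup_eigenspace_le {ι : Type} [Fintype ι] (hV : ∀ j, Continuous (V j))
    (hT : ∀ v w, (v, w) ∈ T.graph ↔ InGraph α V v w) (e : ι → Fin N) (x : ι → ℝ)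
    (hx : ∀ i, 0 ≤ x i)
    (h : ∀ (F F' W : Fin N → ℝ → ℂ) (c : ℂ), (∀ j, SolvesEdge (V j) (F j) (F' j) (W j)) →
      (∀ j, F j 0 = c) → ∑ j, F' j 0 = α * c → (∀ i, F (e i) (x i) = 0) →
      0 ≤ ∑ j, ∫ x in Ioi (0 : ℝ), (conj (F j x) * W j x).re) :
    Module.rank ℂ (⨆ l : {l : ℝ // l < 0}, eigenspace T ((l : ℝ) : ℂ) :
      Submodule ℂ (L2Graph N)) ≤ Fintype.card ι := by
  refine rank_le_card_of_values _ e x (fun v hv => ?_) fun v hv h0 => ?_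
  · obtain ⟨w, hw, -⟩ := exists_inGraph_of_mem_iSup hV hT hv
    exact hw.exists_isRep
  · obtain ⟨w, hw, hw', hneg⟩ := exists_inGraph_of_mem_iSup hV hT hv
    by_contra hne
    choose W hW using hw'
    obtain ⟨F, F', c, hs, hF, h1, h2⟩ := hw.exists_solvesEdge hV hW
    have h3 := h F F' W c hs h1 h2 fun i => by
      obtain ⟨G, hG, hG'⟩ := h0 i
      rw [(hF (e i)).eqOn hG (hx i), hG']
    rw [← re_inner_eq_sum_integral hF hW] at h3
    exact absurd (hneg hne) (not_lt.2 h3)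

end Operator

/-! ### Lower bounds for the quadratic form on one edge. -/

section Edge

lemma tendsto_piconeTerm_nhdsGT {g : ℝ → ℝ} {F F' : ℝ → ℂ} (hF : ContinuousOn F (Ici 0))
    (hF' : ContinuousOn F' (Ici 0)) (hg : ContinuousAt g 0) :
    Tendsto (piconeTerm g F F') (𝓝[>] 0) (𝓝 (piconeTerm g F F' 0)) := by
  have h : ContinuousWithinAt (piconeTerm g F F') (Ici 0) 0 :=
    (Complex.continuous_re.continuousAt.comp_continuousWithinAt
      ((Complex.continuous_conj.continuousAt.comp_continuousWithinAt
        (hF 0 self_mem_Ici)).mul (hF' 0 self_mem_Ici))).sub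
      (hg.continuousWithinAt.mul
        (Complex.continuous_normSq.continuousAt.comp_continuousWithinAt (hF 0 self_mem_Ici)))
  exact h.mono_left (nhdsWithin_mono _ Ioi_subset_Ici_self)

variable {p r b : ℝ} {F F' W : ℝ → ℂ}

/-- Lower bound for the form on an edge carrying a tail. -/
lemma SolvesEdge.form_tail_ge (hp : 0 < p) (hr : 0 < r) (hb : 0 < b)
    (h : SolvesEdge (fun x => well (kappa p) p r (x + b)) F F' W) :
    (conj (F 0) * F' 0).re - logDerivSoliton' p r b * Complex.normSq (F 0) ≤
      ∫ x in Ioi (0 : ℝ), (conj (F x) * W x).re := by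
  have hd : ∀ t, 0 ≤ t → HasDerivAt (fun x => logDerivSoliton' p r (x + b))
      (well (kappa p) p r (t + b) - logDerivSoliton' p r (t + b) ^ 2) t := fun t ht =>
    (hasDerivAt_logDerivSoliton' hp hr (by linarith : t + b ≠ 0)).comp_add_const t b
  have := h.picone_Ioi (C := r ^ 2 + |kappa p| * r ^ 2) (fun x => abs_well_le _ _ _ _)
    ((continuous_well _ _ _).comp (by fun_prop)) le_rfl (fun t ht => hd t ht.le)
    (isBoundedUnder_logDerivSoliton' hp hr b)
    (tendsto_piconeTerm_nhdsGT h.cont h.cont' (hd 0 le_rfl).continuousAt)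
  simpa only [piconeTerm, zero_add] using this

/-- Lower bound for the form on an edge carrying a bump, for functions vanishing at its top. -/
lemma SolvesEdge.form_bump_ge (hp : 0 < p) (hr : 0 < r) (hb : 0 < b)
    (h : SolvesEdge (fun x => well (kappa p) p r (x + -b)) F F' W) (hF : F b = 0) :
    (conj (F 0) * F' 0).re + logDerivSoliton' p r b * Complex.normSq (F 0) ≤
      ∫ x in Ioi (0 : ℝ), (conj (F x) * W x).re := by
  have hd : ∀ t, t ≠ b → HasDerivAt (fun x => logDerivSoliton' p r (x + -b))
      (well (kappa p) p r (t + -b) - logDerivSoliton' p r (t + -b) ^ 2) t := fun t ht =>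
    (hasDerivAt_logDerivSoliton' hp hr
      (by rwa [← sub_eq_add_neg, sub_ne_zero])).comp_add_const t (-b)
  have hpole : Tendsto (fun x => logDerivSoliton' p r (x + -b) * (x - b)) (𝓝[≠] b) (𝓝 1) := by
    refine (tendsto_logDerivSoliton'_mul hp hr).comp (f := fun x => x + -b) ?_
    refine tendsto_nhdsWithin_iff.2 ⟨?_, ?_⟩
    · have : ContinuousAt (fun x : ℝ => x + -b) b := by fun_prop
      have h' := this.tendsto
      rw [add_neg_cancel] at h'
      exact h'.mono_left nhdsWithin_le_nhds
    · filter_upwards [self_mem_nhdsWithin] with x hx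
      show x + -b ≠ 0
      rwa [← sub_eq_add_neg, sub_ne_zero]
  -- Since `F b = 0`, the pole at the top contributes nothing, and Picone's inequality holds
  -- separately on `(0, b)` and `(b, ∞)`.
  have hz : Tendsto (piconeTerm (fun x => logDerivSoliton' p r (x + -b)) F F') (𝓝[≠] b) (𝓝 0) :=
    tendsto_piconeTerm_zero (h.deriv b hb) (h.deriv' b hb).continuousAt hF hpole
  have h1 := picone_Ioo hb (fun t ht => hd t ht.2.ne) (fun t ht => h.deriv t ht.1)
    (fun t ht => h.deriv' t ht.1) (h.cont.mono Icc_subset_Ici_self)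
    (h.contW.mono Icc_subset_Ici_self)
    (tendsto_piconeTerm_nhdsGT h.cont h.cont' (hd 0 hb.ne).continuousAt)
    (hz.mono_left (nhdsWithin_mono _ fun y hy => ne_of_lt hy))
  have h2 := h.picone_Ioi (C := r ^ 2 + |kappa p| * r ^ 2) (fun x => abs_well_le _ _ _ _)
    ((continuous_well _ _ _).comp (by fun_prop)) hb.le (fun t ht => hd t ht.ne')
    (isBoundedUnder_logDerivSoliton' hp hr (-b))
    (hz.mono_left (nhdsWithin_mono _ fun y hy => ne_of_gt hy))
  have hi : IntegrableOn (fun t => (conj (F t) * W t).re) (Ioi 0) :=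
    Complex.reCLM.integrable_comp (integrable_conj_mul h.mem h.memW)
  have hdisj : Disjoint (Ioc 0 b) (Ioi b) := Set.Ioc_disjoint_Ioi (le_refl b)
  have h3 := setIntegral_union hdisj measurableSet_Ioi
    (hi.mono_set Ioc_subset_Ioi_self) (hi.mono_set (Ioi_subset_Ioi hb.le))
  rw [Ioc_union_Ioi_eq_Ioi hb.le, ← intervalIntegral.integral_of_le hb.le] at h3
  rw [h3]
  simp only [piconeTerm, zero_add, sub_zero, logDerivSoliton'_neg] at h1
  linarith

/-- Lower bound for the form of `L₋` on an edge. -/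
lemma SolvesEdge.form_minus_ge (a : ℝ) (h : SolvesEdge (fun x => well (p + 1) p r (x + a)) F F' W) :
    (conj (F 0) * F' 0).re - logDerivSoliton p r a * Complex.normSq (F 0) ≤
      ∫ x in Ioi (0 : ℝ), (conj (F x) * W x).re := by
  have hd : ∀ t, HasDerivAt (fun x => logDerivSoliton p r (x + a))
      (well (p + 1) p r (t + a) - logDerivSoliton p r (t + a) ^ 2) t := fun t =>
    (hasDerivAt_logDerivSoliton p r (t + a)).comp_add_const t a
  have := h.picone_Ioi (C := r ^ 2 + |p + 1| * r ^ 2) (fun x => abs_well_le _ _ _ _)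
    ((continuous_well _ _ _).comp (by fun_prop)) le_rfl (fun t _ => hd t)
    (isBoundedUnder_of ⟨|-r| * 1, fun z => by
      rw [logDerivSoliton, abs_mul]
      gcongr
      exact (Real.abs_tanh_lt_one _).le⟩)
    (tendsto_piconeTerm_nhdsGT h.cont h.cont' (hd 0).continuousAt)
  simpa only [piconeTerm, zero_add] using this

/-- Two square-integrable solutions of `F'' = q F` have vanishing Wronskian. -/
lemma SolvesEdge.deriv_zero_eq {q : ℝ → ℝ} {f f' : ℝ → ℝ} {m : ℝ}
    (hF : SolvesEdge q F F' (fun _ => 0))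
    (hG : SolvesEdge q (fun x => (f x : ℂ)) (fun x => (f' x : ℂ)) (fun _ => 0))
    (h0 : f 0 ≠ 0) (h1 : f' 0 = m * f 0) : F' 0 = m * F 0 := by
  have h := hG.integral_green hF
  simp only [map_zero, zero_mul, mul_zero, sub_zero, integral_zero, Complex.conj_ofReal, h1] at h
  push_cast at h
  have h0' : (f 0 : ℂ) ≠ 0 := by exact_mod_cast h0
  refine mul_left_cancel₀ h0' ?_
  linear_combination h

lemma SolvesEdge.eq_zero {q : ℝ → ℝ} {C : ℝ} (hq : ∀ x, |q x| ≤ C)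
    (hF : SolvesEdge q F F' (fun _ => 0)) (h0 : F 0 = 0) (h0' : F' 0 = 0) :
    EqOn F 0 (Ici 0) := fun x hx =>
  (eq_zero_of_initial hq hF.cont hF.cont' hF.deriv
    (fun x hx => by simpa using hF.deriv' x hx) h0 h0' x hx).1

lemma SolvesEdge.const_mul {q : ℝ → ℝ} (h : SolvesEdge q F F' W) (a : ℂ) :
    SolvesEdge q (fun x => a * F x) (fun x => a * F' x) (fun x => a * W x) :=
  ⟨continuousOn_const.mul h.cont, continuousOn_const.mul h.cont', continuousOn_const.mul h.contW,
    h.mem.const_mul a, h.mem'.const_mul a, h.memW.const_mul a,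
    fun x hx => (h.deriv x hx).const_mul a,
    fun x hx => ((h.deriv' x hx).const_mul a).congr_deriv (by ring)⟩

lemma IsRep.eq_zero {f : L2Edge} (h : IsRep F f) (h0 : EqOn F 0 (Ici 0)) : f = 0 := by
  refine Lp.eq_zero_iff_ae_eq_zero.2 ?_
  filter_upwards [h.ae, ae_restrict_mem measurableSet_Ioi] with x hx hx'
  rw [← hx, h0 (mem_Ici.2 (le_of_lt hx'))]

lemma isRep_zero : IsRep (fun _ => 0) 0 :=
  ⟨continuousOn_const, (Lp.coeFn_zero ℂ 2 halfLine).symm⟩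

end Edge

section Graph

variable {N : ℕ}

/-- The signed distance of the vertex to the top of the profile: `-b` on the edges in `B`
(which carry a bump), `b` on the other edges (which carry a tail). -/
def edgeShift (b : ℝ) (B : Finset (Fin N)) (j : Fin N) : ℝ := if j ∈ B then -b else b

/-- The potential on the star graph. -/
def graphWell (κ p r b : ℝ) (B : Finset (Fin N)) (j : Fin N) (x : ℝ) : ℝ :=
  well κ p r (x + edgeShift b B j)

lemma continuous_graphWell (κ p r b : ℝ) (B : Finset (Fin N)) (j : Fin N) :
    Continuous (graphWell κ p r b B j) :=
  (continuous_well κ p r).comp (by fun_prop)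

lemma abs_graphWell_le (κ p r b : ℝ) (B : Finset (Fin N)) (j : Fin N) (x : ℝ) :
    |graphWell κ p r b B j x| ≤ r ^ 2 + |κ| * r ^ 2 := abs_well_le _ _ _ _

lemma sum_ite_mem_eq {R : Type*} [CommSemiring R] (B : Finset (Fin N)) (x y : R) :
    ∑ j, (if j ∈ B then x else y) = B.card * x + Bᶜ.card * y := by
  rw [← Finset.sum_add_sum_compl B]
  congr 1
  · rw [Finset.sum_congr rfl fun j hj => if_pos hj]; simp
  · rw [Finset.sum_congr rfl fun j hj => if_neg (Finset.mem_compl.1 hj)]; simp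

variable {p r b α : ℝ} {B : Finset (Fin N)} {T : L2Graph N →ₗ.[ℂ] L2Graph N}

/-- The `e j` are translates of the decaying solution; the two conditions on the coefficients are
continuity at the vertex and the `δ` condition. -/
lemma exists_eigenvectors (hp : 0 < p) (hr : 0 < r)
    (hT : ∀ v w, (v, w) ∈ T.graph ↔ InGraph α (graphWell (kappa p) p r b B) v w)
    {l : ℝ} (hl : l ≤ 0) : ∃ e : Fin N → L2Edge, (∀ j, e j ≠ 0) ∧ ∀ (c : Fin N → ℂ) (d : ℂ),
      (∀ j, c j * decaying p r l (edgeShift b B j) = d) →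
      ∑ j, c j * decaying' p r l (edgeShift b B j) = α * d →
      (WithLp.toLp 2 fun j => c j • e j) ∈ eigenspace T (l : ℂ) := by
  have hs := fun j => solvesEdge_decaying hp hr hl (edgeShift b B j) 0
  simp only [sub_zero] at hs
  refine ⟨fun j => (hs j).mem.toLp, fun j h0 => ?_, fun c d h1 h2 => ?_⟩
  · have h1 := (isRep_toLp (hs j).cont (hs j).mem)
    have h0' : (hs j).mem.toLp = 0 := h0
    rw [h0'] at h1
    have h2 := h1.eqOn isRep_zero
    obtain ⟨y, hy, hy'⟩ := ((decaying_eventually_pos hp hr l).and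
      (eventually_ge_atTop (edgeShift b B j))).exists
    have h3 := h2 (mem_Ici.2 (by linarith : 0 ≤ y - edgeShift b B j))
    simp only [sub_add_cancel, Complex.ofReal_eq_zero] at h3
    linarith
  · rw [mem_eigenspace_iff_inGraph hT]
    have hrep := fun j => (isRep_toLp (hs j).cont (hs j).mem).const_smul (c j)
    refine inGraph_of_solvesEdge (F := fun j x => c j * (decaying p r l (x + edgeShift b B j) : ℂ))
      (F' := fun j x => c j * (decaying' p r l (x + edgeShift b B j) : ℂ))
      (W := fun j x => c j * ((l : ℂ) * (decaying p r l (x + edgeShift b B j) : ℂ))) (c := d)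
      (continuous_graphWell _ _ _ _ _) (fun j => ⟨_, abs_graphWell_le _ _ _ _ _ j⟩)
      (fun j => (hs j).const_mul (c j)) hrep (fun j => ?_) (fun j => ?_) ?_
    · have := (hrep j).const_smul (l : ℂ)
      have e : (fun x => c j * ((l : ℂ) * (decaying p r l (x + edgeShift b B j) : ℂ))) =
          fun x => (l : ℂ) * (c j * (decaying p r l (x + edgeShift b B j) : ℂ)) := by
        ext x
        ring
      show IsRep (fun x => c j * ((l : ℂ) * (decaying p r l (x + edgeShift b B j) : ℂ))) _
      rw [e]
      exact this
    · simpa using h1 j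
    · simpa using h2

lemma one_le_multiplicity_of_coeff (hp : 0 < p) (hr : 0 < r)
    (hT : ∀ v w, (v, w) ∈ T.graph ↔ InGraph α (graphWell (kappa p) p r b B) v w)
    {l : ℝ} (hl : l ≤ 0) (c : Fin N → ℝ) (d : ℝ)
    (h1 : ∀ j, c j * decaying p r l (edgeShift b B j) = d)
    (h2 : ∑ j, c j * decaying' p r l (edgeShift b B j) = α * d) {j : Fin N} (hj : c j ≠ 0) :
    1 ≤ multiplicity T (l : ℂ) := by
  obtain ⟨e, he, h⟩ := exists_eigenvectors hp hr hT hl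
  have hmem := h (fun j => (c j : ℂ)) d (fun j => by exact_mod_cast h1 j) (by exact_mod_cast h2)
  rw [Order.one_le_iff_ne_zero, Ne, multiplicity_eq_zero_iff]
  intro hbot
  rw [hbot, Submodule.mem_bot] at hmem
  have h3 : (c j : ℂ) • e j = 0 := congrArg (fun v : L2Graph N => v j) hmem
  rcases smul_eq_zero.1 h3 with h4 | h4
  · exact hj (by exact_mod_cast h4)
  · exact he j h4

/-- A bump edge is needed for a nonzero vector: its coefficient is `u(b) > 0`, while the tail
coefficient `u(-b)` may vanish. -/
lemma one_le_multiplicity_of_charFun (hp : 0 < p) (hr : 0 < r) (hb : 0 < b)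
    (hT : ∀ v w, (v, w) ∈ T.graph ↔ InGraph α (graphWell (kappa p) p r b B) v w)
    (hB : B.Nonempty) {l : ℝ} (hl : l ≤ 0) (h : charFun p r b α B.card Bᶜ.card l = 0) :
    1 ≤ multiplicity T (l : ℂ) := by
  obtain ⟨j, hj⟩ := hB
  refine one_le_multiplicity_of_coeff hp hr hT hl
    (fun j => if j ∈ B then decaying p r l b else decaying p r l (-b))
    (decaying p r l (-b) * decaying p r l b) (fun j => ?_) ?_ (j := j) ?_
  · simp only [edgeShift]
    split_ifs <;> ring
  · have e : ∀ j, (if j ∈ B then decaying p r l b else decaying p r l (-b)) *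
        decaying' p r l (edgeShift b B j) = if j ∈ B then decaying' p r l (-b) * decaying p r l b
          else decaying' p r l b * decaying p r l (-b) := fun j => by
      simp only [edgeShift]
      split_ifs <;> ring
    simp only [e]
    rw [sum_ite_mem_eq]
    unfold charFun at h
    linarith
  · rw [if_pos hj]
    exact (decaying_pos hp hr hl hb).ne'

lemma card_sub_one_le_multiplicity (hp : 0 < p) (hr : 0 < r)
    (hT : ∀ v w, (v, w) ∈ T.graph ↔ InGraph α (graphWell (kappa p) p r b B) v w)
    {l : ℝ} (hl : l ≤ 0) (h : decaying p r l (-b) = 0) :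
    ((B.card - 1 : ℕ) : ℕ∞) ≤ multiplicity T (l : ℂ) := by
  obtain ⟨e, he, hmem⟩ := exists_eigenvectors hp hr hT hl
  -- At such an energy bump functions vanish at the vertex and have equal derivatives there, so the
  -- `δ` condition is the vanishing of the coefficient sum.
  let s : (B → ℂ) →ₗ[ℂ] ℂ := ∑ i, LinearMap.proj i
  let ext : (B → ℂ) → Fin N → ℂ := fun x j => if hj : j ∈ B then x ⟨j, hj⟩ else 0
  let f : (LinearMap.ker s) →ₗ[ℂ] L2Graph N :=
    { toFun := fun x => WithLp.toLp 2 fun j => ext x j • e j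
      map_add' := fun x y => by
        ext1 j
        simp only [ext, PiLp.add_apply]
        split_ifs <;> simp [add_smul]
      map_smul' := fun a x => by
        ext1 j
        simp only [ext, PiLp.smul_apply]
        split_ifs <;> simp [mul_smul] }
  have hf : Function.Injective f := by
    rw [injective_iff_map_eq_zero]
    intro x hx
    ext ⟨j, hj⟩
    have h3 : ext x j • e j = 0 := congrArg (fun v : L2Graph N => v j) hx
    have h4 := (smul_eq_zero.1 h3).resolve_right (he j)
    simpa [ext, hj] using h4
  have hfm : ∀ x, f x ∈ eigenspace T (l : ℂ) := by
    intro x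
    refine hmem (ext x) 0 (fun j => ?_) ?_
    · simp only [ext, edgeShift]
      split_ifs with hj
      · rw [h, Complex.ofReal_zero, mul_zero]
      · rw [zero_mul]
    · have hx : ∑ i, (x : B → ℂ) i = 0 := by
        have := LinearMap.mem_ker.1 x.2
        simpa [s] using this
      rw [← Finset.sum_add_sum_compl B, Finset.sum_eq_zero (s := Bᶜ), add_zero, mul_zero,
        ← Finset.sum_coe_sort B]
      · have : ∀ i : B, ext x i * (decaying' p r l (edgeShift b B i) : ℂ) =
            (x : B → ℂ) i * decaying' p r l (-b) := fun i => by
          simp [ext, edgeShift, i.2]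
        simp only [this]
        rw [← Finset.sum_mul, hx, zero_mul]
      · intro j hj
        simp [ext, Finset.mem_compl.1 hj]
  refine le_trans ?_ (natCast_le_multiplicity f hf hfm)
  have h5 := LinearMap.finrank_range_add_finrank_ker s
  have h6 : Module.finrank ℂ (LinearMap.range s) ≤ 1 :=
    (Submodule.finrank_le _).trans (by simp)
  rw [Module.finrank_fintype_fun_eq_card, Fintype.card_coe] at h5
  exact_mod_cast (by omega)

end Graph

/-- Lower bounds for the multiplicities that add up to an upper bound for the dimension of the
negative spectral subspace are sharp. -/
lemma morseIndex_eq_of_le {E : Type*} [AddCommGroup E] [Module ℂ E] {T : E →ₗ.[ℂ] E} {n : ℕ}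
    (hind : iSupIndep fun l : {l : ℝ // l < 0} => eigenspace T ((l : ℝ) : ℂ))
    (hr : Module.rank ℂ (⨆ l : {l : ℝ // l < 0}, eigenspace T ((l : ℝ) : ℂ) : Submodule ℂ E) ≤ n)
    (s : Finset ℝ) (k : ℝ → ℕ) (hs : ∀ l ∈ s, l < 0)
    (hk : ∀ l ∈ s, (k l : ℕ∞) ≤ multiplicity T (l : ℂ)) (hn : n ≤ ∑ l ∈ s, k l) :
    morseIndex T = n ∧ (∀ l ∈ s, multiplicity T (l : ℂ) = k l) ∧
      ∀ l : ℝ, l < 0 → l ∉ s → eigenspace T (l : ℂ) = ⊥ := by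
  classical
  obtain ⟨m, hm, hle⟩ := exists_multiplicity_nat hind hr
  have hkm : ∀ l ∈ s.subtype (· < 0), k l ≤ m l := fun l hl => by
    have := hk l (Finset.mem_subtype.1 hl)
    rw [hm] at this
    exact_mod_cast this
  have hsum := Finset.sum_subtype_of_mem k hs
  have h1 := Finset.sum_le_sum hkm
  have h2 := hle (s.subtype (· < 0))
  have h3 : ∀ l ∈ s.subtype (· < 0), k l = m l :=
    (Finset.sum_eq_sum_iff_of_le hkm).1 (by omega)
  have h4 : ∀ l ∉ s.subtype (· < 0), m l = 0 := fun l hl => by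
    have := hle (insert l (s.subtype (· < 0)))
    rw [Finset.sum_insert hl] at this
    omega
  refine ⟨?_, fun l hl => ?_, fun l hl hls => ?_⟩
  · rw [morseIndex, tsum_congr hm, tsum_eq_sum (s := s.subtype (· < 0)) fun l hl => by simp [h4 l hl]]
    have : ∑ l ∈ s.subtype (· < 0), m l = n := by omega
    exact_mod_cast this
  · rw [hm ⟨l, hs l hl⟩, ← h3 ⟨l, hs l hl⟩ (Finset.mem_subtype.2 hl)]
  · rw [← multiplicity_eq_zero_iff, hm ⟨l, hl⟩, h4 ⟨l, hl⟩ fun h => hls (Finset.mem_subtype.1 h)]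
    rfl

/-! ### Morse and degeneracy indices of `L₊`. -/

section Graph

variable {N : ℕ} {p r b α : ℝ} {B : Finset (Fin N)} {T : L2Graph N →ₗ.[ℂ] L2Graph N}

lemma vertex_sum_eq {F F' : Fin N → ℝ → ℂ} {c : ℂ} (h0 : ∀ j, F j 0 = c)
    (h1 : ∑ j, F' j 0 = α * c) (m : Fin N → ℝ) :
    ∑ j, ((conj (F j 0) * F' j 0).re + m j * Complex.normSq (F j 0)) =
      (α + ∑ j, m j) * Complex.normSq c := by
  simp only [h0]
  rw [Finset.sum_add_distrib, ← Complex.re_sum, ← Finset.mul_sum, h1, ← Finset.sum_mul, add_mul]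
  congr 1
  rw [mul_left_comm, ← Complex.normSq_eq_conj_mul_self]
  exact_mod_cast Complex.ofReal_re _

/-- Lower bound for the form of `L₊` on functions vanishing at the tops of the bumps. -/
lemma form_plus_ge (hp : 0 < p) (hr : 0 < r) (hb : 0 < b) {F F' W : Fin N → ℝ → ℂ} {c : ℂ}
    (hs : ∀ j, SolvesEdge (graphWell (kappa p) p r b B j) (F j) (F' j) (W j))
    (h0 : ∀ j, F j 0 = c) (h1 : ∑ j, F' j 0 = α * c) (hB : ∀ j ∈ B, F j b = 0) :
    (α + ((B.card : ℝ) - Bᶜ.card) * logDerivSoliton' p r b) * Complex.normSq c ≤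
      ∑ j, ∫ x in Ioi (0 : ℝ), (conj (F j x) * W j x).re := by
  have e := vertex_sum_eq h0 h1
    fun j => if j ∈ B then logDerivSoliton' p r b else -logDerivSoliton' p r b
  rw [sum_ite_mem_eq] at e
  have : (α + ((B.card : ℝ) - Bᶜ.card) * logDerivSoliton' p r b) * Complex.normSq c =
      (α + (B.card * logDerivSoliton' p r b + Bᶜ.card * -logDerivSoliton' p r b)) *
        Complex.normSq c := by ring
  rw [this, ← e]
  refine Finset.sum_le_sum fun j _ => ?_
  have hj := hs j
  unfold graphWell edgeShift at hj
  split_ifs at hj ⊢ with h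
  · exact hj.form_bump_ge hp hr hb (hB j h)
  · have := hj.form_tail_ge hp hr hb
    linarith

lemma rank_le_of_pos (hp : 0 < p) (hr : 0 < r) (hb : 0 < b)
    (hT : ∀ v w, (v, w) ∈ T.graph ↔ InGraph α (graphWell (kappa p) p r b B) v w)
    (hα : α = ((B.card : ℝ) - Bᶜ.card) * r * Real.tanh (p * r * b)) (hα0 : 0 < α) :
    Module.rank ℂ (⨆ l : {l : ℝ // l < 0}, eigenspace T ((l : ℝ) : ℂ) :
      Submodule ℂ (L2Graph N)) ≤ B.card := by
  have h := rank_iSup_eigenspace_le (ι := B) (continuous_graphWell _ _ _ _ _) hT (fun j => j)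
    (fun _ => b) (fun _ => hb.le) fun F F' W c hs h0 h1 hB => by
      refine le_trans ?_ (form_plus_ge hp hr hb hs h0 h1 fun j hj => hB ⟨j, hj⟩)
      obtain ⟨d, hd, hd'⟩ := vertex_form_eq hp hr hb hα
      rw [hd']
      have : 0 < (B.card : ℝ) - Bᶜ.card := by
        have hτ : 0 < Real.tanh (p * r * b) := tanh_pos (by positivity)
        rw [hα] at hα0
        exact pos_of_mul_pos_left (pos_of_mul_pos_left hα0 hτ.le) hr.le
      have := Complex.normSq_nonneg c
      positivity
  rwa [Fintype.card_coe] at h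

/-- The extra index `none` stands for the vertex, seen as the point `0` of edge `0`; with `c = 0`
the sign of the vertex term no longer matters. -/
lemma rank_le_card_succ [NeZero N] (hp : 0 < p) (hr : 0 < r) (hb : 0 < b)
    (hT : ∀ v w, (v, w) ∈ T.graph ↔ InGraph α (graphWell (kappa p) p r b B) v w) :
    Module.rank ℂ (⨆ l : {l : ℝ // l < 0}, eigenspace T ((l : ℝ) : ℂ) :
      Submodule ℂ (L2Graph N)) ≤ (B.card + 1 : ℕ) := by
  have h := rank_iSup_eigenspace_le (ι := Option B) (continuous_graphWell _ _ _ _ _) hT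
    (fun i => i.elim 0 fun j => j) (fun i => i.elim 0 fun _ => b)
    (fun i => by cases i <;> simp [hb.le]) fun F F' W c hs h0 h1 hB => by
      refine le_trans ?_ (form_plus_ge hp hr hb hs h0 h1 fun j hj => hB (some ⟨j, hj⟩))
      have hc : c = 0 := (h0 0).symm.trans (hB none)
      simp [hc]
  rwa [Fintype.card_option, Fintype.card_coe] at h

lemma morseIndex_plus_of_pos (hp : 0 < p) (hr : 0 < r) (hb : 0 < b)
    (hT : ∀ v w, (v, w) ∈ T.graph ↔ InGraph α (graphWell (kappa p) p r b B) v w)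
    (hα : α = ((B.card : ℝ) - Bᶜ.card) * r * Real.tanh (p * r * b)) (hα0 : 0 < α)
    (hB : B.Nonempty) : morseIndex T = B.card ∧ ∃ l₁ ls : ℝ, l₁ < ls ∧ ls < 0 ∧
      multiplicity T (l₁ : ℂ) = 1 ∧ multiplicity T (ls : ℂ) = (B.card - 1 : ℕ) ∧
      ∀ l : ℝ, l < 0 → eigenspace T (l : ℂ) ≠ ⊥ → l = l₁ ∨ l = ls := by
  obtain ⟨ls, hls, hls0, hd, -⟩ := exists_dirichlet hp hr hb
  obtain ⟨l₁, hl₁, hc⟩ := exists_charFun_eq_zero_of_pos hp hr hα hα0 (by positivity)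
    (by positivity)
  have hlt := hl₁.trans hls
  have hpos := hB.card_pos
  obtain ⟨h1, h2, h3⟩ := morseIndex_eq_of_le
    (iSupIndep_eigenspace (continuous_graphWell _ _ _ _ _) hT)
    -- With a single bump `ls` gets multiplicity `0`; the count still adds up to `B.card`.
    (rank_le_of_pos hp hr hb hT hα hα0) {l₁, ls} (fun l => if l = ls then B.card - 1 else 1)
    (by
      simp only [Finset.mem_insert, Finset.mem_singleton, forall_eq_or_imp, forall_eq]
      exact ⟨hlt.trans hls0, hls0⟩)
    (by
      simp only [Finset.mem_insert, Finset.mem_singleton, forall_eq_or_imp, forall_eq, if_true,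
        hlt.ne, if_false]
      exact ⟨by simpa using one_le_multiplicity_of_charFun hp hr hb hT hB (hlt.trans hls0).le hc,
        card_sub_one_le_multiplicity hp hr hT hls0.le hd⟩)
    (by
      rw [Finset.sum_pair hlt.ne, if_neg hlt.ne, if_pos rfl]
      omega)
  refine ⟨h1, l₁, ls, hlt, hls0, ?_, ?_, fun l hl hne => ?_⟩
  · simpa [hlt.ne] using h2 l₁ (by simp)
  · simpa using h2 ls (by simp)
  · by_contra hcon
    exact hne (h3 l hl (by simpa using hcon))

lemma morseIndex_plus_of_neg [NeZero N] (hp : 0 < p) (hr : 0 < r) (hb : 0 < b)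
    (hT : ∀ v w, (v, w) ∈ T.graph ↔ InGraph α (graphWell (kappa p) p r b B) v w)
    (hα : α = ((B.card : ℝ) - Bᶜ.card) * r * Real.tanh (p * r * b)) (hα0 : α < 0)
    (hB : B.Nonempty) : morseIndex T = (B.card + 1 : ℕ) ∧ ∃ l₁ l₂ ls : ℝ, l₁ < ls ∧ ls < l₂ ∧
      l₂ < 0 ∧ multiplicity T (l₁ : ℂ) = 1 ∧ multiplicity T (l₂ : ℂ) = 1 ∧
      multiplicity T (ls : ℂ) = (B.card - 1 : ℕ) ∧
      ∀ l : ℝ, l < 0 → eigenspace T (l : ℂ) ≠ ⊥ → l = l₁ ∨ l = l₂ ∨ l = ls := by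
  have hpos := hB.card_pos
  obtain ⟨ls, hls, hls0, hd, hd'⟩ := exists_dirichlet hp hr hb
  obtain ⟨l₁, l₂, hl₁, hl₂, hl₂0, hc₁, hc₂⟩ := exists_charFun_eq_zero_of_neg hp hr hb hα hα0
    (by exact_mod_cast hpos) hls hls0 hd hd'
  have hl₁0 := hl₁.trans hls0
  obtain ⟨h1, h2, h3⟩ := morseIndex_eq_of_le
    (iSupIndep_eigenspace (continuous_graphWell _ _ _ _ _) hT)
    (rank_le_card_succ hp hr hb hT) {l₁, l₂, ls} (fun l => if l = ls then B.card - 1 else 1)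
    (by
      simp only [Finset.mem_insert, Finset.mem_singleton, forall_eq_or_imp, forall_eq]
      exact ⟨hl₁0, hl₂0, hls0⟩)
    (by
      simp only [Finset.mem_insert, Finset.mem_singleton, forall_eq_or_imp, forall_eq, if_true,
        hl₁.ne, hl₂.ne', if_false]
      exact ⟨by simpa using one_le_multiplicity_of_charFun hp hr hb hT hB hl₁0.le hc₁,
        by simpa using one_le_multiplicity_of_charFun hp hr hb hT hB hl₂0.le hc₂,
        card_sub_one_le_multiplicity hp hr hT hls0.le hd⟩)
    (by
      rw [Finset.sum_insert (by simp [(hl₁.trans hl₂).ne, hl₁.ne]), Finset.sum_pair hl₂.ne',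
        if_neg hl₁.ne, if_neg hl₂.ne', if_pos rfl]
      omega)
  refine ⟨h1, l₁, l₂, ls, hl₁, hl₂, hl₂0, ?_, ?_, ?_, fun l hl hne => ?_⟩
  · simpa [hl₁.ne] using h2 l₁ (by simp)
  · simpa [hl₂.ne'] using h2 l₂ (by simp)
  · simpa using h2 ls (by simp)
  · by_contra hcon
    exact hne (h3 l hl (by simpa using hcon))

lemma morseIndex_plus_of_empty [NeZero N] (hp : 0 < p) (hr : 0 < r) (hb : 0 < b)
    (hT : ∀ v w, (v, w) ∈ T.graph ↔ InGraph α (graphWell (kappa p) p r b ∅) v w)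
    (hα : α = (0 - N) * r * Real.tanh (p * r * b)) (hα0 : α < 0) : morseIndex T = 1 := by
  obtain ⟨l, hl, h⟩ := exists_tail_eigenvalue hp hr hb hα hα0
  have hm : 1 ≤ multiplicity T (l : ℂ) :=
    one_le_multiplicity_of_coeff hp hr hT hl.le (fun _ => 1) (decaying p r l b)
      (fun j => by simp [edgeShift]) (by simp [edgeShift, h]) (j := 0) one_ne_zero
  have := (morseIndex_eq_of_le (iSupIndep_eigenspace (continuous_graphWell _ _ _ _ _) hT)
    (rank_le_card_succ hp hr hb hT) {l} (fun _ => 1) (by simpa using hl) (by simpa using hm)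
    (by simp)).1
  simpa using this

lemma exists_kernel_solvesEdge {V : Fin N → ℝ → ℝ} (hV : ∀ j, Continuous (V j))
    (hT : ∀ v w, (v, w) ∈ T.graph ↔ InGraph α V v w) {u : L2Graph N} (hu : u ∈ eigenspace T 0) :
    ∃ (F F' : Fin N → ℝ → ℂ) (c : ℂ), (∀ j, SolvesEdge (V j) (F j) (F' j) fun _ => 0) ∧
      (∀ j, IsRep (F j) (u j)) ∧ (∀ j, F j 0 = c) ∧ ∑ j, F' j 0 = α * c := by
  rw [mem_eigenspace_iff_inGraph hT, zero_smul] at hu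
  exact hu.exists_solvesEdge hV fun _ => isRep_zero

/-- A kernel element whose edgewise logarithmic derivatives at the vertex are prescribed and which
vanishes at the vertex is zero. -/
lemma eq_zero_of_kernel {V : Fin N → ℝ → ℝ} {C : ℝ} (hV : ∀ j x, |V j x| ≤ C) {u : L2Graph N}
    {F F' : Fin N → ℝ → ℂ} (hs : ∀ j, SolvesEdge (V j) (F j) (F' j) fun _ => 0)
    (hF : ∀ j, IsRep (F j) (u j)) {m : Fin N → ℝ} (hm : ∀ j, F' j 0 = m j * F j 0)
    (h0 : ∀ j, F j 0 = 0) : u = 0 := by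
  ext1 j
  exact (hF j).eq_zero ((hs j).eq_zero (hV j) (h0 j) (by rw [hm, h0, mul_zero]))

/-- Vanishing Wronskians with `φ'` fix the logarithmic derivatives, and the `δ` condition becomes
`(B - T) d c = 0`. As `α ≠ 0` gives `B ≠ T`, both data vanish at the vertex. -/
lemma degeneracyIndex_plus (hp : 0 < p) (hr : 0 < r) (hb : 0 < b)
    (hT : ∀ v w, (v, w) ∈ T.graph ↔ InGraph α (graphWell (kappa p) p r b B) v w)
    (hα : α = ((B.card : ℝ) - Bᶜ.card) * r * Real.tanh (p * r * b)) (hα0 : α ≠ 0) :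
    degeneracyIndex T = 0 := by
  rw [degeneracyIndex, multiplicity_eq_zero_iff, Submodule.eq_bot_iff]
  intro u hu
  obtain ⟨F, F', c, hs, hF, h0, h1⟩ :=
    exists_kernel_solvesEdge (continuous_graphWell _ _ _ _ _) hT hu
  obtain ⟨e1, e2, e3, e4⟩ := decaying_data_zero hp hr hb
  have hm : ∀ j, F' j 0 = ((if j ∈ B then -logDerivSoliton' p r b
      else logDerivSoliton' p r b : ℝ) : ℂ) * F j 0 := by
    intro j
    have hG := solvesEdge_decaying hp hr le_rfl (edgeShift b B j) 0
    simp only [sub_zero, Complex.ofReal_zero, zero_mul] at hG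
    refine (hs j).deriv_zero_eq hG ?_ ?_
    · simp only [zero_add, edgeShift]
      split_ifs
      exacts [e2.ne, e1.ne']
    · simp only [zero_add, edgeShift]
      split_ifs
      exacts [e4, e3]
  refine eq_zero_of_kernel (abs_graphWell_le _ _ _ _ _) hs hF hm fun j => ?_
  have h2 : ((∑ j, if j ∈ B then -logDerivSoliton' p r b else logDerivSoliton' p r b : ℝ) : ℂ) * c =
      α * c := by
    rw [← h1, Complex.ofReal_sum, Finset.sum_mul]
    exact Finset.sum_congr rfl fun j _ => by rw [hm, h0]
  obtain ⟨d, hd, hd'⟩ := vertex_form_eq hp hr hb hα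
  rw [sum_ite_mem_eq, ← sub_eq_zero, ← sub_mul] at h2
  rw [h0]
  refine (mul_eq_zero.1 h2).resolve_left ?_
  have h3 : (B.card : ℝ) * -logDerivSoliton' p r b + Bᶜ.card * logDerivSoliton' p r b - α =
      -(((B.card : ℝ) - Bᶜ.card) * d) := by linarith
  rw [← Complex.ofReal_sub, h3]
  have h4 : (B.card : ℝ) - Bᶜ.card ≠ 0 := fun h => hα0 (by rw [hα, h, zero_mul, zero_mul])
  exact_mod_cast neg_ne_zero.2 (mul_ne_zero h4 hd.ne')

/-! ### Morse and degeneracy indices of `L₋`. -/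

section Minus

lemma sum_logDerivSoliton_edgeShift
    (hα : α = ((B.card : ℝ) - Bᶜ.card) * r * Real.tanh (p * r * b)) :
    ∑ j, logDerivSoliton p r (edgeShift b B j) = α := by
  have : ∀ j, logDerivSoliton p r (edgeShift b B j) =
      if j ∈ B then r * Real.tanh (p * r * b) else -(r * Real.tanh (p * r * b)) := fun j => by
    unfold edgeShift logDerivSoliton
    split_ifs <;> simp
  simp only [this]
  rw [sum_ite_mem_eq, hα]
  ring

lemma morseIndex_minus
    (hT : ∀ v w, (v, w) ∈ T.graph ↔ InGraph α (graphWell (p + 1) p r b B) v w)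
    (hα : α = ((B.card : ℝ) - Bᶜ.card) * r * Real.tanh (p * r * b)) : morseIndex T = 0 := by
  -- No vanishing condition is imposed: the logarithmic derivatives of the soliton sum to `α`, so
  -- the vertex term cancels exactly.
  have h := rank_iSup_eigenspace_le (ι := Empty) (continuous_graphWell _ _ _ _ _) hT
    (fun i => i.elim) (fun i => i.elim) (fun i => i.elim) fun F F' W c hs h0 h1 _ => by
      have e := vertex_sum_eq h0 h1 fun j => -logDerivSoliton p r (edgeShift b B j)
      rw [Finset.sum_neg_distrib, sum_logDerivSoliton_edgeShift hα, add_neg_cancel, zero_mul] at e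
      refine e.ge.trans (Finset.sum_le_sum fun j _ => ?_)
      have := (hs j).form_minus_ge
      linarith
  have := (morseIndex_eq_of_le (iSupIndep_eigenspace (continuous_graphWell _ _ _ _ _) hT) h ∅
    (fun _ => 1) (by simp) (by simp) (by simp)).1
  simpa using this

/-- The soliton, shifted, as a solution on the half-line. -/
lemma solvesEdge_sechPow (hp : 0 < p) (hr : 0 < r) (a : ℝ) :
    SolvesEdge (fun x => well (p + 1) p r (x + a))
      (fun x => (sechPow (1 / p) (p * r) (x + a) : ℂ))
      (fun x => ((logDerivSoliton p r (x + a) * sechPow (1 / p) (p * r) (x + a) : ℝ) : ℂ))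
      fun _ => 0 := by
  have hd : ∀ y, HasDerivAt (sechPow (1 / p) (p * r))
      (logDerivSoliton p r y * sechPow (1 / p) (p * r) y) y := fun y =>
    (hasDerivAt_sechPow _ _ y).congr_deriv (by rw [logDerivSoliton]; field_simp)
  have hd' : ∀ y, HasDerivAt (fun y => logDerivSoliton p r y * sechPow (1 / p) (p * r) y)
      (well (p + 1) p r y * sechPow (1 / p) (p * r) y) y := fun y =>
    ((hasDerivAt_logDerivSoliton p r y).mul (hd y)).congr_deriv (by ring)
  have hc : Continuous (sechPow (1 / p) (p * r)) :=
    continuous_iff_continuousAt.2 fun y => (hd y).continuousAt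
  have hc' : Continuous fun y => logDerivSoliton p r y * sechPow (1 / p) (p * r) y :=
    continuous_iff_continuousAt.2 fun y => (hd' y).continuousAt
  have hbd : ∀ y, sechPow (1 / p) (p * r) y ≤ 2 ^ (1 / p) * Real.exp (-(r * y)) := fun y => by
    have h1 : Real.exp (p * r * y) / 2 ≤ Real.cosh (p * r * y) := by
      rw [Real.cosh_eq]
      have := Real.exp_pos (-(p * r * y))
      linarith
    refine (Real.rpow_le_rpow_of_nonpos (by positivity) h1 (by simp [hp.le])).trans_eq ?_
    rw [Real.div_rpow (Real.exp_pos _).le zero_le_two, ← Real.exp_mul,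
      Real.rpow_neg zero_le_two (1 / p), div_inv_eq_mul, mul_comm]
    congr 2
    field_simp
  have he : ∀ x, (2 : ℝ) ^ (1 / p) * Real.exp (-(r * (x + a))) =
      2 ^ (1 / p) * Real.exp (-(r * a)) * Real.exp (-(r * x)) := fun x => by
    rw [mul_assoc, ← Real.exp_add]
    ring_nf
  have hbd1 : ∀ x, |sechPow (1 / p) (p * r) (x + a)| ≤
      2 ^ (1 / p) * Real.exp (-(r * a)) * Real.exp (-(r * x)) := fun x => by
    rw [← he, abs_of_pos (sechPow_pos _ _ _)]
    exact hbd _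
  have hca : Continuous fun x => sechPow (1 / p) (p * r) (x + a) := hc.comp (by fun_prop)
  have hca' : Continuous fun x => logDerivSoliton p r (x + a) * sechPow (1 / p) (p * r) (x + a) :=
    hc'.comp (continuous_id.add continuous_const)
  refine ⟨(Complex.continuous_ofReal.comp hca).continuousOn,
    (Complex.continuous_ofReal.comp hca').continuousOn, continuousOn_const,
    memLp_of_exp_bound hca hr fun x _ => hbd1 x,
    memLp_of_exp_bound (C := r * (2 ^ (1 / p) * Real.exp (-(r * a)))) hca' hr fun x _ => ?_,
    MemLp.zero', fun x _ => ((hd (x + a)).comp_add_const x a).ofReal_comp, fun x _ => ?_⟩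
  · rw [abs_mul, mul_assoc]
    refine mul_le_mul ?_ (hbd1 x) (abs_nonneg _) hr.le
    rw [logDerivSoliton, abs_mul, abs_neg, abs_of_pos hr]
    exact mul_le_of_le_one_right hr.le (Real.abs_tanh_lt_one _).le
  · refine ((hd' (x + a)).comp_add_const x a).ofReal_comp.congr_deriv ?_
    push_cast
    ring

lemma sechPow_edgeShift (β s b : ℝ) (B : Finset (Fin N)) (j : Fin N) :
    sechPow β s (edgeShift b B j) = sechPow β s b := by
  unfold edgeShift
  split_ifs
  exacts [sechPow_neg_arg _ _ _, rfl]

lemma degeneracyIndex_minus [NeZero N] (hp : 0 < p) (hr : 0 < r)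
    (hT : ∀ v w, (v, w) ∈ T.graph ↔ InGraph α (graphWell (p + 1) p r b B) v w)
    (hα : α = ((B.card : ℝ) - Bᶜ.card) * r * Real.tanh (p * r * b)) : degeneracyIndex T = 1 := by
  have hG := fun j => solvesEdge_sechPow hp hr (edgeShift b B j)
  refine le_antisymm ?_ ?_
  -- A kernel element is determined by its vertex value, since its edge derivatives there are fixed
  -- multiples of it.
  · have : Module.rank ℂ (eigenspace T 0) ≤ Fintype.card Unit :=
      rank_le_card_of_values _ (fun _ => 0) (fun _ => 0)
        (fun v hv i => by
          obtain ⟨F, -, -, -, hF, -⟩ :=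
            exists_kernel_solvesEdge (continuous_graphWell _ _ _ _ _) hT hv
          exact ⟨F i, hF i⟩)
        (fun v hv h => by
          obtain ⟨F, F', c, hs, hF, h0, h1⟩ :=
            exists_kernel_solvesEdge (continuous_graphWell _ _ _ _ _) hT hv
          refine eq_zero_of_kernel (abs_graphWell_le _ _ _ _ _) hs hF (fun j =>
            (hs j).deriv_zero_eq (hG j) (sechPow_pos _ _ _).ne' rfl) fun j => ?_
          obtain ⟨G, hG, hG0⟩ := h ()
          rw [h0, ← h0 0, (hF 0).eqOn hG self_mem_Ici, hG0])
    rw [Fintype.card_unit, Nat.cast_one] at this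
    simpa [degeneracyIndex, multiplicity] using this
  · rw [degeneracyIndex, Order.one_le_iff_ne_zero, Ne, multiplicity_eq_zero_iff,
      Submodule.eq_bot_iff]
    intro h
    have hrep := fun j => isRep_toLp (hG j).cont (hG j).mem
    have h0 := h (WithLp.toLp 2 fun j => (hG j).mem.toLp) (by
      rw [mem_eigenspace_iff_inGraph hT, zero_smul]
      refine inGraph_of_solvesEdge (c := sechPow (1 / p) (p * r) b)
        (continuous_graphWell _ _ _ _ _) (fun j => ⟨_, abs_graphWell_le _ _ _ _ _ j⟩) hG hrep
        (fun _ => isRep_zero) (fun j => by rw [zero_add, sechPow_edgeShift]) ?_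
      simp only [zero_add, sechPow_edgeShift]
      rw [← Complex.ofReal_sum, ← Finset.sum_mul, sum_logDerivSoliton_edgeShift hα,
        Complex.ofReal_mul])
    have h1 : (hG 0).mem.toLp = 0 := congrArg (fun v : L2Graph N => v 0) h0
    have h2 := hrep 0
    rw [h1] at h2
    have h3 := h2.eqOn isRep_zero self_mem_Ici
    exact (sechPow_pos (1 / p) (p * r) (0 + edgeShift b B 0)).ne' (Complex.ofReal_eq_zero.1 h3)

end Minus

end Graph

/-! ### From the stationary state to bumps and tails. -/

lemma soliton_rpow {p ω : ℝ} (hp : 0 < p) (hω : 0 < ω) (y : ℝ) :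
    soliton p ω y ^ (2 * p) = ω * (1 - Real.tanh (p * √ω * y) ^ 2) := by
  have hc := Real.cosh_pos (p * √ω * y)
  have e1 : 1 / (2 * p) * (2 * p) = 1 := by field_simp
  have e2 : 1 / p * (2 * p) = (2 : ℕ) := by push_cast; field_simp
  rw [soliton, Real.mul_rpow (by positivity) (by positivity), ← Real.rpow_mul hω.le,
    ← Real.rpow_mul (by positivity), e1, e2, Real.rpow_one, Real.rpow_natCast,
    Real.tanh_eq_sinh_div_cosh]
  have := Real.cosh_sq (p * √ω * y)
  field_simp
  linarith

lemma mem_graph_hessian_iff {κ p α ω b : ℝ} {N : ℕ} {S B : Finset (Fin N)} (hp : 0 < p)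
    (hω : 0 < ω)
    (hB : ∀ j, edgeShift b B j =
      if j ∈ S then shift p α ω N S.card else -shift p α ω N S.card) (v w : L2Graph N) :
    (v, w) ∈ (hessian κ p α ω S).graph ↔ InGraph α (graphWell κ p (√ω) b B) v w := by
  have : (fun (j : Fin N) (t : ℝ) => ω - κ * stationaryState p α ω S j t ^ (2 * p)) =
      graphWell κ p (√ω) b B := by
    ext j t
    unfold graphWell stationaryState
    rw [hB]
    split_ifs <;> rw [soliton_rpow hp hω, well, Real.sq_sqrt hω.le] <;> ring_nf
  rw [graph_hessian, mem_hessianGraph_iff, this]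

/-- The position of the vertex relative to the bumps and tails of the stationary state. -/
lemma exists_edgeShift_eq {p α ω : ℝ} {N : ℕ} (hp : 0 < p) (hα : α ≠ 0) (S : Finset (Fin N))
    (hS : 0 < (N : ℝ) - 2 * S.card) (hω : α ^ 2 / ((N : ℝ) - 2 * S.card) ^ 2 < ω) :
    ∃ b > 0, ∃ B : Finset (Fin N), (α < 0 → B = S) ∧ (0 < α → B = Sᶜ) ∧
      (∀ j, edgeShift b B j =
        if j ∈ S then shift p α ω N S.card else -shift p α ω N S.card) ∧
      α = ((B.card : ℝ) - Bᶜ.card) * √ω * Real.tanh (p * √ω * b) := by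
  have hω0 : 0 < ω := lt_of_le_of_lt (by positivity) hω
  have hr : 0 < √ω := Real.sqrt_pos.2 hω0
  have hsq := Real.sq_sqrt hω0.le
  have hmul : 0 < ((N : ℝ) - 2 * S.card) * √ω := mul_pos hS hr
  -- The lower bound on `ω` places the argument of `artanh` in `(-1, 1)`.
  have habs : |α| < ((N : ℝ) - 2 * S.card) * √ω := by
    refine abs_lt_of_sq_lt_sq ?_ hmul.le
    rw [div_lt_iff₀ (by positivity)] at hω
    rw [mul_pow, hsq]
    linarith
  obtain ⟨hlo, hhi⟩ := abs_lt.1 habs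
  have hcard : (Sᶜ.card : ℝ) = N - S.card := by
    have h := Finset.card_add_card_compl S
    rw [Fintype.card_fin] at h
    have h' : (S.card : ℝ) + Sᶜ.card = N := by exact_mod_cast h
    linarith
  have htanh : Real.tanh (p * √ω * shift p α ω N S.card) =
      α / (((N : ℝ) - 2 * S.card) * √ω) := by
    rw [shift, mul_div_cancel₀ _ (by positivity)]
    exact Real.tanh_artanh ⟨by rw [lt_div_iff₀ hmul]; linarith, by rw [div_lt_one hmul]; exact hhi⟩
  have hpos : ∀ y, 0 < Real.tanh (p * √ω * y) → 0 < y := fun y hy => by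
    by_contra hcon
    have := tanh_mono (mul_nonpos_of_nonneg_of_nonpos (mul_pos hp hr).le (not_lt.1 hcon))
    rw [Real.tanh_zero] at this
    linarith
  have key : α = ((N : ℝ) - 2 * S.card) * √ω * Real.tanh (p * √ω * shift p α ω N S.card) := by
    rw [htanh, mul_div_cancel₀ _ hmul.ne']
  rcases hα.lt_or_gt with h | h
  · refine ⟨-shift p α ω N S.card, hpos _ ?_, S, fun _ => rfl, fun h' => absurd h' h.not_gt,
      fun j => by simp [edgeShift], ?_⟩
    · rw [mul_neg, Real.tanh_neg, htanh]
      exact neg_pos.2 (div_neg_of_neg_of_pos h hmul)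
    · rw [mul_neg, Real.tanh_neg, hcard]
      linear_combination key
  · refine ⟨shift p α ω N S.card, hpos _ ?_, Sᶜ, fun h' => absurd h' h.not_gt, fun _ => rfl,
      fun j => by simp [edgeShift, Finset.mem_compl, ite_not], ?_⟩
    · rw [htanh]
      exact div_pos h hmul
    · rw [hcard, compl_compl]
      linear_combination key

end

end StarGraph

theorem theorem1 (p α ω : ℝ) (N K : ℕ) (hp : 0 < p) (hα : α ≠ 0) (hN : 1 ≤ N)
    (hK : K ≤ (N - 1) / 2) (hω : α ^ 2 / ((N : ℝ) - 2 * K) ^ 2 < ω)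
    (S : Finset (Fin N)) (hS : S.card = K) :
    (StarGraph.degeneracyIndex (StarGraph.Lminus p α ω S) = 1 ∧
      StarGraph.morseIndex (StarGraph.Lminus p α ω S) = 0) ∧
    (StarGraph.degeneracyIndex (StarGraph.Lplus p α ω S) = 0 ∧
      (α < 0 → StarGraph.morseIndex (StarGraph.Lplus p α ω S) = (K + 1 : ℕ)) ∧
      (0 < α → StarGraph.morseIndex (StarGraph.Lplus p α ω S) = (N - K : ℕ))) ∧
    (α < 0 → 1 ≤ K → ∃ l₁ l₂ ls : ℝ, l₁ < ls ∧ ls < l₂ ∧ l₂ < 0 ∧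
      StarGraph.multiplicity (StarGraph.Lplus p α ω S) (l₁ : ℂ) = 1 ∧
      StarGraph.multiplicity (StarGraph.Lplus p α ω S) (l₂ : ℂ) = 1 ∧
      StarGraph.multiplicity (StarGraph.Lplus p α ω S) (ls : ℂ) = (K - 1 : ℕ) ∧
      ∀ l : ℝ, l < 0 → StarGraph.eigenspace (StarGraph.Lplus p α ω S) (l : ℂ) ≠ ⊥ →
        l = l₁ ∨ l = l₂ ∨ l = ls) ∧
    (0 < α → ∃ l₁ ls : ℝ, l₁ < ls ∧ ls < 0 ∧
      StarGraph.multiplicity (StarGraph.Lplus p α ω S) (l₁ : ℂ) = 1 ∧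
      StarGraph.multiplicity (StarGraph.Lplus p α ω S) (ls : ℂ) = (N - K - 1 : ℕ) ∧
      ∀ l : ℝ, l < 0 → StarGraph.eigenspace (StarGraph.Lplus p α ω S) (l : ℂ) ≠ ⊥ →
        l = l₁ ∨ l = ls) := by
  subst hS
  have : NeZero N := ⟨by omega⟩
  have hNK : 0 < (N : ℝ) - 2 * S.card := by
    -- The integer division in `hK`, together with `1 ≤ N`, gives a strict inequality.
    have : 2 * S.card < N := by omega
    have : (2 * S.card : ℝ) < N := by exact_mod_cast this
    linarith
  have hω0 : 0 < ω := lt_of_le_of_lt (by positivity) hω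
  have hr : 0 < √ω := Real.sqrt_pos.2 hω0
  obtain ⟨b, hb, B, hneg, hpos, hB, hv⟩ := StarGraph.exists_edgeShift_eq hp hα S hNK hω
  have hTp : ∀ v w, (v, w) ∈ (StarGraph.Lplus p α ω S).graph ↔ _ :=
    StarGraph.mem_graph_hessian_iff hp hω0 hB
  have hTm : ∀ v w, (v, w) ∈ (StarGraph.Lminus p α ω S).graph ↔ _ :=
    StarGraph.mem_graph_hessian_iff hp hω0 hB
  have hcard : Sᶜ.card = N - S.card := by rw [Finset.card_compl, Fintype.card_fin]
  have hplus : 0 < α → _ := fun h => by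
    rw [hpos h] at hTp hv
    have hne : Sᶜ.Nonempty := Finset.card_pos.1 (by omega)
    exact StarGraph.morseIndex_plus_of_pos hp hr hb hTp hv h hne
  have hminus : α < 0 → S.Nonempty → _ := fun h hne => by
    rw [hneg h] at hTp hv
    exact StarGraph.morseIndex_plus_of_neg hp hr hb hTp hv h hne
  refine ⟨⟨StarGraph.degeneracyIndex_minus hp hr hTm hv, StarGraph.morseIndex_minus hTm hv⟩,
    ⟨StarGraph.degeneracyIndex_plus hp hr hb hTp hv hα, fun h => ?_, fun h => ?_⟩,
    fun h hK1 => ?_, fun h => ?_⟩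
  -- With no bump the zeros of `charFun` need not give eigenvectors, so `K = 0` uses the tail
  -- eigenvalue instead.
  · rcases S.eq_empty_or_nonempty with hS | hS
    · have e := hneg h
      subst e
      subst hS
      have := StarGraph.morseIndex_plus_of_empty hp hr hb hTp (by simpa using hv) h
      simpa using this
    · exact (hminus h hS).1
  · rw [← hcard]
    exact (hplus h).1
  · exact (hminus h (Finset.card_pos.1 hK1)).2
  · rw [← hcard]
    exact (hplus h).2
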